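/- Let $n\ge 3$ and let $\mathrm{D}_n^{\mathrm{IV}}=\{z\in\mathbb{C}^n : |z|<1,\ 2|z|^2<1+|z^\top z|^2\}$ be the Cartan domain of type IV. For a real number $\lambda>n-1$ let $v_\lambda$ be the probability measure on $\mathrm{D}_n^{\mathrm{IV}}$ proportional to $(1-2|z|^2+|z^\top z|^2)^{\lambda-n}\,dz$ ($dz$ being Lebesgue measure), and let $\mathcal{A}^2_\lambda(\mathrm{D}_n^{\mathrm{IV}})\subset L^2(v_\lambda)$ be the weighted Bergman space of holomorphic functions on $\mathrm{D}_n^{\mathrm{IV}}$ that belong to $L^2(v_\lambda)$. Identify $\mathrm{SO}(2)$ with the unit circle in $\mathbb{C}$, and let $\pi_\lambda$ be the unitary representation of $\mathrm{SO}(n)\times\mathrm{SO}(2)$ on $\mathcal{A}^2_\lambda(\mathrm{D}_n^{\mathrm{IV}})$ given by $(\pi_\lambda(A,t)f)(z)=f(\bar t A^{-1}z)$. For $m\in\mathbb{N}=\{0,1,2,\dots\}$ let $\mathcal{H}^m(\mathbb{C}^n)$ be the space of complex polynomials $p$ on $\mathbb{C}^n$, homogeneous of degree $m$, with $\sum_{j}\partial^2p/\partial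 z_j^2=0$, with the $\mathrm{SO}(n)$-action $(A\cdot p)(z)=p(A^{-1}z)$, and let $\mathbb{C}_m$ be the one-dimensional $\mathrm{SO}(2)$-module given by the character $t\mapsto t^{-m}$. For weights of $\mathrm{SO}(n)$ use the Cartan subalgebra of $\mathfrak{so}(n,\mathbb{C})$ formed by the block diagonal matrices $H(b)=\mathrm{diag}(ib_1R,\dots,ib_\ell R)$ (with a trailing $0$ if $n$ is odd), where $\ell=\lfloor n/2\rfloor$, $b\in\mathbb{C}^\ell$ and $R=\begin{pmatrix}0&1\\-1&0\end{pmatrix}$, the functionals $e_j(H(b))=b_j$, and the lexicographic order on roots with respect to $e_1,\dots,e_\ell$. A weight $\mu$ of a module is its highest weight if for every weight $\nu$ of the module the difference $\mu-\nu$ is a (possibly empty) sum of positive roots; a highest weight vector is a non-zero vector of the highest weight space. Then the isotypic decomposition of $\pi_\lambda$ (the Hilbert direct sum of the sums of all irreducible subspaces of a given isomorphism type) is $$\mathcal{A}^2_\lambda(\mathrm{D}_n^{\mathrm{IV}})=\bigoplus_{k_1,k_2\in\mathbb{N}}\mathcal{H}^{k_1}(\mathbb{C}^n)\,(z^\top z)^{k_2}.$$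 Furthermore: 1. For every $k_1,k_2\in\mathbb{N}$, the subspace $\mathcal{H}^{k_1}(\mathbb{C}^n)(z^\top z)^{k_2}$ is an irreducible $\mathrm{SO}(n)$-module isomorphic to $\mathcal{H}^{k_1}(\mathbb{C}^n)$; its highest weight is $k_1e_1$, and $(z_1-iz_2)^{k_1}(z^\top z)^{k_2}$ is a highest weight vector. 2. For every $k_1,k_2\in\mathbb{N}$, the subspace $\mathcal{H}^{k_1}(\mathbb{C}^n)(z^\top z)^{k_2}$ is an irreducible module over $\mathrm{SO}(n)\times\mathrm{SO}(2)$, isomorphic to the outer tensor product $\mathcal{H}^{k_1}(\mathbb{C}^n)\otimes\mathbb{C}_{k_1+2k_2}$. 3. The decomposition is multiplicity-free, that is, every isotypic component is irreducible. -/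

import Mathlib

open MeasureTheory
open scoped TensorProduct

noncomputable section

namespace BergmanIV

/-! ### Unitary representations on (pre-)Hilbert spaces -/

section UnitaryRep

variable {G E : Type*} [Group G] [NormedAddCommGroup E] [InnerProductSpace ℂ E]

/-- `V` is an irreducible (non-zero, closed, invariant) subspace of a unitary representation:
it contains no closed invariant subspaces other than `0` and itself. -/
structure IsIrreducibleSubspace (π : G →* (E ≃ₗᵢ[ℂ] E)) (V : Submodule ℂ E) : Prop where
  isClosed : IsClosed (V : Set E)
  invariant : ∀ g, ∀ v ∈ V, π g v ∈ V
  ne_bot : V ≠ ⊥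
  minimal : ∀ W : Submodule ℂ E, W ≤ V → IsClosed (W : Set E) →
    (∀ g, ∀ w ∈ W, π g w ∈ W) → W = ⊥ ∨ W = V

/-- Unitary equivalence of two invariant subspaces: there is an intertwining unitary map
from `V` onto `W`. -/
def UnitarilyEquivalent (π : G →* (E ≃ₗᵢ[ℂ] E)) (V W : Submodule ℂ E) : Prop :=
  ∃ e : V ≃ₗᵢ[ℂ] W, ∀ (g : G) (v v' : V), (v' : E) = π g v → (e v' : E) = π g (e v)

/-- The module `σ` is isomorphic to the subspace `V` of the unitary representation `π`:
there is an equivariant linear isomorphism onto `V` (in particular `V` is invariant). -/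
def IsModuleIso {M : Type*} [AddCommGroup M] [Module ℂ M] (σ : Representation ℂ G M)
    (π : G →* (E ≃ₗᵢ[ℂ] E)) (V : Submodule ℂ E) : Prop :=
  ∃ e : M ≃ₗ[ℂ] V, ∀ (g : G) (x : M), (e (σ g x) : E) = π g (e x)

/-- `H` is the isotypic decomposition of the unitary representation `π` on `E`: there are
mutually inequivalent irreducible subspaces `V j` such that `H j` is the sum of all irreducible
subspaces equivalent to `V j`, each `H j` is closed, and the Hilbert space `E` is the Hilbert
direct sum of the `H j`, which are preserved by the group. -/
structure IsIsotypicDecomposition {ι : Type*} (π : G →* (E ≃ₗᵢ[ℂ] E))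
    (H : ι → Submodule ℂ E) : Prop where
  isotypic : ∃ V : ι → Submodule ℂ E,
    (∀ j, IsIrreducibleSubspace π (V j)) ∧
    (∀ i j, i ≠ j → ¬ UnitarilyEquivalent π (V i) (V j)) ∧
    ∀ j, H j = sSup {W | IsIrreducibleSubspace π W ∧ UnitarilyEquivalent π (V j) W}
  isClosed : ∀ j, IsClosed (H j : Set E)
  invariant : ∀ j g, ∀ v ∈ H j, π g v ∈ H j
  hilbertSum : ∃ _ : CompleteSpace E,
    IsHilbertSum ℂ (fun j => H j) (fun j => (H j).subtypeₗᵢ)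

/-- An isotypic decomposition is multiplicity-free when every isotypic component is
irreducible. -/
def IsMultiplicityFree {ι : Type*} (π : G →* (E ≃ₗᵢ[ℂ] E)) (H : ι → Submodule ℂ E) : Prop :=
  IsIsotypicDecomposition π H ∧ ∀ j, IsIrreducibleSubspace π (H j)

end UnitaryRep

/-- The outer tensor product of a `G`-module and an `H`-module, as a `G × H`-module. -/
def outerTensor {G H M N : Type*} [Group G] [Group H] [AddCommGroup M] [Module ℂ M]
    [AddCommGroup N] [Module ℂ N] (ρ : Representation ℂ G M) (σ : Representation ℂ H N) :
    Representation ℂ (G × H) (M ⊗[ℂ] N) :=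
  Representation.tprod (MonoidHom.comp ρ (MonoidHom.fst G H))
    (MonoidHom.comp σ (MonoidHom.snd G H))

/-! ### The groups -/

/-- `SO(n)`. -/
abbrev SO (n : ℕ) : Type := Matrix.specialOrthogonalGroup (Fin n) ℝ

/-- `SO(n) × SO(2)`, with `SO(2)` identified with the unit circle of `ℂ`. -/
abbrev SOxSO2 (n : ℕ) : Type := SO n × Circle

/-- A real matrix of `SO(n)` viewed as a complex matrix. -/
def complexMatrix {n : ℕ} (A : SO n) : Matrix (Fin n) (Fin n) ℂ :=
  (A : Matrix (Fin n) (Fin n) ℝ).map Complex.ofRealHom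

lemma complexMatrix_one {n : ℕ} : complexMatrix (1 : SO n) = 1 := by
  simp [complexMatrix]

lemma complexMatrix_mul {n : ℕ} (A B : SO n) :
    complexMatrix (A * B) = complexMatrix A * complexMatrix B := by
  simp only [complexMatrix, Submonoid.coe_mul]
  exact Matrix.map_mul

lemma complexMatrix_mul_transpose {n : ℕ} (A : SO n) :
    complexMatrix A * (complexMatrix A).transpose = 1 := by
  have h : (A : Matrix (Fin n) (Fin n) ℝ) * (A : Matrix (Fin n) (Fin n) ℝ).transpose = 1 := by
    have := (Matrix.mem_specialOrthogonalGroup_iff.1 A.2).1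
    simpa [Matrix.star_eq_conjTranspose] using (Matrix.mem_orthogonalGroup_iff (Fin n) ℝ).1 this
  have h2 := congrArg (fun M : Matrix (Fin n) (Fin n) ℝ => M.map Complex.ofRealHom) h
  simp only [Matrix.map_mul] at h2
  rw [Matrix.map_one _ (map_zero _) (map_one _)] at h2
  simpa only [complexMatrix, Matrix.transpose_map] using h2

lemma complexMatrix_transpose_mul {n : ℕ} (A : SO n) :
    (complexMatrix A).transpose * complexMatrix A = 1 :=
  mul_eq_one_comm.1 (complexMatrix_mul_transpose A)

lemma complexMatrix_sum {n : ℕ} (A : SO n) (k l : Fin n) :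
    ∑ i, complexMatrix A k i * complexMatrix A l i = if k = l then 1 else 0 := by
  have := congrFun (congrFun (complexMatrix_mul_transpose A) k) l
  simpa [Matrix.mul_apply, Matrix.one_apply] using this

/-! ### Harmonic polynomials as an `SO(n)`-module -/

/-- The polynomial `zᵀz = z₁² + ⋯ + zₙ²`. -/
def quad (n : ℕ) : MvPolynomial (Fin n) ℂ := ∑ j, MvPolynomial.X j ^ 2

/-- The holomorphic Laplacian `∑ ∂²/∂zⱼ²`. -/
def laplacian (n : ℕ) : MvPolynomial (Fin n) ℂ →ₗ[ℂ] MvPolynomial (Fin n) ℂ :=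
  ∑ j, (MvPolynomial.pderiv j).toLinearMap ∘ₗ (MvPolynomial.pderiv j).toLinearMap

/-- The space of harmonic polynomials that are homogeneous of degree `m`. -/
def harmonic (n m : ℕ) : Submodule ℂ (MvPolynomial (Fin n) ℂ) :=
  LinearMap.ker (laplacian n) ⊓ MvPolynomial.homogeneousSubmodule (Fin n) ℂ m

/-- Linear substitution of variables: `p(z) ↦ p(B z)`. -/
def subst {n : ℕ} (B : Matrix (Fin n) (Fin n) ℂ) :
    MvPolynomial (Fin n) ℂ →ₐ[ℂ] MvPolynomial (Fin n) ℂ :=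
  MvPolynomial.aeval fun i => ∑ j, MvPolynomial.C (B i j) * MvPolynomial.X j

/-- The action of `SO(n)` on polynomials, `(A · p)(z) = p(A⁻¹ z)`. -/
def polyRep (n : ℕ) : Representation ℂ (SO n) (MvPolynomial (Fin n) ℂ) where
  toFun A := (subst (complexMatrix A⁻¹)).toLinearMap
  map_one' := by
    have : subst (complexMatrix (1 : SO n)) = AlgHom.id ℂ _ := by
      apply MvPolynomial.algHom_ext
      intro i
      simp [subst, complexMatrix_one, Matrix.one_apply]
    rw [inv_one, this]
    rfl
  map_mul' A B := by
    have : subst (complexMatrix (A * B)⁻¹) =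
        (subst (complexMatrix A⁻¹)).comp (subst (complexMatrix B⁻¹)) := by
      apply MvPolynomial.algHom_ext
      intro i
      simp only [subst, mul_inv_rev, complexMatrix_mul, AlgHom.comp_apply, MvPolynomial.aeval_X,
        map_sum, map_mul, MvPolynomial.algHom_C, Matrix.mul_apply, Finset.sum_mul, Finset.mul_sum,
        MvPolynomial.algebraMap_eq]
      rw [Finset.sum_comm]
      simp [mul_assoc]
    rw [this]
    rfl

lemma pderiv_subst {n : ℕ} (B : Matrix (Fin n) (Fin n) ℂ) (i : Fin n)
    (p : MvPolynomial (Fin n) ℂ) :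
    MvPolynomial.pderiv i (subst B p) =
      ∑ k, MvPolynomial.C (B k i) * subst B (MvPolynomial.pderiv k p) := by
  induction p using MvPolynomial.induction_on with
  | C a => simp [subst]
  | add p q hp hq => simp [hp, hq, mul_add, Finset.sum_add_distrib]
  | mul_X p l hp =>
    have hX : MvPolynomial.pderiv i (subst B (MvPolynomial.X l)) = MvPolynomial.C (B l i) := by
      simp [subst, MvPolynomial.pderiv_X, Pi.single_apply]
    simp only [map_mul, Derivation.leibniz, smul_eq_mul, hp, hX, MvPolynomial.pderiv_X, map_add,
      mul_add, Finset.sum_add_distrib, Finset.mul_sum]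
    congr 1
    · rw [Finset.sum_eq_single l]
      · simp [mul_comm]
      · intro b _ hb
        simp [hb.symm]
      · simp
    · exact Finset.sum_congr rfl fun k _ => by ring

lemma laplacian_subst {n : ℕ} (A : SO n) (p : MvPolynomial (Fin n) ℂ) :
    laplacian n (subst (complexMatrix A) p) = subst (complexMatrix A) (laplacian n p) := by
  simp only [laplacian, LinearMap.sum_apply, LinearMap.comp_apply, Derivation.coeFn_coe,
    pderiv_subst, map_sum, Derivation.leibniz, MvPolynomial.pderiv_C, add_zero,
    mul_zero, smul_eq_mul, Finset.mul_sum]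
  rw [Finset.sum_comm]
  refine Finset.sum_congr rfl fun k _ => ?_
  rw [Finset.sum_comm]
  have h : ∀ l, ∑ i, MvPolynomial.C (complexMatrix A k i) * (MvPolynomial.C (complexMatrix A l i) *
      subst (complexMatrix A) (MvPolynomial.pderiv l (MvPolynomial.pderiv k p))) =
      if k = l then subst (complexMatrix A) (MvPolynomial.pderiv l (MvPolynomial.pderiv k p))
      else 0 := by
    intro l
    simp_rw [← mul_assoc, ← MvPolynomial.C_mul]
    rw [← Finset.sum_mul, ← map_sum, complexMatrix_sum]
    split_ifs <;> simp
  simp [h]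

lemma subst_homogeneous {n m : ℕ} (B : Matrix (Fin n) (Fin n) ℂ) {p : MvPolynomial (Fin n) ℂ}
    (hp : p.IsHomogeneous m) : (subst B p).IsHomogeneous m := by
  have h := hp.aeval (S := ℂ) (n := 1) (fun i => ∑ j, MvPolynomial.C (B i j) * MvPolynomial.X j)
    (fun i => MvPolynomial.IsHomogeneous.sum _ _ _ fun j _ =>
      (MvPolynomial.isHomogeneous_X ℂ j).C_mul _)
  simpa [subst] using h

/-- The `SO(n)`-module of harmonic homogeneous polynomials of degree `m`. -/
def harmonicRep (n m : ℕ) : Representation ℂ (SO n) (harmonic n m) :=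
  (polyRep n).subrepresentation (harmonic n m) fun A p hp => by
    refine ⟨?_, ?_⟩
    · have h0 : laplacian n p = 0 := hp.1
      change laplacian n (subst (complexMatrix A⁻¹) p) = 0
      rw [laplacian_subst, h0, map_zero]
    · exact subst_homogeneous _ hp.2

/-- The one-dimensional `SO(2)`-module `ℂₘ`, given by the character `t ↦ t⁻ᵐ`. -/
def charRep (m : ℕ) : Representation ℂ Circle ℂ where
  toFun t := ((t : ℂ) ^ (-(m : ℤ))) • LinearMap.id
  map_one' := by ext; simp
  map_mul' s t := by ext; simp [mul_pow, mul_comm]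

/-! ### The Cartan domain of type IV and its weighted Bergman spaces -/

/-- The complex number `zᵀz`. -/
def bil {n : ℕ} (z : Fin n → ℂ) : ℂ := ∑ j, z j ^ 2

/-- The square `|z|²` of the Hermitian norm. -/
def normSq {n : ℕ} (z : Fin n → ℂ) : ℝ := ∑ j, ‖z j‖ ^ 2

/-- The Cartan domain of type IV: `|z| < 1` and `2|z|² < 1 + |zᵀz|²`. -/
def cartanIV (n : ℕ) : Set (Fin n → ℂ) :=
  {z | √(normSq z) < 1 ∧ 2 * normSq z < 1 + ‖bil z‖ ^ 2}

/-- `Δ(z) = 1 - 2|z|² + |zᵀz|²`. -/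
def Delta {n : ℕ} (z : Fin n → ℂ) : ℝ := 1 - 2 * normSq z + ‖bil z‖ ^ 2

lemma continuous_bil (n : ℕ) : Continuous (bil : (Fin n → ℂ) → ℂ) := by
  unfold bil; fun_prop

lemma continuous_normSq (n : ℕ) : Continuous (normSq : (Fin n → ℂ) → ℝ) := by
  unfold normSq; fun_prop

lemma continuous_Delta (n : ℕ) : Continuous (Delta : (Fin n → ℂ) → ℝ) := by
  have h1 := continuous_bil n
  have h2 := continuous_normSq n
  unfold Delta; fun_prop

lemma isOpen_cartanIV (n : ℕ) : IsOpen (cartanIV n) := by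
  have h1 := continuous_bil n
  have h2 := continuous_normSq n
  exact (isOpen_lt h2.sqrt continuous_const).inter
    (isOpen_lt (continuous_const.mul h2) (continuous_const.add (h1.norm.pow 2)))

lemma measurableSet_cartanIV (n : ℕ) : MeasurableSet (cartanIV n) :=
  (isOpen_cartanIV n).measurableSet

/-- The measure `Δ(z)^(λ - n) dz` on the domain, before normalization. -/
def weightedMeasure (n : ℕ) (lam : ℝ) : Measure (Fin n → ℂ) :=
  (volume.restrict (cartanIV n)).withDensity fun z => ENNReal.ofReal (Delta z ^ (lam - n))

/-- The measure `v_λ = c_λ Δ(z)^(λ - n) dz` on the domain, normalized to have total mass `1`. -/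
def bergmanMeasure (n : ℕ) (lam : ℝ) : Measure (Fin n → ℂ) :=
  (weightedMeasure n lam Set.univ)⁻¹ • weightedMeasure n lam

instance (n : ℕ) (lam : ℝ) : IsFiniteMeasure (bergmanMeasure n lam) where
  measure_univ_lt_top := by
    simp only [bergmanMeasure, Measure.smul_apply, smul_eq_mul]
    exact (ENNReal.inv_mul_le_one _).trans_lt ENNReal.one_lt_top

/-- The weighted Bergman space: the classes in `L²(v_λ)` of functions that are holomorphic on
the domain. -/
def bergman (n : ℕ) (lam : ℝ) : Submodule ℂ (Lp ℂ 2 (bergmanMeasure n lam)) where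
  carrier := {f | ∃ F : (Fin n → ℂ) → ℂ, DifferentiableOn ℂ F (cartanIV n) ∧
    f =ᵐ[bergmanMeasure n lam] F}
  zero_mem' := ⟨0, differentiableOn_const 0, Lp.coeFn_zero _ _ _⟩
  add_mem' := by
    rintro f g ⟨F, hF, hf⟩ ⟨K, hK, hg⟩
    exact ⟨F + K, hF.add hK, (Lp.coeFn_add f g).trans (hf.add hg)⟩
  smul_mem' := by
    rintro c f ⟨F, hF, hf⟩
    exact ⟨c • F, hF.const_smul c, (Lp.coeFn_smul c f).trans (hf.const_smul c)⟩

lemma ae_mem_cartanIV (n : ℕ) (lam : ℝ) :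
    ∀ᵐ z ∂(bergmanMeasure n lam), z ∈ cartanIV n := by
  apply Measure.ae_smul_measure
  apply (withDensity_absolutelyContinuous _ _).ae_le
  exact ae_restrict_mem (measurableSet_cartanIV n)

lemma norm_lt_one_of_mem {n : ℕ} {z : Fin n → ℂ} (hz : z ∈ cartanIV n) (i : Fin n) :
    ‖z i‖ < 1 := by
  have h0 : ‖z i‖ ^ 2 ≤ normSq z :=
    Finset.single_le_sum (f := fun j => ‖z j‖ ^ 2) (fun j _ => by positivity) (Finset.mem_univ i)
  refine lt_of_le_of_lt ?_ hz.1
  exact Real.le_sqrt_of_sq_le h0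

lemma memLp_poly (n : ℕ) (lam : ℝ) (p : MvPolynomial (Fin n) ℂ) :
    MemLp (fun z => MvPolynomial.eval z p) 2 (bergmanMeasure n lam) := by
  have hc : Continuous fun z : Fin n → ℂ => MvPolynomial.eval z p := MvPolynomial.continuous_eval p
  obtain ⟨C, hC⟩ := (isCompact_closedBall (0 : Fin n → ℂ) 1).exists_bound_of_continuousOn
    hc.continuousOn
  refine MemLp.of_bound hc.aestronglyMeasurable C ?_
  filter_upwards [ae_mem_cartanIV n lam] with z hz
  apply hC
  rw [mem_closedBall_zero_iff, pi_norm_le_iff_of_nonneg zero_le_one]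
  exact fun i => (norm_lt_one_of_mem hz i).le

lemma differentiable_poly (n : ℕ) (p : MvPolynomial (Fin n) ℂ) :
    Differentiable ℂ fun z : Fin n → ℂ => MvPolynomial.eval z p := by
  induction p using MvPolynomial.induction_on with
  | C a => simp
  | add p q hp hq =>
    simp only [map_add]
    exact hp.fun_add hq
  | mul_X p l hp =>
    simp only [map_mul, MvPolynomial.eval_X]
    exact hp.fun_mul (differentiable_apply l)

/-- Polynomials as elements of the Bergman space. -/
def polyToBergman (n : ℕ) (lam : ℝ) : MvPolynomial (Fin n) ℂ →ₗ[ℂ] bergman n lam where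
  toFun p := ⟨(memLp_poly n lam p).toLp _,
    fun z => MvPolynomial.eval z p, (differentiable_poly n p).differentiableOn, MemLp.coeFn_toLp _⟩
  map_add' p q := by
    ext1
    simp only [map_add]
    exact MemLp.toLp_add (memLp_poly n lam p) (memLp_poly n lam q)
  map_smul' c p := by
    ext1
    simp only [MvPolynomial.smul_eval]
    exact MemLp.toLp_const_smul c (memLp_poly n lam p)

/-- The subspace `𝓗^{k₁}(ℂⁿ) (zᵀz)^{k₂}` of the Bergman space. -/
def summand (n : ℕ) (lam : ℝ) (k₁ k₂ : ℕ) : Submodule ℂ (bergman n lam) :=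
  (harmonic n k₁).map (polyToBergman n lam ∘ₗ LinearMap.mulRight ℂ (quad n ^ k₂))

/-! ### The unitary representation of `SO(n) × SO(2)` on the Bergman spaces -/

/-- The matrix `t A` of the action of `(A, t)`. -/
def actMatrix {n : ℕ} (g : SOxSO2 n) : Matrix (Fin n) (Fin n) ℂ :=
  (g.2 : ℂ) • complexMatrix g.1

/-- The linear action `(A, t) · z = t A z`. -/
def act {n : ℕ} (g : SOxSO2 n) (z : Fin n → ℂ) : Fin n → ℂ := (actMatrix g).mulVec z

lemma act_one {n : ℕ} : act (1 : SOxSO2 n) = id := by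
  ext z; simp [act, actMatrix, complexMatrix_one]

lemma act_mul {n : ℕ} (g h : SOxSO2 n) : act (g * h) = act g ∘ act h := by
  ext1 z
  simp [act, actMatrix, complexMatrix_mul, smul_smul, Matrix.mulVec_mulVec, mul_comm]

lemma differentiable_act {n : ℕ} (g : SOxSO2 n) : Differentiable ℂ (act g) :=
  (Matrix.mulVecLin (actMatrix g)).toContinuousLinearMap.differentiable

lemma bil_act {n : ℕ} (g : SOxSO2 n) (z : Fin n → ℂ) : bil (act g z) = (g.2 : ℂ) ^ 2 * bil z := by
  have h : ∀ w : Fin n → ℂ, bil w = w ⬝ᵥ w := fun w => by simp [bil, dotProduct, sq]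
  have hA : (complexMatrix g.1).mulVec z ⬝ᵥ (complexMatrix g.1).mulVec z = z ⬝ᵥ z := by
    rw [Matrix.dotProduct_mulVec, ← Matrix.mulVec_transpose, Matrix.mulVec_mulVec,
      complexMatrix_transpose_mul, Matrix.one_mulVec]
  rw [h, h, act, actMatrix, Matrix.smul_mulVec, smul_dotProduct, dotProduct_smul, hA,
    smul_smul, smul_eq_mul, sq]

lemma star_complexMatrix_mulVec {n : ℕ} (A : SO n) (z : Fin n → ℂ) :
    star ((complexMatrix A).mulVec z) = (complexMatrix A).mulVec (star z) := by
  ext i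
  simp [Matrix.mulVec, dotProduct, complexMatrix]

lemma normSq_act {n : ℕ} (g : SOxSO2 n) (z : Fin n → ℂ) : normSq (act g z) = normSq z := by
  have h : ∀ w : Fin n → ℂ, (normSq w : ℂ) = star w ⬝ᵥ w := fun w => by
    simp [normSq, dotProduct, ← Complex.conj_mul']
  have hA : (complexMatrix g.1).mulVec (star z) ⬝ᵥ (complexMatrix g.1).mulVec z =
      star z ⬝ᵥ z := by
    rw [Matrix.dotProduct_mulVec, ← Matrix.mulVec_transpose, Matrix.mulVec_mulVec,
      complexMatrix_transpose_mul, Matrix.one_mulVec]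
  have ht : star (g.2 : ℂ) * (g.2 : ℂ) = 1 := by
    have := Complex.conj_mul' (g.2 : ℂ)
    rw [Circle.norm_coe g.2] at this
    simpa using this
  apply Complex.ofReal_injective
  rw [h, h, act, actMatrix, Matrix.smul_mulVec, star_smul, star_complexMatrix_mulVec,
    smul_dotProduct, dotProduct_smul, hA, smul_smul, ht, one_smul]

lemma norm_bil_act {n : ℕ} (g : SOxSO2 n) (z : Fin n → ℂ) : ‖bil (act g z)‖ = ‖bil z‖ := by
  rw [bil_act, norm_mul, norm_pow, Circle.norm_coe g.2, one_pow, one_mul]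

lemma Delta_act {n : ℕ} (g : SOxSO2 n) (z : Fin n → ℂ) : Delta (act g z) = Delta z := by
  simp [Delta, norm_bil_act, normSq_act]

lemma act_mem_iff {n : ℕ} (g : SOxSO2 n) (z : Fin n → ℂ) :
    act g z ∈ cartanIV n ↔ z ∈ cartanIV n := by
  simp [cartanIV, norm_bil_act, normSq_act]

lemma norm_det_actMatrix {n : ℕ} (g : SOxSO2 n) : ‖(actMatrix g).det‖ = 1 := by
  have h := congrArg Matrix.det (complexMatrix_mul_transpose g.1)
  rw [Matrix.det_mul, Matrix.det_transpose, Matrix.det_one] at h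
  have h2 : ‖(complexMatrix g.1).det‖ = 1 := by
    have h3 := congrArg norm h
    rw [norm_mul, norm_one] at h3
    nlinarith [norm_nonneg (complexMatrix g.1).det]
  rw [actMatrix, Matrix.det_smul, norm_mul, norm_pow, Circle.norm_coe g.2, h2]
  simp

lemma measurePreserving_act_volume {n : ℕ} (g : SOxSO2 n) :
    MeasurePreserving (act g) (volume : Measure (Fin n → ℂ)) volume := by
  refine ⟨(differentiable_act g).continuous.measurable, ?_⟩
  have hdet : |LinearMap.det ((Matrix.mulVecLin (actMatrix g)).restrictScalars ℝ)| = 1 := by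
    have hd : LinearMap.det (Matrix.mulVecLin (actMatrix g)) = (actMatrix g).det := by
      rw [← Matrix.toLin'_apply', LinearMap.det_toLin']
    rw [LinearMap.det_restrictScalars, hd, Algebra.norm_complex_apply, Complex.normSq_eq_norm_sq,
      norm_det_actMatrix]
    simp
  have h0 : LinearMap.det ((Matrix.mulVecLin (actMatrix g)).restrictScalars ℝ) ≠ 0 := by
    intro h
    rw [h] at hdet
    simp at hdet
  have := Measure.map_linearMap_addHaar_eq_smul_addHaar
    (volume : Measure (Fin n → ℂ)) h0
  rw [abs_inv, hdet, inv_one, ENNReal.ofReal_one, one_smul] at this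
  exact this

lemma measurePreserving_act {n : ℕ} (lam : ℝ) (g : SOxSO2 n) :
    MeasurePreserving (act g) (bergmanMeasure n lam) (bergmanMeasure n lam) := by
  have hm := (differentiable_act g).continuous.measurable
  have hpre : act g ⁻¹' cartanIV n = cartanIV n := by
    ext z; exact act_mem_iff g z
  have h1 : MeasurePreserving (act g) (volume.restrict (cartanIV n))
      (volume.restrict (cartanIV n)) := by
    have := (measurePreserving_act_volume g).restrict_preimage (measurableSet_cartanIV n)
    rwa [hpre] at this
  have h2 : MeasurePreserving (act g) (weightedMeasure n lam) (weightedMeasure n lam) := by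
    refine ⟨hm, ?_⟩
    ext s hs
    have hd : Measurable fun z : Fin n → ℂ => ENNReal.ofReal (Delta z ^ (lam - n)) :=
      ((continuous_Delta n).measurable.pow_const _).ennreal_ofReal
    rw [Measure.map_apply hm hs, weightedMeasure, withDensity_apply _ (hm hs),
      withDensity_apply _ hs, ← h1.setLIntegral_comp_preimage hs hd]
    simp [Delta_act]
  exact ⟨hm, by rw [bergmanMeasure, Measure.map_smul, h2.map_eq]⟩

lemma pullback_mem {n : ℕ} {lam : ℝ} (g : SOxSO2 n) {f : Lp ℂ 2 (bergmanMeasure n lam)}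
    (hf : f ∈ bergman n lam) :
    Lp.compMeasurePreserving (act g) (measurePreserving_act lam g) f ∈ bergman n lam := by
  obtain ⟨F, hF, hf⟩ := hf
  refine ⟨F ∘ act g, hF.comp (differentiable_act g).differentiableOn
    (fun z hz => (act_mem_iff g z).2 hz), ?_⟩
  exact (Lp.coeFn_compMeasurePreserving f (measurePreserving_act lam g)).trans
    ((measurePreserving_act lam g).quasiMeasurePreserving.ae_eq_comp hf)

/-- The operator `f ↦ f ∘ (g · )` on the Bergman space. -/
def pullback (n : ℕ) (lam : ℝ) (g : SOxSO2 n) : bergman n lam →ₗᵢ[ℂ] bergman n lam where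
  toFun f := ⟨Lp.compMeasurePreserving (act g) (measurePreserving_act lam g) f.1,
    pullback_mem g f.2⟩
  map_add' _ _ := Subtype.ext (map_add _ _ _)
  map_smul' c f := Subtype.ext
    ((Lp.compMeasurePreservingₗ ℂ (act g) (measurePreserving_act lam g)).map_smul c f.1)
  norm_map' f := Lp.norm_compMeasurePreserving f.1 (measurePreserving_act lam g)

lemma pullback_one (n : ℕ) (lam : ℝ) (f : bergman n lam) : pullback n lam 1 f = f := by
  apply Subtype.ext
  apply Lp.ext
  refine (Lp.coeFn_compMeasurePreserving f.1 (measurePreserving_act lam 1)).trans ?_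
  rw [act_one, Function.comp_id]

lemma pullback_mul (n : ℕ) (lam : ℝ) (g h : SOxSO2 n) (f : bergman n lam) :
    pullback n lam (g * h) f = pullback n lam h (pullback n lam g f) := by
  apply Subtype.ext
  apply Lp.ext
  refine (Lp.coeFn_compMeasurePreserving f.1 (measurePreserving_act lam (g * h))).trans ?_
  refine .trans ?_ (Lp.coeFn_compMeasurePreserving _ (measurePreserving_act lam h)).symm
  rw [act_mul, ← Function.comp_assoc]
  exact ((measurePreserving_act lam h).quasiMeasurePreserving.ae_eq_comp
    (Lp.coeFn_compMeasurePreserving f.1 (measurePreserving_act lam g))).symm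

/-- The unitary representation `π_λ` of `SO(n) × SO(2)` on the weighted Bergman space,
`(π_λ(g) f)(z) = f(g⁻¹ · z)`, that is, `(π_λ(A, t) f)(z) = f(t⁻¹ A⁻¹ z)`. -/
def bergmanRep (n : ℕ) (lam : ℝ) : SOxSO2 n →* (bergman n lam ≃ₗᵢ[ℂ] bergman n lam) where
  toFun g :=
    { toLinearEquiv := LinearEquiv.ofLinearMap (pullback n lam g⁻¹).toLinearMap
        (pullback n lam g).toLinearMap
        (by ext1 f; simpa [pullback_one] using (pullback_mul n lam g g⁻¹ f).symm)
        (by ext1 f; simpa [pullback_one] using (pullback_mul n lam g⁻¹ g f).symm)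
      norm_map' := (pullback n lam g⁻¹).norm_map }
  map_one' := by
    ext1 f
    simpa using pullback_one n lam f
  map_mul' g h := by
    ext1 f
    change pullback n lam (g * h)⁻¹ f = pullback n lam g⁻¹ (pullback n lam h⁻¹ f)
    rw [mul_inv_rev, pullback_mul]

/-- The restriction of `π_λ` to `SO(n)`. -/
def bergmanRepSO (n : ℕ) (lam : ℝ) : SO n →* (bergman n lam ≃ₗᵢ[ℂ] bergman n lam) :=
  (bergmanRep n lam).comp (MonoidHom.inl (SO n) Circle)

/-! ### Weights of representations of `SO(n)` -/

lemma so_transpose {n : ℕ} (X : LieAlgebra.Orthogonal.so (Fin n) ℝ) :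
    (X : Matrix (Fin n) (Fin n) ℝ).transpose = -X :=
  (LieAlgebra.Orthogonal.mem_so (n := Fin n) (R := ℝ) _).1 X.2

lemma exp_mul_transpose {n : ℕ} (X : LieAlgebra.Orthogonal.so (Fin n) ℝ) :
    NormedSpace.exp (X : Matrix (Fin n) (Fin n) ℝ) *
      (NormedSpace.exp (X : Matrix (Fin n) (Fin n) ℝ)).transpose = 1 := by
  have hc : Commute (X : Matrix (Fin n) (Fin n) ℝ) (-(X : Matrix (Fin n) (Fin n) ℝ)) :=
    Commute.neg_right (Commute.refl _)
  rw [← Matrix.exp_transpose, so_transpose, ← Matrix.exp_add_of_commute _ _ hc, add_neg_cancel,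
    NormedSpace.exp_zero]

/-- The exponential map `so(n) → SO(n)`. -/
def expSO {n : ℕ} (X : LieAlgebra.Orthogonal.so (Fin n) ℝ) : SO n :=
  ⟨NormedSpace.exp (X : Matrix (Fin n) (Fin n) ℝ), by
    rw [Matrix.mem_specialOrthogonalGroup_iff, Matrix.mem_orthogonalGroup_iff]
    refine ⟨exp_mul_transpose X, ?_⟩
    have h := congrArg Matrix.det (exp_mul_transpose ((1 / 2 : ℝ) • X))
    rw [Matrix.det_mul, Matrix.det_transpose, Matrix.det_one] at h
    have h2 : (X : Matrix (Fin n) (Fin n) ℝ) =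
        ((1 / 2 : ℝ) • X : LieAlgebra.Orthogonal.so (Fin n) ℝ) +
        ((1 / 2 : ℝ) • X : LieAlgebra.Orthogonal.so (Fin n) ℝ) := by
      rw [← AddMemClass.coe_add, ← add_smul]
      norm_num
    rw [h2, Matrix.exp_add_of_commute _ _ (Commute.refl _), Matrix.det_mul, h]⟩

section Weights

variable {n : ℕ} {E : Type*} [NormedAddCommGroup E] [InnerProductSpace ℂ E]

/-- `w = dπ(X) v` for `X ∈ so(n)`: the curve `s ↦ π(exp(sX)) v` has derivative `w` at `0`. -/
def IsDifferential (π : SO n →* (E ≃ₗᵢ[ℂ] E)) (X : LieAlgebra.Orthogonal.so (Fin n) ℝ)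
    (v w : E) : Prop :=
  HasDerivAt (fun s : ℝ => π (expSO (s • X)) v) w 0

/-- `w = ρ^ℂ(Z) v` where `ρ^ℂ` is the complex linear extension of `dπ` to `so(n, ℂ)`:
`Z = X + iY` with `X, Y ∈ so(n)` and `w = dπ(X) v + i dπ(Y) v`. -/
def IsComplexDifferential (π : SO n →* (E ≃ₗᵢ[ℂ] E)) (Z : Matrix (Fin n) (Fin n) ℂ)
    (v w : E) : Prop :=
  ∃ X Y : LieAlgebra.Orthogonal.so (Fin n) ℝ,
    Z = (X : Matrix (Fin n) (Fin n) ℝ).map Complex.ofRealHom +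
      Complex.I • (Y : Matrix (Fin n) (Fin n) ℝ).map Complex.ofRealHom ∧
    ∃ w₁ w₂ : E, IsDifferential π X v w₁ ∧ IsDifferential π Y v w₂ ∧ w = w₁ + Complex.I • w₂

/-- The element `H(b) = diag(i b₁ R(π/2), …, i b_ℓ R(π/2), (0))` of the Cartan subalgebra of
`so(n, ℂ)`, where `ℓ = ⌊n/2⌋` and `R(π/2)` is the matrix with rows `(0, 1)` and `(-1, 0)`.
The Cartan subalgebra is parametrized by `b ∈ ℂ^ℓ`, so that the functional `e_j`,
`e_j(H(b)) = b_j`, is the `j`-th coordinate. -/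
def cartanElement (n : ℕ) (b : Fin (n / 2) → ℂ) : Matrix (Fin n) (Fin n) ℂ :=
  ∑ j : Fin (n / 2), (Complex.I * b j) •
    (Matrix.single (⟨2 * j, by omega⟩ : Fin n) (⟨2 * j + 1, by omega⟩ : Fin n) (1 : ℂ) -
      Matrix.single (⟨2 * j + 1, by omega⟩ : Fin n) (⟨2 * j, by omega⟩ : Fin n) (1 : ℂ))

/-- Linear functionals on the Cartan subalgebra, in the parametrization `b ↦ H(b)`. -/
abbrev CartanDual (n : ℕ) : Type := Module.Dual ℂ (Fin (n / 2) → ℂ)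

/-- The functional `e_j`, with indices starting at `0`. -/
def coordFunctional (n : ℕ) (j : Fin (n / 2)) : CartanDual n := LinearMap.proj j

/-- `α` is a root of `so(n, ℂ)`: it is non-zero and has a non-zero root space. -/
def IsRoot (n : ℕ) (α : CartanDual n) : Prop :=
  α ≠ 0 ∧ ∃ X ∈ LieAlgebra.Orthogonal.so (Fin n) ℂ, X ≠ 0 ∧
    ∀ b, ⁅cartanElement n b, X⁆ = α b • X

/-- `α = ∑ a_j e_j` is a positive root: a root that is positive for the lexicographic order
given by `e_1, …, e_ℓ`, so that the first non-zero coefficient `a_j = α(H(j-th unit vector))`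
is positive. -/
def IsPositiveRoot (n : ℕ) (α : CartanDual n) : Prop :=
  IsRoot n α ∧ ∃ j : Fin (n / 2), (∀ i < j, α (Pi.single i 1) = 0) ∧
    ∃ r : ℝ, 0 < r ∧ α (Pi.single j 1) = r

/-- `μ₁ ≼ μ₂`: the difference `μ₂ - μ₁` is a (possibly empty) sum of positive roots. -/
def WeightLE (n : ℕ) (μ₁ μ₂ : CartanDual n) : Prop :=
  μ₂ - μ₁ ∈ AddSubmonoid.closure {α | IsPositiveRoot n α}

/-- `v` belongs to the weight space of weight `μ` in the invariant subspace `V`. -/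
def InWeightSpace (π : SO n →* (E ≃ₗᵢ[ℂ] E)) (V : Submodule ℂ E) (μ : CartanDual n)
    (v : E) : Prop :=
  v ∈ V ∧ ∀ b, IsComplexDifferential π (cartanElement n b) v (μ b • v)

/-- `μ` is a weight of the invariant subspace `V`. -/
def IsWeight (π : SO n →* (E ≃ₗᵢ[ℂ] E)) (V : Submodule ℂ E) (μ : CartanDual n) : Prop :=
  ∃ v, v ≠ 0 ∧ InWeightSpace π V μ v

/-- `μ` is the highest weight of `V`. -/
def IsHighestWeight (π : SO n →* (E ≃ₗᵢ[ℂ] E)) (V : Submodule ℂ E) (μ : CartanDual n) : Prop :=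
  IsWeight π V μ ∧ ∀ ν, IsWeight π V ν → WeightLE n ν μ

/-- `v` is a highest weight vector of `V`: a non-zero vector in the weight space of the highest
weight. -/
def IsHighestWeightVector (π : SO n →* (E ≃ₗᵢ[ℂ] E)) (V : Submodule ℂ E) (v : E) : Prop :=
  v ≠ 0 ∧ ∃ μ, IsHighestWeight π V μ ∧ InWeightSpace π V μ v

end Weights

end BergmanIV

end

open BergmanIV

-- The proof rests on a general criterion, `isIsotypicDecomposition_of_irreducible`: if
-- finite-dimensional irreducible subspaces have trivial common orthogonal complement and no
-- non-zero intertwining operator maps one into another, then they are pairwise orthogonal and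
-- inequivalent, and any irreducible subspace equivalent to one of them coincides with it. So the
-- summands have to be shown to be irreducible, pairwise disjoint and total.
--
-- Totality is half analysis, half algebra. For λ > n - 1 the weight has finite mass
-- (`weightedMeasure_univ_lt_top`), so the normalized measure is a probability measure. The sub-mean
-- value inequality bounds point evaluations, whence the Bergman space is complete and polynomials
-- embed in it. A function orthogonal to all polynomials vanishes (`eq_zero_of_inner_poly_eq_zero`):
-- its homogeneous Taylor components are polynomials, the circle action extracts each of them by a
-- Cauchy integral, and each is therefore orthogonal to itself. On the algebraic side the Laplacian
-- sends h q^(k+1), with h harmonic and q = zᵀz, to a non-zero multiple of h q^k; this gives the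
-- decomposition of every homogeneous polynomial into products h q^j (`mem_harmonicProducts`).
--
-- Irreducibility already holds under SO(n). In an invariant subspace W ≠ 0 the vector representing
-- evaluation at a coordinate vector is annihilated by the Lie algebra of its stabilizer SO(n-1). A
-- harmonic polynomial with this property is determined by its value at that point
-- (`eq_zero_of_zonal`), so W and its complement in the summand cannot both be non-zero.
--
-- Disjointness comes from two invariants. The Casimir operator of so(n) acts on the summand (k, j)
-- by -2k(k+n-2), which determines k; the circle acts by the character of degree k + 2j, which then
-- determines j.
--
-- For the weights, a linear change of variables diagonalizes the Cartan subalgebra on polynomials.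
-- Every weight in degree k is a sum of k weights of the defining representation, and e_1 dominates
-- each of those.

open MeasureTheory
open scoped TensorProduct

noncomputable section

namespace BergmanIV

-- Holomorphic functions of several variables: Cauchy estimates, limits, Taylor components

section SeveralComplexVariables

open Filter Topology Metric Set

variable {E : Type*} [NormedAddCommGroup E] [NormedSpace ℂ E]

/-- Schwarz's lemma for `F`, which maps the ball into the disc of radius 2M around `F c`; this is
the source of the factor 2. -/
lemma norm_fderiv_le_of_bound {F : E → ℂ} {c : E} {R M : ℝ} (hR : 0 < R)
    (hd : DifferentiableOn ℂ F (ball c R)) (hM : ∀ w ∈ ball c R, ‖F w‖ ≤ M) :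
    ‖fderiv ℂ F c‖ ≤ 2 * M / R := by
  refine Complex.norm_fderiv_le_div_of_mapsTo_ball hd (fun w hw => ?_) hR
  rw [mem_closedBall, dist_eq_norm]
  have h1 := hM w hw
  have h2 := hM c (mem_ball_self hR)
  linarith [norm_sub_le (F w) (F c)]

/-- After subtraction of the linear part, the function agrees with its value at `c` to first order,
so the Schwarz lemma for higher-order vanishing yields a quadratic bound. It makes difference
quotients converge at a rate uniform in the base point. -/
lemma norm_taylor_one_le_of_bound {F : E → ℂ} {c w : E} {R M : ℝ} (hR : 0 < R)
    (hd : DifferentiableOn ℂ F (ball c R)) (hM : ∀ w ∈ ball c R, ‖F w‖ ≤ M)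
    (hw : w ∈ ball c R) :
    ‖F w - F c - fderiv ℂ F c (w - c)‖ ≤ 4 * M * (‖w - c‖ / R) ^ 2 := by
  have hF' := norm_fderiv_le_of_bound hR hd hM
  have hM0 : 0 ≤ M := (norm_nonneg _).trans (hM c (mem_ball_self hR))
  have hc : HasFDerivAt F (fderiv ℂ F c) c :=
    (hd.differentiableAt (ball_mem_nhds c hR)).hasFDerivAt
  set g : E → ℂ := fun w => F w - fderiv ℂ F c (w - c) with hg
  have hgd : DifferentiableOn ℂ g (ball c R) :=
    hd.sub ((fderiv ℂ F c).differentiable.comp (differentiable_id.sub_const c)).differentiableOn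
  have hgc : g c = F c := by simp [hg]
  have hmaps : MapsTo g (ball c R) (closedBall (g c) (4 * M)) := by
    intro w hw
    rw [mem_closedBall, dist_eq_norm, hgc]
    have h1 := hM w hw
    have h2 := hM c (mem_ball_self hR)
    have h3 : ‖fderiv ℂ F c (w - c)‖ ≤ 2 * M := by
      refine ((fderiv ℂ F c).le_opNorm _).trans ?_
      have : ‖w - c‖ ≤ R := by rw [← dist_eq_norm]; exact (mem_ball.1 hw).le
      calc ‖fderiv ℂ F c‖ * ‖w - c‖ ≤ 2 * M / R * R := by gcongr
        _ = 2 * M := by field_simp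
    have h4 : g w - F c = F w - F c - fderiv ℂ F c (w - c) := by simp only [hg]; ring
    rw [h4]
    linarith [norm_sub_le (F w - F c) (fderiv ℂ F c (w - c)), norm_sub_le (F w) (F c)]
  have ho : (g · - g c) =o[𝓝 c] (fun w => ‖w - c‖ ^ (1 : ℕ)) := by
    have := hc.isLittleO
    refine (this.norm_right).congr (fun w => ?_) fun w => (pow_one _).symm
    simp only [hg, sub_self, map_zero, sub_zero]; ring
  have := Complex.dist_le_mul_div_pow_of_mapsTo_ball_of_isLittleO hgd hmaps ho hw
  rw [dist_eq_norm, dist_eq_norm, hgc] at this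
  have e : F w - F c - fderiv ℂ F c (w - c) = g w - F c := by simp only [hg]; ring
  rw [e]
  simpa using this

/-- A locally uniform limit of holomorphic functions of several variables is holomorphic. -/
lemma differentiableAt_of_tendstoUniformlyOn_ball {F : ℕ → E → ℂ} {f : E → ℂ} {z : E} {r : ℝ}
    (hr : 0 < r) (hF : ∀ k, DifferentiableOn ℂ (F k) (ball z r))
    (hunif : TendstoUniformlyOn F f atTop (ball z r)) : DifferentiableAt ℂ f z := by
  have hR : 0 < r / 2 := by positivity
  have hsub : ∀ w ∈ ball z (r / 2), ball w (r / 2) ⊆ ball z r := by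
    intro w hw x hx
    rw [mem_ball] at *
    linarith [dist_triangle x w z]
  have hC : UniformCauchySeqOn (fun k w => fderiv ℂ (F k) w) atTop (ball z (r / 2)) := by
    rw [Metric.uniformCauchySeqOn_iff]
    intro ε hε
    -- With bound ε r / 8 on a ball of radius r / 2, the Cauchy estimate gives ε / 2 for the
    -- difference of derivatives.
    obtain ⟨N, hN⟩ := (Metric.uniformCauchySeqOn_iff.1 hunif.uniformCauchySeqOn) (ε * r / 8)
      (by positivity)
    refine ⟨N, fun m hm k hk w hw => ?_⟩
    have hnhds : ball z r ∈ 𝓝 w := isOpen_ball.mem_nhds (hsub w hw (mem_ball_self hR))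
    rw [dist_eq_norm, ← fderiv_sub ((hF m).differentiableAt hnhds) ((hF k).differentiableAt hnhds)]
    refine (norm_fderiv_le_of_bound (M := ε * r / 8) hR
      (((hF m).sub (hF k)).mono (hsub w hw)) (fun x hx => ?_)).trans_lt ?_
    · have := hN m hm k hk x (hsub w hw hx)
      rw [dist_eq_norm] at this
      exact this.le
    · field_simp
      linarith
  have hlim : ∀ w, ∃ L, w ∈ ball z (r / 2) → Tendsto (fun k => fderiv ℂ (F k) w) atTop (𝓝 L) := by
    intro w
    by_cases hw : w ∈ ball z (r / 2)
    · exact (cauchySeq_tendsto_of_complete (hC.cauchySeq hw)).imp fun _ h _ => h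
    · exact ⟨0, fun h => absurd h hw⟩
  choose g hg using hlim
  have hT := hC.tendstoUniformlyOn_of_tendsto hg
  have key : HasFDerivAt f (g z) z :=
    hasFDerivAt_of_tendstoUniformlyOn (f := F) isOpen_ball hT (fun k w hw =>
      ((hF k).differentiableAt
        (isOpen_ball.mem_nhds (hsub w hw (mem_ball_self hR)))).hasFDerivAt)
      (fun w hw => hunif.tendsto_at (hsub w hw (mem_ball_self hR))) (mem_ball_self hR)
  exact key.differentiableAt

/-- Directional derivatives of holomorphic functions are holomorphic. -/
lemma differentiableOn_fderiv_apply {F : E → ℂ} {U : Set E} (hU : IsOpen U)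
    (hF : DifferentiableOn ℂ F U) (v : E) : DifferentiableOn ℂ (fun z => fderiv ℂ F z v) U := by
  intro z hz
  obtain ⟨R, hR, hRU, M, hM⟩ : ∃ R > 0, ball z (R + R) ⊆ U ∧ ∃ M, ∀ w ∈ ball z (R + R),
      ‖F w‖ ≤ M := by
    have hcont : ContinuousAt F z := (hF.differentiableAt (hU.mem_nhds hz)).continuousAt
    have h1 : ∀ᶠ w in 𝓝 z, ‖F w‖ < ‖F z‖ + 1 := hcont.norm.eventually_lt_const (by linarith)
    obtain ⟨r, hr, hrU⟩ := Metric.mem_nhds_iff.1 (Filter.inter_mem h1 (hU.mem_nhds hz))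
    refine ⟨r / 2, by positivity, ?_, ‖F z‖ + 1, ?_⟩
    · rw [add_halves]; exact fun x hx => (hrU hx).2
    · rw [add_halves]; exact fun x hx => (hrU hx).1.le
  have hM0 : 0 ≤ M := (norm_nonneg _).trans (hM z (mem_ball_self (by linarith)))
  -- Step sizes tending to 0 with h k ‖v‖ < R; the added 1 and 2 cover v = 0 and make the inequality
  -- strict at k = 0.
  set h : ℕ → ℝ := fun k => R / (‖v‖ + 1) / (k + 2) with hh
  have hpos : ∀ k, 0 < h k := fun k => by positivity
  have hv : ∀ k, h k * ‖v‖ < R := by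
    intro k
    have hk : (1 : ℝ) < k + 2 := by have := Nat.cast_nonneg (α := ℝ) k; linarith
    simp only [hh]
    rw [div_div, div_mul_eq_mul_div, div_lt_iff₀ (by positivity)]
    have := norm_nonneg v
    nlinarith [mul_pos hR (by linarith : (0:ℝ) < k + 2 - 1), mul_nonneg hR.le this,
      mul_nonneg (mul_nonneg hR.le this) (by linarith : (0:ℝ) ≤ k + 2 - 1)]
  have hmem : ∀ k, ∀ w ∈ ball z R, w + (h k : ℂ) • v ∈ ball w R := by
    intro k w hw
    rw [mem_ball, dist_eq_norm, add_sub_cancel_left, norm_smul, Complex.norm_real,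
      Real.norm_of_nonneg (hpos k).le]
    exact hv k
  have hsub : ∀ w ∈ ball z R, ball w R ⊆ ball z (R + R) := by
    intro w hw x hx
    rw [mem_ball] at *
    linarith [dist_triangle x w z]
  refine (differentiableAt_of_tendstoUniformlyOn_ball (f := fun w => fderiv ℂ F w v)
    (F := fun k w => (F (w + (h k : ℂ) • v) - F w) / h k) hR
    (fun k => ?_) ?_).differentiableWithinAt
  · have h1 : DifferentiableOn ℂ (fun w => F (w + (h k : ℂ) • v)) (ball z R) :=
      hF.comp (differentiable_id.add_const _).differentiableOn
        fun w hw => hRU (hsub w hw (hmem k w hw))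
    have h2 : DifferentiableOn ℂ F (ball z R) :=
      hF.mono fun w hw => hRU (hsub w hw (mem_ball_self hR))
    simp only [div_eq_mul_inv]
    exact (h1.fun_sub h2).mul_const _
  · have hlim : Tendsto (fun k => 4 * M * (‖v‖ / R) ^ 2 * h k) atTop (𝓝 0) := by
      have h1 : Tendsto h atTop (𝓝 0) :=
        tendsto_const_nhds.div_atTop (tendsto_atTop_add_const_right _ _
          tendsto_natCast_atTop_atTop)
      simpa using h1.const_mul (4 * M * (‖v‖ / R) ^ 2)
    rw [Metric.tendstoUniformlyOn_iff]
    intro ε hε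
    filter_upwards [hlim.eventually_lt_const hε] with k hk w hw
    refine lt_of_le_of_lt ?_ hk
    -- The remainder is quadratic in h k, hence after division by h k it is still O(h k), uniformly
    -- in w.
    have := norm_taylor_one_le_of_bound hR (hF.mono ((hsub w hw).trans hRU))
      (fun x hx => hM x (hsub w hw hx)) (hmem k w hw)
    rw [add_sub_cancel_left, map_smul, norm_smul, Complex.norm_real,
      Real.norm_of_nonneg (hpos k).le] at this
    have hne : (h k : ℂ) ≠ 0 := Complex.ofReal_ne_zero.2 (hpos k).ne'
    rw [dist_comm, dist_eq_norm]
    have e : (F (w + (h k : ℂ) • v) - F w) / h k - fderiv ℂ F w v =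
        (F (w + (h k : ℂ) • v) - F w - (h k : ℂ) • fderiv ℂ F w v) / h k := by
      rw [smul_eq_mul]; field_simp
    rw [e, norm_div, Complex.norm_real, Real.norm_of_nonneg (hpos k).le, div_le_iff₀ (hpos k)]
    refine this.trans_eq ?_
    ring

/-- The Taylor coefficients of `t ↦ F (t z)` at `0` are polynomials in `z`. -/
lemma exists_poly_iteratedDeriv {n : ℕ} {U : Set (Fin n → ℂ)} (hU : IsOpen U) (h0 : 0 ∈ U)
    (m : ℕ) : ∀ F : (Fin n → ℂ) → ℂ, DifferentiableOn ℂ F U →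
      ∃ p : MvPolynomial (Fin n) ℂ,
        ∀ z, iteratedDeriv m (fun t : ℂ => F (t • z)) 0 = MvPolynomial.eval z p := by
  induction m with
  | zero =>
    intro F _
    exact ⟨MvPolynomial.C (F 0), fun z => by simp⟩
  | succ m ih =>
    intro F hF
    choose p hpe using fun j : Fin n =>
      ih (fun z => fderiv ℂ F z (Pi.single j 1)) (differentiableOn_fderiv_apply hU hF _)
    refine ⟨∑ j, MvPolynomial.X j * p j, fun z => ?_⟩
    have hcont : Continuous fun t : ℂ => t • z := by fun_prop
    have hev : ∀ᶠ t : ℂ in 𝓝 0, t • z ∈ U :=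
      hcont.continuousAt.eventually_mem (hU.mem_nhds (by simpa using h0))
    -- The chain rule expresses the coefficient of order m + 1 of `F` as ∑ z_j times the coefficient
    -- of order m of ∂_j F, which is a polynomial by induction.
    have hderiv : deriv (fun t : ℂ => F (t • z)) =ᶠ[𝓝 0]
        fun t => ∑ j, z j * fderiv ℂ F (t • z) (Pi.single j 1) := by
      filter_upwards [hev] with t ht
      have h1 : HasFDerivAt F (fderiv ℂ F (t • z)) (t • z) :=
        (hF.differentiableAt (hU.mem_nhds ht)).hasFDerivAt
      have h2 : HasDerivAt (fun t : ℂ => t • z) z t := by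
        simpa using (hasDerivAt_id t).smul_const z
      have h3 : HasDerivAt (fun t : ℂ => F (t • z)) (fderiv ℂ F (t • z) z) t :=
        h1.comp_hasDerivAt t h2
      rw [h3.deriv]
      generalize fderiv ℂ F (t • z) = A
      conv_lhs => rw [pi_eq_sum_univ' z]
      simp only [map_sum, map_smul, smul_eq_mul]
    have hana : ∀ j, ContDiffAt ℂ m (fun t : ℂ => fderiv ℂ F (t • z) (Pi.single j 1)) 0 := by
      intro j
      have hd : DifferentiableOn ℂ (fun t : ℂ => fderiv ℂ F (t • z) (Pi.single j 1))
          ((fun t : ℂ => t • z) ⁻¹' U) :=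
        (differentiableOn_fderiv_apply hU hF _).comp
          (differentiable_id.smul_const z).differentiableOn fun _ h => h
      exact (hd.analyticAt ((hU.preimage hcont).mem_nhds (by simpa using h0))).contDiffAt
    rw [iteratedDeriv_succ', hderiv.iteratedDeriv_eq, iteratedDeriv_fun_sum]
    · simp only [map_sum, map_mul, MvPolynomial.eval_X]
      refine Finset.sum_congr rfl fun j _ => ?_
      rw [iteratedDeriv_const_mul_field, hpe]
    · exact fun j _ => contDiffAt_const.mul (hana j)

end SeveralComplexVariables

-- Finiteness of the total mass of the weight

section Finiteness

open Set

/-- Lagrange's identity, summed over ordered pairs. It bounds |z|⁴ - |zᵀz|² from below by the square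
of a single Im(z_a z̄_b). -/
lemma norm_bil_sq_add_sum_im {n : ℕ} (z : Fin n → ℂ) :
    ‖bil z‖ ^ 2 + ∑ i, ∑ j, 2 * (z i * star (z j)).im ^ 2 = normSq z ^ 2 := by
  have h1 : ‖bil z‖ ^ 2 = ∑ i, ∑ j, (z i ^ 2 * star (z j ^ 2)).re := by
    have : ((‖bil z‖ ^ 2 : ℝ) : ℂ) = bil z * star (bil z) := by
      push_cast
      exact (Complex.mul_conj' _).symm
    have h2 := congrArg Complex.re this
    rw [Complex.ofReal_re] at h2
    rw [h2, bil, star_sum, Finset.sum_mul_sum]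
    simp
  have h2 : normSq z ^ 2 = ∑ i, ∑ j, ‖z i‖ ^ 2 * ‖z j‖ ^ 2 := by
    rw [sq, normSq, Finset.sum_mul_sum]
  rw [h1, h2, ← Finset.sum_add_distrib]
  refine Finset.sum_congr rfl fun i _ => ?_
  rw [← Finset.sum_add_distrib]
  refine Finset.sum_congr rfl fun j _ => ?_
  rw [← Complex.normSq_eq_norm_sq, ← Complex.normSq_eq_norm_sq, Complex.normSq_apply,
    Complex.normSq_apply]
  simp [sq]
  ring

lemma norm_bil_le {n : ℕ} (z : Fin n → ℂ) : ‖bil z‖ ≤ normSq z := by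
  refine (norm_sum_le _ _).trans (le_of_eq ?_)
  simp [normSq]

lemma normSq_nonneg {n : ℕ} (z : Fin n → ℂ) : 0 ≤ normSq z :=
  Finset.sum_nonneg fun _ _ => by positivity

lemma normSq_lt_one {n : ℕ} {z : Fin n → ℂ} (hz : z ∈ cartanIV n) : normSq z < 1 := by
  have := hz.1
  rwa [Real.sqrt_lt' one_pos, one_pow] at this

lemma mem_cartanIV_iff {n : ℕ} {z : Fin n → ℂ} : z ∈ cartanIV n ↔ normSq z < 1 ∧ 0 < Delta z := by
  rw [cartanIV, mem_ofPred_eq, Real.sqrt_lt' one_pos, one_pow, Delta]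
  refine and_congr Iff.rfl ?_
  constructor <;> intro h <;> linarith

lemma Delta_le_one {n : ℕ} {z : Fin n → ℂ} (hz : z ∈ cartanIV n) : Delta z ≤ 1 := by
  have h1 := normSq_lt_one hz
  have h2 := norm_bil_le z
  have h3 := norm_nonneg (bil z)
  unfold Delta
  nlinarith [normSq_nonneg z]

lemma normSq_smul {n : ℕ} (c : ℂ) (z : Fin n → ℂ) : normSq (c • z) = ‖c‖ ^ 2 * normSq z := by
  simp [normSq, mul_pow, Finset.mul_sum]

lemma bil_smul {n : ℕ} (c : ℂ) (z : Fin n → ℂ) : bil (c • z) = c ^ 2 * bil z := by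
  simp [bil, mul_pow, Finset.mul_sum]

/-- `x ↦ x ^ (-s)`, with the value `∞` for `x ≤ 0`. -/
def negPow (s x : ℝ) : ENNReal := ENNReal.ofReal x ^ (-s)

lemma measurable_negPow (s : ℝ) : Measurable (negPow s) :=
  ENNReal.measurable_ofReal.pow_const _

lemma negPow_anti {s x y : ℝ} (hs : 0 ≤ s) (h : x ≤ y) : negPow s y ≤ negPow s x := by
  rw [negPow, negPow, ENNReal.rpow_neg, ENNReal.rpow_neg, ENNReal.inv_le_inv]
  exact ENNReal.rpow_le_rpow (ENNReal.ofReal_le_ofReal h) hs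

lemma negPow_mul {s x y : ℝ} (hx : 0 ≤ x) : negPow s (x * y) = negPow s x * negPow s y := by
  rw [negPow, ENNReal.ofReal_mul hx]
  exact ENNReal.mul_rpow_of_ne_top ENNReal.ofReal_ne_top ENNReal.ofReal_ne_top _

lemma negPow_zero {s : ℝ} (hs : 0 < s) : negPow s 0 = ⊤ := by
  simp [negPow, hs]

lemma negPow_lt_top {s x : ℝ} (hx : 0 < x) : negPow s x < ⊤ := by
  rw [negPow, ENNReal.ofReal_rpow_of_pos hx]
  exact ENNReal.ofReal_lt_top

lemma negPow_ne_zero {s x : ℝ} (hs : 0 ≤ s) : negPow s x ≠ 0 := by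
  simp [negPow, hs.not_gt]

/-- Within distance 1 of the singularity the integral converges because s < 1; elsewhere the
integrand is at most 1 on an interval of length 1. The bound is uniform in `c`, and `C ≠ 0` is
needed for C · ∞ = ∞. -/
lemma exists_lintegral_negPow_le {s : ℝ} (h0 : 0 < s) (h1 : s < 1) :
    ∃ C : ENNReal, C ≠ ⊤ ∧ C ≠ 0 ∧ ∀ c : ℝ, ∫⁻ t in Ioo (1 : ℝ) 2, negPow s |t - c| ≤ C := by
  have hfin : ∫⁻ u in Ioo (-1 : ℝ) 1, negPow s |u| ≠ ⊤ := by
    have hi : IntegrableOn (fun u : ℝ => |u| ^ (-s)) (Ioo (-1 : ℝ) 1) := by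
      have hb : Metric.ball (0 : ℝ) 1 = Ioo (-1) 1 := by rw [Real.ball_eq_Ioo]; simp
      rw [← hb]
      refine integrableOn_ball_of_norm_le_rpow (C := 1) (α := s) (by simp) (by simpa using h1)
        (Filter.Eventually.of_forall fun u => ?_)
        (measurable_id.abs.pow_const _).aestronglyMeasurable
      rw [one_mul, Real.norm_eq_abs, Real.norm_eq_abs, abs_of_nonneg (by positivity)]
    have := hi.lintegral_lt_top
    refine ne_of_lt (lt_of_le_of_lt (lintegral_mono_ae ?_) this)
    have hz : ∀ᵐ u : ℝ ∂(volume.restrict (Ioo (-1) 1)), u ≠ 0 :=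
      ae_restrict_of_ae (Measure.ae_ne volume 0)
    filter_upwards [hz] with u hu
    rw [negPow, ENNReal.ofReal_rpow_of_pos (abs_pos.2 hu)]
  refine ⟨(∫⁻ u in Ioo (-1 : ℝ) 1, negPow s |u|) + 1, by simp [hfin], by simp, fun c => ?_⟩
  have hle : ∀ u : ℝ, negPow s |u| ≤ (Ioo (-1 : ℝ) 1).indicator (fun u => negPow s |u|) u + 1 := by
    intro u
    by_cases hu : u ∈ Ioo (-1 : ℝ) 1
    · rw [indicator_of_mem hu]; exact le_self_add
    · have : 1 ≤ |u| := by
        by_contra! h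
        exact hu (abs_lt.1 h)
      refine le_add_left ((negPow_anti h0.le this).trans ?_)
      simp [negPow]
  calc ∫⁻ t in Ioo (1 : ℝ) 2, negPow s |t - c|
      ≤ ∫⁻ t in Ioo (1 : ℝ) 2, ((Ioo (-1 : ℝ) 1).indicator (fun u => negPow s |u|) (t - c) + 1) :=
        lintegral_mono fun t => hle _
    _ = (∫⁻ t in Ioo (1 : ℝ) 2, (Ioo (-1 : ℝ) 1).indicator (fun u => negPow s |u|) (t - c)) + 1 := by
        rw [lintegral_add_right _ measurable_const]
        simp
        norm_num
    _ ≤ (∫⁻ t, (Ioo (-1 : ℝ) 1).indicator (fun u => negPow s |u|) (t - c)) + 1 := by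
        gcongr
        exact Measure.restrict_le_self
    _ = (∫⁻ u in Ioo (-1 : ℝ) 1, negPow s |u|) + 1 := by
        rw [lintegral_sub_right_eq_self (μ := (volume : Measure ℝ))
          (fun u => (Ioo (-1 : ℝ) 1).indicator (fun u => negPow s |u|) u) c,
          lintegral_indicator measurableSet_Ioo]

/-- Averaging over translates in a fixed direction, over a parameter interval of length 1, reduces
integrability to one-dimensional integrals. -/
lemma lintegral_eq_lintegral_translates {n : ℕ} {f : (Fin n → ℂ) → ENNReal} (hf : Measurable f)
    (v : Fin n → ℂ) : ∫⁻ z, f z = ∫⁻ z, ∫⁻ t in Ioo (1 : ℝ) 2, f (z + t • v) := by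
  rw [lintegral_lintegral_swap]
  · have : ∀ t : ℝ, ∫⁻ z, f (z + t • v) = ∫⁻ z, f z := fun t =>
      lintegral_add_right_eq_self f (t • v)
    simp [this]
    norm_num
  · exact (hf.comp (by fun_prop)).aemeasurable

/-- The same averaging along rays; a dilation by t < 2 costs a Jacobian of at most 2^d. -/
lemma lintegral_le_lintegral_dilates {n : ℕ} {f : (Fin n → ℂ) → ENNReal} (hf : Measurable f) :
    ∫⁻ z, f z ≤ ENNReal.ofReal (2 ^ (Module.finrank ℝ (Fin n → ℂ))) *
      ∫⁻ z, ∫⁻ t in Ioo (1 : ℝ) 2, f (t • z) := by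
  set d := Module.finrank ℝ (Fin n → ℂ)
  have hmeas : Measurable fun p : (Fin n → ℂ) × ℝ => f (p.2 • p.1) := hf.comp (by fun_prop)
  rw [lintegral_lintegral_swap hmeas.aemeasurable]
  have key : ∀ t ∈ Ioo (1 : ℝ) 2, ∫⁻ z, f z ≤ ENNReal.ofReal (2 ^ d) * ∫⁻ z, f (t • z) := by
    intro t ht
    have ht0 : (0 : ℝ) < t := by linarith [ht.1]
    have h := Measure.map_addHaar_smul (volume : Measure (Fin n → ℂ)) ht0.ne'
    have h2 : ∫⁻ z, f (t • z) = ENNReal.ofReal |(t ^ d)⁻¹| * ∫⁻ z, f z := by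
      rw [← lintegral_map hf (measurable_const_smul t), h, lintegral_smul_measure, smul_eq_mul]
    rw [h2, ← mul_assoc, ← ENNReal.ofReal_mul (by positivity)]
    refine le_mul_of_one_le_left' ?_
    rw [ENNReal.one_le_ofReal, abs_of_pos (by positivity), ← div_eq_mul_inv,
      one_le_div (by positivity)]
    gcongr
    exact ht.2.le
  calc ∫⁻ z, f z = ∫⁻ t in Ioo (1 : ℝ) 2, ∫⁻ z, f z := by simp; norm_num
    _ ≤ ∫⁻ t in Ioo (1 : ℝ) 2, ENNReal.ofReal (2 ^ d) * ∫⁻ z, f (t • z) :=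
        setLIntegral_mono' measurableSet_Ioo key
    _ = _ := lintegral_const_mul' _ _ ENNReal.ofReal_ne_top

/-- Two translations remove the singularity: moving z_a by it adds t Re z_b to the imaginary part,
which leaves a factor |Re z_b|^(-s); moving z_b by t removes that factor. The ball is enlarged by 2
each time to contain the translates. -/
lemma lintegral_negPow_im_lt_top {n : ℕ} {s : ℝ} (h0 : 0 < s) (h1 : s < 1) {a b : Fin n}
    (hab : a ≠ b) :
    ∫⁻ z in Metric.ball (0 : Fin n → ℂ) 1, negPow s |(z a * star (z b)).im| < ⊤ := by
  obtain ⟨C, hC, hC0, hCle⟩ := exists_lintegral_negPow_le h0 h1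
  have hmem : ∀ (r : ℝ) (z v : Fin n → ℂ) (t : ℝ), t ∈ Ioo (1 : ℝ) 2 → ‖v‖ ≤ 1 →
      z + t • v ∈ Metric.ball (0 : Fin n → ℂ) r → z ∈ Metric.ball (0 : Fin n → ℂ) (r + 2) := by
    intro r z v t ht hv h
    rw [mem_ball_zero_iff] at *
    have h1 : ‖t • v‖ ≤ 2 := by
      rw [norm_smul, Real.norm_of_nonneg (by linarith [ht.1])]
      nlinarith [ht.1, ht.2, norm_nonneg v]
    have h2 := norm_sub_le (z + t • v) (t • v)
    rw [add_sub_cancel_right] at h2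
    linarith
  set g : (Fin n → ℂ) → ENNReal := (Metric.ball (0 : Fin n → ℂ) 1).indicator
    fun z => negPow s |(z a * star (z b)).im|
  set g' : (Fin n → ℂ) → ENNReal := (Metric.ball (0 : Fin n → ℂ) (1 + 2)).indicator
    fun z => negPow s |(z b).re|
  have hg : Measurable g := by
    refine Measurable.indicator ((measurable_negPow s).comp ?_) measurableSet_ball
    exact (by fun_prop : Continuous fun z : Fin n → ℂ => |(z a * star (z b)).im|).measurable
  have hg' : Measurable g' := by
    refine Measurable.indicator ((measurable_negPow s).comp ?_) measurableSet_ball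
    exact (by fun_prop : Continuous fun z : Fin n → ℂ => |(z b).re|).measurable
  have step1 : ∫⁻ z, g z ≤ C * ∫⁻ z, g' z := by
    rw [lintegral_eq_lintegral_translates hg (Pi.single a Complex.I), ← lintegral_const_mul C hg']
    refine lintegral_mono fun z => ?_
    by_cases hz : z ∈ Metric.ball (0 : Fin n → ℂ) (1 + 2)
    · simp only [g', indicator_of_mem hz]
      -- Here the right-hand side is infinite, so nothing is to be shown.
      by_cases hx : (z b).re = 0
      · simp [hx, negPow_zero h0, ENNReal.mul_top hC0]
      calc ∫⁻ t in Ioo (1 : ℝ) 2, g (z + t • (Pi.single a Complex.I : Fin n → ℂ))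
          ≤ ∫⁻ t in Ioo (1 : ℝ) 2, negPow s |(z b).re| *
              negPow s |t - ((z a).re * (z b).im / (z b).re - (z a).im)| := by
            refine lintegral_mono fun t => (indicator_le_self _ _ _).trans (le_of_eq ?_)
            rw [← negPow_mul (abs_nonneg _), ← abs_mul]
            congr 2
            simp [hab.symm]
            field_simp
            ring
        _ ≤ C * negPow s |(z b).re| := by
            rw [lintegral_const_mul' _ _ (negPow_lt_top (abs_pos.2 hx)).ne, mul_comm]
            gcongr
            exact hCle _
    · simp only [g', indicator_of_notMem hz, mul_zero, nonpos_iff_eq_zero]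
      refine (setLIntegral_congr_fun measurableSet_Ioo fun t ht => ?_).trans lintegral_zero
      exact indicator_of_notMem (fun h => hz (hmem _ _ _ t ht (by simp [Pi.norm_single]) h)) _
  have step2 : ∫⁻ z, g' z ≤ C * volume (Metric.ball (0 : Fin n → ℂ) (1 + 2 + 2)) := by
    rw [lintegral_eq_lintegral_translates hg' (Pi.single b 1),
      ← lintegral_indicator_const measurableSet_ball]
    refine lintegral_mono fun z => ?_
    by_cases hz : z ∈ Metric.ball (0 : Fin n → ℂ) (1 + 2 + 2)
    · rw [indicator_of_mem hz]
      refine le_trans (lintegral_mono fun t => ?_) (hCle (-(z b).re))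
      refine (indicator_le_self _ _ _).trans (le_of_eq ?_)
      simp [add_comm]
    · rw [indicator_of_notMem hz, nonpos_iff_eq_zero]
      refine (setLIntegral_congr_fun measurableSet_Ioo fun t ht => ?_).trans lintegral_zero
      exact indicator_of_notMem (fun h => hz (hmem _ _ _ t ht (by simp [Pi.norm_single]) h)) _
  rw [← lintegral_indicator measurableSet_ball]
  refine step1.trans_lt (ENNReal.mul_lt_top hC.lt_top (step2.trans_lt ?_))
  exact ENNReal.mul_lt_top hC.lt_top measure_ball_lt_top

/-- With N = |z|² and W = N² - |zᵀz|², `Delta (t • z)` is (1 - t²(N+√W))(1 - t²(N-√W)). In the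
domain both factors are positive; the second is at least √W ≥ |Im(z_a z̄_b)|, and the first vanishes
at most linearly in t. -/
lemma negPow_Delta_smul_le {n : ℕ} {s : ℝ} (hs : 0 ≤ s) (a b : Fin n) (z : Fin n → ℂ) :
    ∃ c : ℝ, ∀ t ∈ Ioo (1 : ℝ) 2, t • z ∈ cartanIV n →
      negPow s (Delta (t • z)) ≤
        negPow s (1 / 4) * negPow s |(z a * star (z b)).im| * negPow s |t - c| := by
  set N := normSq z with hN
  set W := N ^ 2 - ‖bil z‖ ^ 2 with hW
  have hWim : (z a * star (z b)).im ^ 2 ≤ W := by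
    have h := norm_bil_sq_add_sum_im z
    have h1 : 2 * (z a * star (z b)).im ^ 2 ≤ ∑ i, ∑ j, 2 * (z i * star (z j)).im ^ 2 :=
      (Finset.single_le_sum (f := fun j => 2 * (z a * star (z j)).im ^ 2)
        (fun j _ => by positivity) (Finset.mem_univ b)).trans
        (Finset.single_le_sum (f := fun i => ∑ j, 2 * (z i * star (z j)).im ^ 2)
          (fun j _ => Finset.sum_nonneg fun _ _ => by positivity) (Finset.mem_univ a))
    have h2 := sq_nonneg (z a * star (z b)).im
    simp only [hW, hN]
    linarith
  have hW0 : 0 ≤ W := (sq_nonneg _).trans hWim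
  have hsq : |(z a * star (z b)).im| ≤ √W := Real.abs_le_sqrt hWim
  have hN0 : 0 ≤ N := normSq_nonneg z
  have hsW : √W ^ 2 = W := Real.sq_sqrt hW0
  have hsW0 : 0 ≤ √W := Real.sqrt_nonneg W
  set α := √(N + √W) with hα
  have hα0 : 0 ≤ α := Real.sqrt_nonneg _
  have hα2 : α ^ 2 = N + √W := Real.sq_sqrt (by positivity)
  -- The first factor is 1 - (tα)² ≥ 1 - tα, with zero at t = 1/α. For α ≥ 1/4 this is α(1/α - t) ≥
  -- |t - c|/4; for α < 1/4 it exceeds 1/2 ≥ t/4, so c = 0 serves.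
  refine ⟨if α < 1 / 4 then 0 else 1 / α, fun t ht htz => ?_⟩
  have ht1 := ht.1
  have ht2 := ht.2
  have hsm : (t • z) = (t : ℂ) • z := by ext i; simp
  obtain ⟨hlt, hpos⟩ := mem_cartanIV_iff.1 htz
  have hD : Delta (t • z) = (1 - t ^ 2 * (N + √W)) * (1 - t ^ 2 * (N - √W)) := by
    rw [Delta, hsm, normSq_smul, bil_smul, norm_mul, norm_pow, Complex.norm_real,
      Real.norm_of_nonneg (by linarith)]
    have : ‖bil z‖ ^ 2 = N ^ 2 - √W ^ 2 := by rw [hsW, hW]; ring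
    rw [mul_pow, this]
    ring
  rw [hsm, normSq_smul, Complex.norm_real, Real.norm_of_nonneg (by linarith)] at hlt
  rw [hD] at hpos ⊢
  -- The factors cannot both be negative, since their sum 2 - 2t²N is positive in the domain.
  have hp : 0 < 1 - t ^ 2 * (N + √W) ∧ 0 < 1 - t ^ 2 * (N - √W) := by
    rcases pos_and_pos_or_neg_and_neg_of_mul_pos hpos with h | h
    · exact h
    · linarith [h.1, h.2]
  have htt : 1 ≤ t ^ 2 := by nlinarith
  have hf2 : √W ≤ 1 - t ^ 2 * (N - √W) := by nlinarith [hp.1]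
  have htα : t * α < 1 := by
    have : (t * α) ^ 2 < 1 := by rw [mul_pow, hα2]; linarith [hp.1]
    exact lt_of_pow_lt_pow_left₀ 2 zero_le_one (by simpa using this)
  have hf1 : 1 / 4 * |t - if α < 1 / 4 then 0 else 1 / α| ≤ 1 - t ^ 2 * (N + √W) := by
    have h1 : 1 - t * α ≤ 1 - t ^ 2 * (N + √W) := by
      rw [← hα2, ← mul_pow]
      nlinarith [mul_nonneg (by linarith : (0 : ℝ) ≤ t) hα0]
    refine le_trans ?_ h1
    split_ifs with h
    · rw [sub_zero, abs_of_pos (by linarith)]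
      nlinarith
    · push Not at h
      have hαpos : 0 < α := by linarith
      have : t < 1 / α := by rwa [lt_div_iff₀ hαpos]
      rw [abs_of_neg (by linarith)]
      have h3 : 1 - t * α = α * (1 / α - t) := by field_simp
      rw [h3]
      nlinarith
  rw [mul_right_comm, ← negPow_mul (by norm_num), ← negPow_mul (by positivity)]
  refine negPow_anti hs ?_
  exact mul_le_mul hf1 (hsq.trans hf2) (abs_nonneg _) hp.1.le

lemma lintegral_negPow_Delta_lt_top {n : ℕ} (hn : 2 ≤ n) {s : ℝ} (h0 : 0 < s) (h1 : s < 1) :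
    ∫⁻ z in cartanIV n, negPow s (Delta z) < ⊤ := by
  obtain ⟨C, hC, hC0, hCle⟩ := exists_lintegral_negPow_le h0 h1
  set a : Fin n := ⟨0, by omega⟩
  set b : Fin n := ⟨1, by omega⟩
  have hab : a ≠ b := by simp [a, b]
  have hmeas : Measurable fun z : Fin n → ℂ => negPow s (Delta z) :=
    (measurable_negPow s).comp (continuous_Delta n).measurable
  rw [← lintegral_indicator (measurableSet_cartanIV n)]
  refine (lintegral_le_lintegral_dilates (hmeas.indicator (measurableSet_cartanIV n))).trans_lt
    (ENNReal.mul_lt_top ENNReal.ofReal_lt_top ?_)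
  have key : ∫⁻ z, ∫⁻ t in Ioo (1 : ℝ) 2, (cartanIV n).indicator (fun z => negPow s (Delta z)) (t • z)
      ≤ ∫⁻ z, negPow s (1 / 4) * C * (Metric.ball (0 : Fin n → ℂ) 1).indicator
        (fun z => negPow s |(z a * star (z b)).im|) z := by
    refine lintegral_mono fun z => ?_
    by_cases hz : z ∈ Metric.ball (0 : Fin n → ℂ) 1
    · rw [indicator_of_mem hz]
      obtain ⟨c, hc⟩ := negPow_Delta_smul_le h0.le a b z
      by_cases hx : (z a * star (z b)).im = 0
      · rw [hx, abs_zero, negPow_zero h0, ENNReal.mul_top]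
        · exact le_top
        · exact mul_ne_zero (negPow_ne_zero h0.le) hC0
      calc _ ≤ ∫⁻ t in Ioo (1 : ℝ) 2, negPow s (1 / 4) * negPow s |(z a * star (z b)).im| *
            negPow s |t - c| := by
            refine setLIntegral_mono' measurableSet_Ioo fun t ht => ?_
            by_cases htz : t • z ∈ cartanIV n
            · rw [indicator_of_mem htz]; exact hc t ht htz
            · rw [indicator_of_notMem htz]; exact zero_le
        _ ≤ negPow s (1 / 4) * negPow s |(z a * star (z b)).im| * C := by
            rw [lintegral_const_mul']
            · gcongr
              exact hCle c
            · exact (ENNReal.mul_lt_top (negPow_lt_top (by norm_num))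
                (negPow_lt_top (abs_pos.2 hx))).ne
        _ = _ := by ring
    · rw [indicator_of_notMem hz, mul_zero, nonpos_iff_eq_zero]
      refine (setLIntegral_congr_fun measurableSet_Ioo fun t ht => ?_).trans lintegral_zero
      refine indicator_of_notMem (fun h => hz ?_) _
      rw [mem_ball_zero_iff, pi_norm_lt_iff one_pos]
      intro i
      have h2 := norm_lt_one_of_mem h i
      rw [Pi.smul_apply, norm_smul, Real.norm_of_nonneg (by linarith [ht.1])] at h2
      nlinarith [ht.1, norm_nonneg (z i)]
  refine key.trans_lt ?_
  rw [lintegral_const_mul', lintegral_indicator measurableSet_ball]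
  · exact ENNReal.mul_lt_top (ENNReal.mul_lt_top (negPow_lt_top (by norm_num)) hC.lt_top)
      (lintegral_negPow_im_lt_top h0 h1 hab)
  · exact (ENNReal.mul_lt_top (negPow_lt_top (by norm_num)) hC.lt_top).ne

/-- If the mass were infinite, the normalizing factor would be 0 and `bergmanMeasure` would vanish.
Since 0 < Δ ≤ 1, Δ^(λ-n) ≤ Δ^(-s) for any s ≥ n - λ; the maximum with 1/2 keeps s in (0, 1). -/
lemma weightedMeasure_univ_lt_top {n : ℕ} (hn : 2 ≤ n) {lam : ℝ} (hlam : (n : ℝ) - 1 < lam) :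
    weightedMeasure n lam univ < ⊤ := by
  set s := max ((n : ℝ) - lam) (1 / 2)
  have h0 : 0 < s := lt_max_of_lt_right (by norm_num)
  have h1 : s < 1 := max_lt (by linarith) (by norm_num)
  rw [weightedMeasure, withDensity_apply _ MeasurableSet.univ, Measure.restrict_univ]
  refine lt_of_le_of_lt (setLIntegral_mono' (measurableSet_cartanIV n) fun z hz => ?_)
    (lintegral_negPow_Delta_lt_top hn h0 h1)
  have hpos := (mem_cartanIV_iff.1 hz).2
  rw [negPow, ENNReal.ofReal_rpow_of_pos hpos]
  refine ENNReal.ofReal_le_ofReal (Real.rpow_le_rpow_of_exponent_ge hpos (Delta_le_one hz) ?_)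
  linarith [le_max_left ((n : ℝ) - lam) (1 / 2)]

lemma zero_mem_cartanIV (n : ℕ) : (0 : Fin n → ℂ) ∈ cartanIV n := by
  simp [cartanIV, normSq, bil]

lemma weightedMeasure_univ_ne_zero (n : ℕ) (lam : ℝ) : weightedMeasure n lam univ ≠ 0 := by
  rw [weightedMeasure, withDensity_apply _ MeasurableSet.univ, Measure.restrict_univ]
  intro h
  have hm : Measurable fun z : Fin n → ℂ => ENNReal.ofReal (Delta z ^ (lam - n)) :=
    ((continuous_Delta n).measurable.pow_const _).ennreal_ofReal
  rw [lintegral_eq_zero_iff hm] at h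
  have h2 : ∀ᵐ z ∂(volume.restrict (cartanIV n)), False := by
    filter_upwards [h, ae_restrict_mem (measurableSet_cartanIV n)] with z hz hzD
    have := Real.rpow_pos_of_pos (mem_cartanIV_iff.1 hzD).2 (lam - n)
    simp at hz
    linarith
  have h3 : volume (cartanIV n) = 0 := by
    rw [Filter.eventually_false_iff_eq_bot, ae_eq_bot] at h2
    simpa using congrArg (fun μ => μ univ) h2
  exact ((isOpen_cartanIV n).measure_pos volume ⟨0, zero_mem_cartanIV n⟩).ne' h3

lemma isProbabilityMeasure_bergmanMeasure {n : ℕ} (hn : 2 ≤ n) {lam : ℝ}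
    (hlam : (n : ℝ) - 1 < lam) : IsProbabilityMeasure (bergmanMeasure n lam) where
  measure_univ := by
    rw [bergmanMeasure, Measure.smul_apply, smul_eq_mul]
    exact ENNReal.inv_mul_cancel (weightedMeasure_univ_ne_zero n lam)
      (weightedMeasure_univ_lt_top hn hlam).ne

end Finiteness

-- Rotations, Casimir operator and harmonic decomposition of polynomials

section PolynomialAlgebra

open MvPolynomial

variable {n : ℕ}

/-- The derivation of the polynomial ring that acts on linear forms through the matrix `M`. -/
def linDer (M : Matrix (Fin n) (Fin n) ℂ) :
    Derivation ℂ (MvPolynomial (Fin n) ℂ) (MvPolynomial (Fin n) ℂ) :=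
  mkDerivation ℂ fun i => ∑ j, C (M i j) * X j

@[simp]
lemma linDer_X (M : Matrix (Fin n) (Fin n) ℂ) (i : Fin n) :
    linDer M (X i) = ∑ j, C (M i j) * X j := mkDerivation_X _ _ _

lemma linDer_add (M N : Matrix (Fin n) (Fin n) ℂ) : linDer (M + N) = linDer M + linDer N := by
  refine derivation_ext fun i => ?_
  simp [add_mul, Finset.sum_add_distrib]

lemma linDer_smul (c : ℂ) (M : Matrix (Fin n) (Fin n) ℂ) : linDer (c • M) = c • linDer M := by
  refine derivation_ext fun i => ?_
  simp [Finset.smul_sum, smul_eq_C_mul, mul_assoc]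

/-- Skew matrices generate rotations, which fix zᵀz: the terms M_ij X_i X_j cancel in pairs. Hence
multiplication by powers of `quad n` commutes with so(n). -/
lemma linDer_quad {M : Matrix (Fin n) (Fin n) ℂ} (hM : M.transpose = -M) :
    linDer M (quad n) = 0 := by
  have h : ∀ i j, M j i = -M i j := fun i j => by
    simpa using congrFun (congrFun hM i) j
  have h1 : linDer M (quad n) = ∑ i, ∑ j, 2 * (C (M i j) * (X i * X j)) := by
    simp only [quad, map_sum, Derivation.leibniz_pow, linDer_X]
    refine Finset.sum_congr rfl fun i _ => ?_
    simp only [Finset.smul_sum, nsmul_eq_mul, smul_eq_mul, Nat.cast_ofNat, Finset.mul_sum]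
    refine Finset.sum_congr rfl fun j _ => ?_
    ring
  have h2 : linDer M (quad n) = -linDer M (quad n) := by
    conv_lhs => rw [h1, Finset.sum_comm]
    rw [h1, ← Finset.sum_neg_distrib]
    refine Finset.sum_congr rfl fun i _ => ?_
    rw [← Finset.sum_neg_distrib]
    refine Finset.sum_congr rfl fun j _ => ?_
    rw [h i j, map_neg]
    ring
  exact self_eq_neg.1 h2

lemma linDer_mul_quad_pow {M : Matrix (Fin n) (Fin n) ℂ} (hM : M.transpose = -M)
    (p : MvPolynomial (Fin n) ℂ) (k : ℕ) :
    linDer M (p * quad n ^ k) = linDer M p * quad n ^ k := by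
  rw [Derivation.leibniz, Derivation.leibniz_pow, linDer_quad hM]
  simp [mul_comm]

/-- The matrix of the infinitesimal rotation in the plane of the coordinates `i` and `j`. -/
def rotMatrix (i j : Fin n) : Matrix (Fin n) (Fin n) ℂ :=
  Matrix.single j i 1 - Matrix.single i j 1

lemma rotMatrix_transpose (i j : Fin n) : (rotMatrix i j).transpose = -rotMatrix i j := by
  simp [rotMatrix]

lemma linDer_rotMatrix (i j : Fin n) (p : MvPolynomial (Fin n) ℂ) :
    linDer (rotMatrix i j) p = X i * pderiv j p - X j * pderiv i p := by
  have : linDer (rotMatrix i j) = (X i : MvPolynomial (Fin n) ℂ) • pderiv j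
      - (X j : MvPolynomial (Fin n) ℂ) • pderiv i := by
    refine derivation_ext fun k => ?_
    have h : ∀ a b c : Fin n, ∑ x, C (Matrix.single a b (1 : ℂ) c x) * X x =
        if a = c then (X b : MvPolynomial (Fin n) ℂ) else 0 := by
      intro a b c
      by_cases hac : a = c
      · simp [Matrix.single_apply, hac]
      · simp [hac]
    simp only [rotMatrix, linDer_X, Matrix.sub_apply, map_sub, sub_mul, Finset.sum_sub_distrib, h,
      Derivation.sub_apply, Derivation.smul_apply, pderiv_X, smul_eq_mul, Pi.single_apply,
      mul_ite, mul_one, mul_zero]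
    simp only [eq_comm]
  rw [this]
  simp

lemma pderiv_pderiv_comm (i j : Fin n) (p : MvPolynomial (Fin n) ℂ) :
    pderiv i (pderiv j p) = pderiv j (pderiv i p) := by
  ext m
  simp only [coeff_pderiv]
  by_cases h : i = j
  · rw [h]
  · simp only [Finsupp.add_apply, Finsupp.single_apply, h, Ne.symm h, if_false, add_zero]
    rw [add_right_comm]
    ring

/-- The Euler operator in the variables of `S`. -/
def eulerOn (S : Finset (Fin n)) (p : MvPolynomial (Fin n) ℂ) : MvPolynomial (Fin n) ℂ :=
  ∑ i ∈ S, X i * pderiv i p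

/-- The Casimir operator of the rotations in the variables of `S`, equal to r²Δ - E² - (|S| - 2)E up
to the factor 2 from ordered pairs. With all variables it separates degrees of harmonics; with one
variable omitted it controls zonal polynomials. -/
lemma sum_rot_rot (S : Finset (Fin n)) (p : MvPolynomial (Fin n) ℂ) :
    ∑ i ∈ S, ∑ j ∈ S, linDer (rotMatrix i j) (linDer (rotMatrix i j) p) =
      2 * ((∑ i ∈ S, X i ^ 2) * (∑ i ∈ S, pderiv i (pderiv i p)) - eulerOn S (eulerOn S p)
        - ((S.card : MvPolynomial (Fin n) ℂ) - 2) * eulerOn S p) := by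
  have hE : eulerOn S (eulerOn S p) = (∑ i ∈ S, ∑ j ∈ S, X i * X j * pderiv i (pderiv j p)) +
      eulerOn S p := by
    have h : ∀ i j, pderiv i (X j * pderiv j p) = X j * pderiv i (pderiv j p) +
        if i = j then pderiv j p else 0 := by
      intro i j
      rw [Derivation.leibniz, pderiv_X, Pi.single_apply, smul_eq_mul, smul_eq_mul, mul_ite, mul_one,
        mul_zero]
      simp only [eq_comm]
    rw [eulerOn, eulerOn, ← Finset.sum_add_distrib]
    refine Finset.sum_congr rfl fun i hi => ?_
    rw [map_sum, Finset.sum_congr rfl fun j _ => h i j, Finset.sum_add_distrib, Finset.sum_ite_eq,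
      if_pos hi, mul_add, Finset.mul_sum]
    simp only [mul_assoc]
  -- On the diagonal the rotation is 0, and the last term cancels the surplus first-order terms of
  -- the general formula.
  have hL : ∀ i j, linDer (rotMatrix i j) (linDer (rotMatrix i j) p) =
      X i ^ 2 * pderiv j (pderiv j p) + X j ^ 2 * pderiv i (pderiv i p)
      - 2 * (X i * X j * pderiv i (pderiv j p)) - X i * pderiv i p - X j * pderiv j p
      + if i = j then X i * pderiv i p + X j * pderiv j p else 0 := by
    intro i j
    simp only [linDer_rotMatrix, map_sub, Derivation.leibniz, smul_eq_mul, pderiv_X_self]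
    by_cases h : i = j
    · subst h
      simp only [pderiv_X_self, if_true]
      ring
    · rw [pderiv_X_of_ne h, pderiv_X_of_ne (Ne.symm h), pderiv_pderiv_comm j i, if_neg h]
      ring
  simp only [hL, Finset.sum_add_distrib, Finset.sum_sub_distrib]
  have h1 : ∑ i ∈ S, ∑ j ∈ S, X i ^ 2 * pderiv j (pderiv j p) =
      (∑ i ∈ S, X i ^ 2) * (∑ i ∈ S, pderiv i (pderiv i p)) := by rw [Finset.sum_mul_sum]
  have h2 : ∑ i ∈ S, ∑ j ∈ S, X j ^ 2 * pderiv i (pderiv i p) =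
      (∑ i ∈ S, X i ^ 2) * (∑ i ∈ S, pderiv i (pderiv i p)) := by
    rw [Finset.sum_comm, Finset.sum_mul_sum]
  have h3 : ∑ i ∈ S, ∑ j ∈ S, (if i = j then X i * pderiv i p + X j * pderiv j p else 0) =
      2 * eulerOn S p := by
    rw [eulerOn, Finset.mul_sum]
    refine Finset.sum_congr rfl fun i hi => ?_
    rw [Finset.sum_ite_eq, if_pos hi]
    ring
  have h4 : ∑ i ∈ S, ∑ _j ∈ S, X i * pderiv i p = S.card * eulerOn S p := by
    simp [eulerOn, Finset.mul_sum]
  have h5 : ∑ _i ∈ S, ∑ j ∈ S, X j * pderiv j p = S.card * eulerOn S p := by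
    simp [eulerOn]
  rw [h1, h2, h3, h4, h5, hE]
  simp only [← Finset.mul_sum]
  ring

lemma laplacian_apply (p : MvPolynomial (Fin n) ℂ) :
    laplacian n p = ∑ i, pderiv i (pderiv i p) := by
  simp [laplacian]

lemma eulerOn_univ {p : MvPolynomial (Fin n) ℂ} {m : ℕ} (hp : p.IsHomogeneous m) :
    eulerOn Finset.univ p = (m : MvPolynomial (Fin n) ℂ) * p := by
  rw [eulerOn, hp.sum_X_mul_pderiv, nsmul_eq_mul]

lemma sum_rot_rot_harmonic {p : MvPolynomial (Fin n) ℂ} {m : ℕ} (hp : p ∈ harmonic n m) :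
    ∑ i, ∑ j, linDer (rotMatrix i j) (linDer (rotMatrix i j) p) =
      (-(2 * m * (m + n - 2)) : ℂ) • p := by
  have h1 : laplacian n p = 0 := hp.1
  have h2 : p.IsHomogeneous m := hp.2
  rw [laplacian_apply] at h1
  have h3 : eulerOn Finset.univ ((m : MvPolynomial (Fin n) ℂ) * p) = m * (m * p) := by
    have : ((m : MvPolynomial (Fin n) ℂ) * p).IsHomogeneous m := by
      have := h2.C_mul (m : ℂ)
      simpa using this
    exact eulerOn_univ this
  rw [sum_rot_rot, h1, eulerOn_univ h2, h3, smul_eq_C_mul]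
  have hC : (C 2 : MvPolynomial (Fin n) ℂ) = 2 := map_ofNat C 2
  simp [hC]
  ring

lemma laplacian_quad_mul {p : MvPolynomial (Fin n) ℂ} {m : ℕ} (hp : p.IsHomogeneous m) :
    laplacian n (quad n * p) = ((2 * n + 4 * m : ℕ) : ℂ) • p + quad n * laplacian n p := by
  have hq : ∀ i, pderiv i (quad n) = 2 * X i := by
    intro i
    simp only [quad, map_sum, Derivation.leibniz_pow, pderiv_X]
    rw [Finset.sum_eq_single i]
    · simp
    · intro j _ hj
      simp [hj]
    · simp
  have hE := hp.sum_X_mul_pderiv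
  have h2 : ∀ i, pderiv i (2 : MvPolynomial (Fin n) ℂ) = 0 := fun i => by
    have := (pderiv i : Derivation ℂ (MvPolynomial (Fin n) ℂ) _).map_natCast 2
    simpa using this
  have h : ∀ i, pderiv i (pderiv i (quad n * p)) =
      2 * p + 4 * (X i * pderiv i p) + quad n * pderiv i (pderiv i p) := by
    intro i
    simp only [Derivation.leibniz, hq, smul_eq_mul, map_add, pderiv_X, h2, Pi.single_eq_same]
    ring
  simp only [laplacian_apply, h, Finset.sum_add_distrib, ← Finset.mul_sum, hE]
  have hC : (C 2 : MvPolynomial (Fin n) ℂ) = 2 := map_ofNat C 2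
  have hC' : (C 4 : MvPolynomial (Fin n) ℂ) = 4 := map_ofNat C 4
  simp [smul_eq_C_mul, hC, hC']
  ring

lemma isHomogeneous_quad (n : ℕ) : (quad n).IsHomogeneous 2 :=
  IsHomogeneous.sum _ _ _ fun i _ => by simpa using (isHomogeneous_X ℂ i).pow 2

lemma isHomogeneous_mul_quad_pow {p : MvPolynomial (Fin n) ℂ} {m : ℕ} (hp : p.IsHomogeneous m)
    (k : ℕ) : (p * quad n ^ k).IsHomogeneous (m + 2 * k) :=
  hp.mul ((isHomogeneous_quad n).pow k)

/-- Each further factor zᵀz adds a positive integer, by Euler's identity in `laplacian_quad_mul`, so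
the accumulated constant is non-zero. -/
lemma exists_laplacian_harmonic_mul_quad_pow (hn : 1 ≤ n) {h : MvPolynomial (Fin n) ℂ} {m : ℕ}
    (hh : h ∈ harmonic n m) (k : ℕ) :
    ∃ c : ℕ, c ≠ 0 ∧ laplacian n (h * quad n ^ (k + 1)) = (c : ℂ) • (h * quad n ^ k) := by
  have h0 : laplacian n h = 0 := hh.1
  have h1 : h.IsHomogeneous m := hh.2
  induction k with
  | zero =>
    refine ⟨2 * n + 4 * m, by omega, ?_⟩
    rw [zero_add, pow_one, mul_comm, laplacian_quad_mul h1, h0]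
    simp
  | succ k ih =>
    obtain ⟨c, hc, hcl⟩ := ih
    refine ⟨2 * n + 4 * (m + 2 * (k + 1)) + c, by omega, ?_⟩
    have e : h * quad n ^ (k + 1 + 1) = quad n * (h * quad n ^ (k + 1)) := by ring
    rw [e, laplacian_quad_mul (isHomogeneous_mul_quad_pow h1 (k + 1)), hcl]
    simp only [smul_eq_C_mul]
    push_cast
    simp only [map_add, map_mul]
    ring

/-- The polynomials of degree `m` of the form `h q ^ k` with `h` harmonic. -/
def harmonicProducts (n m : ℕ) : Submodule ℂ (MvPolynomial (Fin n) ℂ) :=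
  Submodule.span ℂ {p | ∃ k j, k + 2 * j = m ∧ ∃ h ∈ harmonic n k, p = h * quad n ^ j}

/-- On the generators the Laplacian lowers the power of zᵀz by one, up to a non-zero constant, so
raising the power inverts it. -/
lemma exists_laplacian_eq (hn : 1 ≤ n) {m : ℕ} {p : MvPolynomial (Fin n) ℂ}
    (hp : p ∈ harmonicProducts n m) :
    ∃ p' ∈ harmonicProducts n (m + 2), laplacian n p' = p := by
  induction hp using Submodule.span_induction with
  | mem p hp =>
    obtain ⟨k, j, hkj, h, hh, rfl⟩ := hp
    obtain ⟨c, hc, hcl⟩ := exists_laplacian_harmonic_mul_quad_pow hn hh j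
    refine ⟨(c : ℂ)⁻¹ • (h * quad n ^ (j + 1)), Submodule.smul_mem _ _
      (Submodule.subset_span ⟨k, j + 1, by omega, h, hh, rfl⟩), ?_⟩
    rw [map_smul, hcl, smul_smul, inv_mul_cancel₀ (by exact_mod_cast hc), one_smul]
  | zero => exact ⟨0, Submodule.zero_mem _, map_zero _⟩
  | add p q _ _ hp hq =>
    obtain ⟨p', hp', rfl⟩ := hp
    obtain ⟨q', hq', rfl⟩ := hq
    exact ⟨p' + q', Submodule.add_mem _ hp' hq', map_add _ _ _⟩
  | smul c p _ hp =>
    obtain ⟨p', hp', rfl⟩ := hp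
    exact ⟨c • p', Submodule.smul_mem _ _ hp', map_smul _ _ _⟩

lemma isHomogeneous_of_mem_harmonicProducts {m : ℕ} {p : MvPolynomial (Fin n) ℂ}
    (hp : p ∈ harmonicProducts n m) : p.IsHomogeneous m := by
  have : harmonicProducts n m ≤ homogeneousSubmodule (Fin n) ℂ m := by
    refine Submodule.span_le.2 ?_
    rintro _ ⟨k, j, rfl, h, hh, rfl⟩
    exact isHomogeneous_mul_quad_pow hh.2 j
  exact this hp

/-- Every homogeneous polynomial is a sum of products of harmonic polynomials with powers of
`zᵀz`. -/
lemma mem_harmonicProducts (hn : 1 ≤ n) (m : ℕ) {p : MvPolynomial (Fin n) ℂ}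
    (hp : p.IsHomogeneous m) : p ∈ harmonicProducts n m := by
  have hharm : ∀ {m : ℕ} {p : MvPolynomial (Fin n) ℂ}, p ∈ harmonic n m →
      p ∈ harmonicProducts n m := fun {m p} hp =>
    Submodule.subset_span ⟨m, 0, by omega, p, hp, by simp⟩
  induction m using Nat.strong_induction_on generalizing p with
  | _ m ih =>
    have hd : ∀ i, (pderiv i (pderiv i p)).IsHomogeneous (m - 1 - 1) := fun i =>
      hp.pderiv.pderiv
    rcases Nat.lt_or_ge m 2 with hm | hm
    · refine hharm ⟨?_, hp⟩
      change laplacian n p = 0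
      rw [laplacian_apply]
      refine Finset.sum_eq_zero fun i _ => ?_
      have h1 : (pderiv i p).IsHomogeneous 0 := by
        have := hp.pderiv (i := i)
        rwa [show m - 1 = 0 by omega] at this
      rw [(totalDegree_eq_zero_iff_eq_C (p := pderiv i p)).1 (Nat.le_zero.1 h1.totalDegree_le)]
      simp
    · have hL : (laplacian n p).IsHomogeneous (m - 2) := by
        rw [laplacian_apply]
        exact IsHomogeneous.sum _ _ _ fun i _ => hd i
      -- A particular solution of the Poisson equation with the Laplacian of `p` on the right; it
      -- differs from `p` by a harmonic polynomial.
      obtain ⟨p', hp', hpp'⟩ := exists_laplacian_eq hn (ih (m - 2) (by omega) hL)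
      rw [Nat.sub_add_cancel hm] at hp'
      have : p - p' ∈ harmonic n m := by
        refine ⟨?_, Submodule.sub_mem _ hp (isHomogeneous_of_mem_harmonicProducts hp')⟩
        change laplacian n (p - p') = 0
        rw [map_sub, hpp', sub_self]
      have := Submodule.add_mem _ (hharm this) hp'
      rwa [sub_add_cancel] at this

/-- The Laplacian of ℓ^k is k(k-1) ℓ^(k-2) ∑ a_i², which is 0 for an isotropic linear form. -/
lemma pow_linear_mem_harmonic (a : Fin n → ℂ) (ha : ∑ i, a i ^ 2 = 0) (k : ℕ) :
    (∑ i, C (a i) * X i) ^ k ∈ harmonic n k := by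
  constructor
  · change laplacian n _ = 0
    have hu : ∀ j, pderiv j (∑ i, C (a i) * X i) = C (a j) := by
      intro j
      simp [pderiv_X, Pi.single_apply]
    simp only [laplacian_apply, Derivation.leibniz_pow, hu, Derivation.leibniz, map_nsmul,
      smul_eq_mul, pderiv_C, mul_zero, zero_add]
    have : ∀ j : Fin n, k • (C (a j) * ((k - 1) • ((∑ i, C (a i) * X i) ^ (k - 1 - 1) * C (a j)))) =
        (k • (k - 1) • (∑ i, C (a i) * X i) ^ (k - 1 - 1)) * C (a j ^ 2) := by
      intro j
      simp only [nsmul_eq_mul, C_pow]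
      ring
    simp only [this]
    rw [← Finset.mul_sum, ← map_sum, ha, map_zero, mul_zero]
  · have := (IsHomogeneous.sum Finset.univ (fun i => C (a i) * X i) 1 fun j _ =>
      (isHomogeneous_X ℂ j).C_mul (a j)).pow k
    simpa using this

end PolynomialAlgebra

-- Uniqueness of zonal harmonics

section Zonal

open MvPolynomial

variable {n : ℕ}

lemma coeff_X_mul_pderiv (i : Fin n) (p : MvPolynomial (Fin n) ℂ) (m : Fin n →₀ ℕ) :
    coeff m (X i * pderiv i p) = m i * coeff m p := by
  rw [coeff_X_mul']
  split_ifs with h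
  · have h1 : 1 ≤ m i := Nat.one_le_iff_ne_zero.2 (Finsupp.mem_support_iff.1 h)
    have h2 : m - Finsupp.single i 1 + Finsupp.single i 1 = m :=
      tsub_add_cancel_of_le (Finsupp.single_le_iff.2 h1)
    rw [coeff_pderiv, h2, Finsupp.tsub_apply, Finsupp.single_eq_same, Nat.cast_sub h1]
    push_cast
    ring
  · rw [Finsupp.notMem_support_iff.1 h]
    simp

lemma coeff_eulerOn (S : Finset (Fin n)) (p : MvPolynomial (Fin n) ℂ) (m : Fin n →₀ ℕ) :
    coeff m (eulerOn S p) = ((∑ i ∈ S, m i : ℕ) : ℂ) * coeff m p := by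
  simp [eulerOn, coeff_sum, coeff_X_mul_pderiv, Finset.sum_mul]

/-- A harmonic polynomial that is infinitesimally invariant under the stabilizer of a basis
vector and vanishes there is zero. -/
lemma eq_zero_of_zonal (hn : 3 ≤ n) (o : Fin n) {k : ℕ} {h : MvPolynomial (Fin n) ℂ}
    (hh : h ∈ harmonic n k)
    (hrot : ∀ i j, i ≠ o → j ≠ o → linDer (rotMatrix i j) h = 0)
    (heval : eval (Pi.single o 1) h = 0) : h = 0 := by
  set S : Finset (Fin n) := Finset.univ.erase o with hS
  have hcard : S.card = n - 1 := by simp [hS]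
  have hlap : ∑ i ∈ S, pderiv i (pderiv i h) = -pderiv o (pderiv o h) := by
    have h1 : laplacian n h = 0 := hh.1
    rw [laplacian_apply, ← Finset.add_sum_erase _ _ (Finset.mem_univ o)] at h1
    exact eq_neg_of_add_eq_zero_right h1
  -- The Casimir operator of the stabilizer annihilates `h`, and harmonicity trades the Laplacian in
  -- the variables of `S` for -∂_o².
  have hcas : eulerOn S (eulerOn S h) + C ((n - 3 : ℕ) : ℂ) * eulerOn S h =
      -∑ i ∈ S, X i * (X i * pderiv o (pderiv o h)) := by
    have h1 := sum_rot_rot S h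
    rw [Finset.sum_eq_zero fun i hi => Finset.sum_eq_zero fun j hj => by
      rw [hrot i j (Finset.ne_of_mem_erase hi) (Finset.ne_of_mem_erase hj), map_zero]] at h1
    have h2 := (mul_eq_zero.1 h1.symm).resolve_left two_ne_zero
    have h3 : ((S.card : MvPolynomial (Fin n) ℂ) - 2) = C ((n - 3 : ℕ) : ℂ) := by
      rw [hcard, map_natCast, show n - 1 = (n - 3) + 2 by omega]
      push_cast
      ring
    rw [h3, hlap, mul_neg, Finset.sum_mul] at h2
    have h4 : ∑ i ∈ S, X i * (X i * pderiv o (pderiv o h)) =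
        ∑ i ∈ S, X i ^ 2 * pderiv o (pderiv o h) := Finset.sum_congr rfl fun i _ => by ring
    rw [h4]
    linear_combination -h2
  -- Induction on the degree d in the variables of `S`. Comparing coefficients in `hcas` gives (d² +
  -- (n-3)d) times a coefficient in terms of those of `S`-degree d - 2, and the factor is non-zero
  -- for d > 0.
  have key : ∀ d : ℕ, ∀ m : Fin n →₀ ℕ, ∑ i ∈ S, m i = d → coeff m h = 0 := by
    intro d
    induction d using Nat.strong_induction_on with
    | _ d ih =>
      intro m hm
      rcases Nat.eq_zero_or_pos d with hd | hd
      -- For d = 0 homogeneity leaves only the monomial X_o^k, whose coefficient is the value at the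
      -- basis vector.
      · have hmi : ∀ i, i ≠ o → m i = 0 := fun i hi =>
          Finset.sum_eq_zero_iff.1 (hm.trans hd) i (by simp [hS, hi])
        by_contra hne
        have hdeg : ∀ m', coeff m' h ≠ 0 → (∀ i, i ≠ o → m' i = 0) → m' o = k := by
          intro m' hm' hi
          have := hh.2 hm'
          rw [Finsupp.weight_apply, Finsupp.sum_fintype _ _ (by simp),
            Finset.sum_eq_single o (fun i _ hio => by simp [hi i hio]) (by simp)] at this
          simpa using this
        rw [eval_eq', Finset.sum_eq_single m] at heval
        · apply hne
          rw [Finset.prod_eq_one, mul_one] at heval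
          · exact heval
          · intro i _
            by_cases hi : i = o
            · subst hi; simp
            · simp [hmi i hi]
        · intro m' hm' hne'
          by_cases hall : ∀ i, i ≠ o → m' i = 0
          · refine absurd (Finsupp.ext fun i => ?_) hne'
            by_cases hi : i = o
            · rw [hi, hdeg m' (mem_support_iff.1 hm') hall, hdeg m hne hmi]
            · rw [hall i hi, hmi i hi]
          · push Not at hall
            obtain ⟨i, hi, hi0⟩ := hall
            rw [Finset.prod_eq_zero (Finset.mem_univ i), mul_zero]
            simp [hi, hi0]
        · intro hm'
          simp [notMem_support_iff.1 hm']
      · have h1 := congrArg (coeff m) hcas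
        rw [coeff_add, coeff_C_mul, coeff_eulerOn, coeff_eulerOn, hm, coeff_neg, coeff_sum,
          Finset.sum_eq_zero, neg_zero] at h1
        · have h2 : ((d * d + (n - 3) * d : ℕ) : ℂ) * coeff m h = 0 := by
            push_cast
            linear_combination h1
          refine (mul_eq_zero.1 h2).resolve_left ?_
          exact Nat.cast_ne_zero.2 (by positivity)
        · intro i hi
          rw [coeff_X_mul']
          split_ifs with hmi
          swap
          · rfl
          rw [coeff_X_mul']
          split_ifs with hmi'
          swap
          · rfl
          have hio : i ≠ o := Finset.ne_of_mem_erase hi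
          rw [coeff_pderiv, coeff_pderiv, ih _ _ _ rfl]
          · simp
          · rw [← hm]
            refine Finset.sum_lt_sum (fun j hj => ?_) ⟨i, hi, ?_⟩
            · simp [Finsupp.single_apply, (Finset.ne_of_mem_erase hj).symm]
              omega
            · have : m i ≠ 0 := Finsupp.mem_support_iff.1 hmi
              simp [hio.symm]
              omega
  ext m
  rw [key _ m rfl, coeff_zero]

end Zonal

-- Weights of polynomials and positive roots

section Weights

open MvPolynomial

variable {n : ℕ}

/-- The partner of an index in its coordinate plane; the last index is its own partner if `n` is
odd. -/
def partner (i : Fin n) : Fin n :=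
  if h : (i : ℕ) / 2 < n / 2 then
    if h2 : (i : ℕ) % 2 = 0 then ⟨(i : ℕ) + 1, by omega⟩ else ⟨(i : ℕ) - 1, by omega⟩
  else i

/-- The weight of the `i`-th basis weight vector: `± e_{i / 2}`, or zero. -/
def basicWeight (i : Fin n) : CartanDual n :=
  if h : (i : ℕ) / 2 < n / 2 then
    (if (i : ℕ) % 2 = 0 then 1 else -1 : ℂ) • coordFunctional n ⟨i / 2, h⟩
  else 0

lemma partner_val (i : Fin n) : (partner i : ℕ) = if (i : ℕ) / 2 < n / 2 then
    (if (i : ℕ) % 2 = 0 then (i : ℕ) + 1 else (i : ℕ) - 1) else i := by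
  unfold partner
  split_ifs <;> rfl

lemma partner_partner (i : Fin n) : partner (partner i) = i := by
  ext
  rw [partner_val, partner_val]
  split_ifs <;> omega

lemma basicWeight_partner (i : Fin n) : basicWeight (partner i) = -basicWeight i := by
  have hv := partner_val i
  by_cases h : (i : ℕ) / 2 < n / 2
  · have e1 : (partner i : ℕ) / 2 = i / 2 := by
      rw [hv]; split_ifs <;> omega
    have e2 : (partner i : ℕ) % 2 = 1 - i % 2 := by
      rw [hv]; split_ifs <;> omega
    have e3 : (partner i : ℕ) / 2 < n / 2 := by omega
    rw [basicWeight, basicWeight, dif_pos h, dif_pos e3]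
    have e4 : (⟨(partner i : ℕ) / 2, e3⟩ : Fin (n / 2)) = ⟨i / 2, h⟩ := Fin.ext e1
    rw [e4]
    rcases Nat.mod_two_eq_zero_or_one i with h2 | h2 <;> simp [e2, h2]
  · have : partner i = i := by ext; rw [hv, if_neg h]
    rw [this, basicWeight, dif_neg h, neg_zero]

lemma cartanElement_transpose (b : Fin (n / 2) → ℂ) :
    (cartanElement n b).transpose = -cartanElement n b := by
  simp [cartanElement, Matrix.transpose_sum, ← Finset.sum_neg_distrib, ← smul_neg]

lemma cartanElement_apply (b : Fin (n / 2) → ℂ) (i j : Fin n) :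
    cartanElement n b i j = if j = partner i then Complex.I * basicWeight i b else 0 := by
  have hv := partner_val i
  rw [cartanElement, Matrix.sum_apply]
  simp only [Matrix.smul_apply, Matrix.sub_apply, Matrix.single_apply, smul_eq_mul, Fin.ext_iff, hv]
  by_cases h : (i : ℕ) / 2 < n / 2
  · rw [basicWeight, dif_pos h, Finset.sum_eq_single ⟨i / 2, h⟩]
    · simp only [coordFunctional, LinearMap.smul_apply, LinearMap.proj_apply, if_pos h, smul_eq_mul]
      rcases Nat.mod_two_eq_zero_or_one i with h2 | h2
      · simp only [h2, if_true]
        rw [if_neg (by omega : ¬ (2 * ((i : ℕ) / 2) + 1 = i ∧ 2 * ((i : ℕ) / 2) = j))]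
        by_cases hj : (j : ℕ) = i + 1
        · rw [if_pos hj, if_pos (by omega)]; ring
        · rw [if_neg hj, if_neg (by omega)]; ring
      · simp only [h2, one_ne_zero, if_false]
        rw [if_neg (by omega : ¬ (2 * ((i : ℕ) / 2) = i ∧ 2 * ((i : ℕ) / 2) + 1 = j))]
        by_cases hj : (j : ℕ) = i - 1
        · rw [if_pos hj, if_pos (by omega)]; ring
        · rw [if_neg hj, if_neg (by omega)]; ring
    · intro x _ hx
      have : (x : ℕ) ≠ i / 2 := fun h => hx (Fin.ext h)
      rw [if_neg (by omega), if_neg (by omega)]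
      simp
    · simp
  · rw [basicWeight, dif_neg h]
    simp only [LinearMap.zero_apply, mul_zero, ite_self]
    refine Finset.sum_eq_zero fun x _ => ?_
    have := x.2
    rw [if_neg (by omega), if_neg (by omega)]
    simp

lemma linDer_cartanElement_X (b : Fin (n / 2) → ℂ) (i : Fin n) :
    linDer (-cartanElement n b) (X i) =
      C (-(Complex.I * basicWeight i b)) * X (partner i) := by
  rw [linDer_X, Finset.sum_eq_single (partner i)]
  · simp [cartanElement_apply]
  · intro j _ hj
    simp [cartanElement_apply, hj]
  · simp

/-- Substitution of the weight vectors `X i - √-1 X (partner i)` for the variables. -/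
def toWeightVars (n : ℕ) : MvPolynomial (Fin n) ℂ →ₐ[ℂ] MvPolynomial (Fin n) ℂ :=
  aeval fun i => X i - C Complex.I * X (partner i)

/-- The inverse of `toWeightVars`. -/
def ofWeightVars (n : ℕ) : MvPolynomial (Fin n) ℂ →ₐ[ℂ] MvPolynomial (Fin n) ℂ :=
  aeval fun i => C (1 / 2) * (X i + C Complex.I * X (partner i))

lemma half_add_half (p : MvPolynomial (Fin n) ℂ) : C (1 / 2 : ℂ) * (p + p) = p := by
  rw [← two_mul, ← mul_assoc, show (2 : MvPolynomial (Fin n) ℂ) = C 2 from (map_ofNat C 2).symm,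
    ← C_mul]
  norm_num

lemma C_I_mul_C_I : (C Complex.I * C Complex.I : MvPolynomial (Fin n) ℂ) = -1 := by
  rw [← C_mul, Complex.I_mul_I]; simp

/-- The cross terms cancel because `partner` is an involution. The computation also covers a
self-partnered index, where the substitution is multiplication by 1 - √-1. -/
lemma toWeightVars_ofWeightVars (p : MvPolynomial (Fin n) ℂ) :
    toWeightVars n (ofWeightVars n p) = p := by
  have : (toWeightVars n).comp (ofWeightVars n) = AlgHom.id ℂ _ := by
    refine algHom_ext fun i => ?_
    simp only [toWeightVars, ofWeightVars, AlgHom.comp_apply, aeval_X, map_mul, map_add, algHom_C,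
      AlgHom.id_apply, algebraMap_eq, partner_partner]
    conv_rhs => rw [← half_add_half (X i)]
    congr 1
    linear_combination (-X i : MvPolynomial (Fin n) ℂ) * C_I_mul_C_I
  exact DFunLike.congr_fun this p

lemma ofWeightVars_toWeightVars (p : MvPolynomial (Fin n) ℂ) :
    ofWeightVars n (toWeightVars n p) = p := by
  have : (ofWeightVars n).comp (toWeightVars n) = AlgHom.id ℂ _ := by
    refine algHom_ext fun i => ?_
    simp only [toWeightVars, ofWeightVars, AlgHom.comp_apply, aeval_X, map_mul, map_sub, algHom_C,
      AlgHom.id_apply, algebraMap_eq, partner_partner]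
    conv_rhs => rw [← half_add_half (X i)]
    linear_combination (-X i * C (1 / 2) : MvPolynomial (Fin n) ℂ) * C_I_mul_C_I
  exact DFunLike.congr_fun this p

lemma isHomogeneous_ofWeightVars {p : MvPolynomial (Fin n) ℂ} {k : ℕ} (hp : p.IsHomogeneous k) :
    (ofWeightVars n p).IsHomogeneous k := by
  have h := hp.aeval (S := ℂ) (n := 1) (fun i => C (1 / 2) * (X i + C Complex.I * X (partner i)))
    (fun i => ((isHomogeneous_X ℂ i).add ((isHomogeneous_X ℂ (partner i)).C_mul _)).C_mul _)
  simpa [ofWeightVars] using h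

/-- The new variables are eigenvectors of the Cartan subalgebra, and the Leibniz rule carries this
to products: in these coordinates every monomial is a weight vector. -/
lemma linDer_toWeightVars (b : Fin (n / 2) → ℂ) (p : MvPolynomial (Fin n) ℂ) :
    linDer (-cartanElement n b) (toWeightVars n p) =
      toWeightVars n (∑ i, C (basicWeight i b) * (X i * pderiv i p)) := by
  induction p using MvPolynomial.induction_on with
  | C a => simp [toWeightVars]
  | add p q hp hq =>
    rw [map_add, map_add, hp, hq, ← map_add, ← Finset.sum_add_distrib]
    simp only [map_add, mul_add]
  | mul_X p i hp =>
    have hX : linDer (-cartanElement n b) (toWeightVars n (X i)) =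
        C (basicWeight i b) * toWeightVars n (X i) := by
      simp only [toWeightVars, aeval_X, map_sub, Derivation.leibniz, linDer_cartanElement_X,
        basicWeight_partner, partner_partner, smul_eq_mul, LinearMap.neg_apply, derivation_C,
        mul_zero, add_zero, map_neg, map_mul, mul_neg, neg_neg]
      linear_combination (-C (basicWeight i b) * X i : MvPolynomial (Fin n) ℂ) * C_I_mul_C_I
    rw [map_mul, Derivation.leibniz, hX, hp, smul_eq_mul, smul_eq_mul]
    have : ∑ j, C (basicWeight j b) * (X j * pderiv j (p * X i)) =
        (∑ j, C (basicWeight j b) * (X j * pderiv j p)) * X i + C (basicWeight i b) * (p * X i) := by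
      have h : ∀ j, C (basicWeight j b) * (X j * pderiv j (p * X i)) =
          C (basicWeight j b) * (X j * pderiv j p) * X i +
            if j = i then C (basicWeight i b) * (p * X i) else 0 := by
        intro j
        rw [pderiv_mul]
        by_cases hj : j = i
        · subst hj; simp; ring
        · rw [pderiv_X_of_ne (Ne.symm hj), if_neg hj]; ring
      rw [Finset.sum_congr rfl fun j _ => h j, Finset.sum_add_distrib, Finset.sum_ite_eq',
        if_pos (Finset.mem_univ i), Finset.sum_mul]
    rw [this, map_add, map_mul, map_mul, map_mul]
    have hC : toWeightVars n (C (basicWeight i b)) = C (basicWeight i b) := by simp [toWeightVars]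
    rw [hC]
    ring

/-- The weights of the homogeneous polynomials of degree `k` are sums of `k` basic weights. -/
lemma exists_weight_eq_sum {k : ℕ} {p : MvPolynomial (Fin n) ℂ} (hp : p.IsHomogeneous k)
    (hp0 : p ≠ 0) {ν : CartanDual n}
    (hν : ∀ b, linDer (-cartanElement n b) p = ν b • p) :
    ∃ m : Fin n → ℕ, ∑ i, m i = k ∧ ν = ∑ i, m i • basicWeight i := by
  set p' := ofWeightVars n p with hp'
  have hpp' : toWeightVars n p' = p := toWeightVars_ofWeightVars p
  have hp'0 : p' ≠ 0 := by
    rintro h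
    rw [h, map_zero] at hpp'
    exact hp0 hpp'.symm
  -- Since monomials are weight vectors, the exponent of any monomial occurring in `p'` gives the
  -- weight.
  obtain ⟨m, hm⟩ := ne_zero_iff.1 hp'0
  refine ⟨m, ?_, ?_⟩
  · have := (isHomogeneous_ofWeightVars hp) hm
    rw [Finsupp.weight_apply, Finsupp.sum_fintype _ _ (by simp)] at this
    simpa using this
  · refine LinearMap.ext fun b => ?_
    have h1 := hν b
    rw [← hpp', linDer_toWeightVars, ← map_smul] at h1
    have h2 := congrArg (ofWeightVars n) h1
    rw [ofWeightVars_toWeightVars, ofWeightVars_toWeightVars] at h2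
    have h3 := congrArg (coeff m) h2
    simp only [coeff_sum, coeff_C_mul, coeff_X_mul_pderiv, coeff_smul, smul_eq_mul] at h3
    have h4 : (∑ i, (m i : ℂ) * basicWeight i b) * coeff m p' = ν b * coeff m p' := by
      rw [← h3, Finset.sum_mul]
      exact Finset.sum_congr rfl fun i _ => by ring
    have h5 := mul_right_cancel₀ hm h4
    rw [← h5]
    simp [LinearMap.sum_apply]

/-- The eigenvectors of the Cartan subalgebra in the defining representation. -/
def weightVector (i : Fin n) : Fin n → ℂ :=
  Pi.single i 1 - Complex.I • Pi.single (partner i) 1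

lemma cartanElement_mulVec_weightVector (b : Fin (n / 2) → ℂ) (i : Fin n) :
    (cartanElement n b).mulVec (weightVector i) = basicWeight i b • weightVector i := by
  have h : ∀ j, (cartanElement n b).mulVec (Pi.single j 1) =
      -(Complex.I * basicWeight j b) • Pi.single (partner j) 1 := by
    intro j
    ext l
    rw [Matrix.mulVec_single_one, Matrix.col_apply, cartanElement_apply]
    by_cases hl : l = partner j
    · subst hl
      simp [partner_partner, basicWeight_partner]
    · have : j ≠ partner l := fun hj => hl (by rw [hj, partner_partner])
      simp [this, hl]
  rw [weightVector, Matrix.mulVec_sub, Matrix.mulVec_smul, h, h, basicWeight_partner,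
    partner_partner]
  ext l
  simp only [Pi.sub_apply, Pi.smul_apply, smul_eq_mul, LinearMap.neg_apply]
  linear_combination (-(basicWeight i b * (Pi.single i 1 : Fin n → ℂ) l)) * Complex.I_mul_I

/-- The skew matrix u vᵀ - v uᵀ built from two weight vectors is a root vector for the sum of their
weights, so(n) being the exterior square of the defining representation. -/
lemma isRoot_add {i j : Fin n} (hij : i ≠ j) (hij' : partner i ≠ j)
    (hne : basicWeight i + basicWeight j ≠ 0) : IsRoot n (basicWeight i + basicWeight j) := by
  set u := weightVector i
  set v := weightVector j
  have hcT : ∀ b, (cartanElement n b).transpose = -cartanElement n b := cartanElement_transpose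
  refine ⟨hne, Matrix.vecMulVec u v - Matrix.vecMulVec v u, ?_, ?_, fun b => ?_⟩
  · rw [LieAlgebra.Orthogonal.mem_so]
    simp [Matrix.transpose_vecMulVec]
  · intro h
    have h1 := congrFun (congrFun h i) j
    have hji : partner j ≠ i := fun h => hij' (by rw [← h, partner_partner])
    simp only [Matrix.sub_apply, Matrix.vecMulVec_apply, u, v, weightVector, Pi.sub_apply,
      Pi.smul_apply, Pi.single_apply, smul_eq_mul, Matrix.zero_apply] at h1
    simp [hij, hij.symm, hij'.symm, hji.symm] at h1
    -- The (i, j) entry is a product of diagonal components of weight vectors; such a component is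
    -- 1, or 1 - √-1 for a self-partnered index, never 0.
    have key : ∀ l : Fin n, (1 - if l = partner l then Complex.I else 0 : ℂ) ≠ 0 := by
      intro l
      split_ifs
      · intro h
        have := congrArg Complex.re h
        simp at this
      · simp
    rcases h1 with h1 | h1
    · exact key i h1
    · exact key j h1
  · have hv : ∀ l, Matrix.vecMul (weightVector l) (cartanElement n b) =
        -(basicWeight l b) • weightVector l := by
      intro l
      rw [← Matrix.mulVec_transpose, hcT, Matrix.neg_mulVec, cartanElement_mulVec_weightVector,
        neg_smul]
    rw [Ring.lie_def, mul_sub, sub_mul, Matrix.mul_vecMulVec, Matrix.mul_vecMulVec,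
      Matrix.vecMulVec_mul, Matrix.vecMulVec_mul, hv, hv, cartanElement_mulVec_weightVector,
      cartanElement_mulVec_weightVector]
    ext x y
    simp only [Matrix.sub_apply, Matrix.vecMulVec_apply, Pi.smul_apply, smul_eq_mul,
      Matrix.smul_apply, LinearMap.add_apply]
    ring

lemma basicWeight_apply_single_zero (_hn : 2 ≤ n) {i : Fin n} (hi : 2 ≤ (i : ℕ)) :
    basicWeight i (Pi.single ⟨0, by omega⟩ 1) = 0 := by
  unfold basicWeight
  split_ifs with h
  all_goals simp [coordFunctional, Pi.single_apply, Fin.ext_iff]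
  all_goals omega

lemma basicWeight_zero (hn : 2 ≤ n) :
    basicWeight (⟨0, by omega⟩ : Fin n) = coordFunctional n ⟨0, by omega⟩ := by
  have h : 0 / 2 < n / 2 := by omega
  rw [basicWeight, dif_pos h]
  simp

lemma basicWeight_one (hn : 2 ≤ n) :
    basicWeight (⟨1, by omega⟩ : Fin n) = -coordFunctional n ⟨0, by omega⟩ := by
  rw [← basicWeight_zero hn, ← basicWeight_partner]
  congr 1
  ext
  rw [partner_val]
  simp
  omega

/-- These are the roots e_1 ± e_j with j > 1 and, for n odd, e_1 itself, obtained from the zero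
weight of the last index. Their leading coefficient is 1. -/
lemma isPositiveRoot_add (hn : 3 ≤ n) (hl : 0 < n / 2) {i : Fin n} (hi : 2 ≤ (i : ℕ)) :
    IsPositiveRoot n (coordFunctional n ⟨0, hl⟩ + basicWeight i) := by
  have hval : (coordFunctional n ⟨0, hl⟩ + basicWeight i) (Pi.single ⟨0, by omega⟩ 1) = 1 := by
    rw [LinearMap.add_apply, basicWeight_apply_single_zero (by omega) hi]
    simp [coordFunctional]
  refine ⟨?_, ⟨0, by omega⟩, fun i hi => absurd hi (by simp [Fin.lt_def]), 1, one_pos, ?_⟩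
  · rw [← basicWeight_zero (by omega)] at *
    refine isRoot_add ?_ ?_ ?_
    · intro h; rw [← h] at hi; simp at hi
    · intro h
      have := congrArg Fin.val h
      rw [partner_val] at this
      simp at this
      split_ifs at this <;> omega
    · intro h
      rw [h] at hval
      simp at hval
  · rw [hval]; simp

/-- The only difference that is neither 0 nor a root of the preceding kind is 2e_1 = (e_1 + w) +
(e_1 - w), where w is the weight of the third index; it exists because n ≥ 3. -/
lemma weightLE_basicWeight (hn : 3 ≤ n) (hl : 0 < n / 2) (i : Fin n) :
    WeightLE n (basicWeight i) (coordFunctional n ⟨0, hl⟩) := by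
  have hpart : ∀ j : Fin n, 2 ≤ (j : ℕ) → 2 ≤ (partner j : ℕ) := by
    intro j hj
    rw [partner_val]
    split_ifs <;> omega
  unfold WeightLE
  rcases Nat.lt_or_ge (i : ℕ) 2 with hi | hi
  · have : i = ⟨0, by omega⟩ ∨ i = ⟨1, by omega⟩ := by
      simp only [Fin.ext_iff]; omega
    rcases this with h | h <;> rw [h]
    · rw [basicWeight_zero (by omega), sub_self]
      exact AddSubmonoid.zero_mem _
    · have h2 : 2 ≤ ((⟨2, by omega⟩ : Fin n) : ℕ) := le_rfl
      have := AddSubmonoid.add_mem (AddSubmonoid.closure {α | IsPositiveRoot n α})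
        (AddSubmonoid.subset_closure (isPositiveRoot_add hn hl h2))
        (AddSubmonoid.subset_closure (isPositiveRoot_add hn hl (hpart _ h2)))
      rw [basicWeight_one (by omega)]
      convert this using 1
      rw [basicWeight_partner]
      abel
  · rw [sub_eq_add_neg, ← basicWeight_partner]
    exact AddSubmonoid.subset_closure (isPositiveRoot_add hn hl (hpart i hi))

lemma weightLE_sum (hn : 3 ≤ n) (hl : 0 < n / 2) (m : Fin n → ℕ) :
    WeightLE n (∑ i, m i • basicWeight i)
      (((∑ i, m i : ℕ) : ℂ) • coordFunctional n ⟨0, hl⟩) := by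
  unfold WeightLE
  have : (((∑ i, m i : ℕ) : ℂ) • coordFunctional n ⟨0, hl⟩) - ∑ i, m i • basicWeight i =
      ∑ i, m i • (coordFunctional n ⟨0, hl⟩ - basicWeight i) := by
    simp only [smul_sub, Finset.sum_sub_distrib]
    congr 1
    rw [← Finset.sum_smul, Nat.cast_smul_eq_nsmul]
  rw [this]
  exact AddSubmonoid.sum_mem _ fun i _ => AddSubmonoid.nsmul_mem _ (weightLE_basicWeight hn hl i) _

lemma linDer_cartanElement_highest (hn : 2 ≤ n) (k : ℕ) (b : Fin (n / 2) → ℂ) :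
    linDer (-cartanElement n b)
      ((X ⟨0, by omega⟩ - C Complex.I * X ⟨1, by omega⟩ : MvPolynomial (Fin n) ℂ) ^ k) =
      ((k : ℂ) • coordFunctional n ⟨0, by omega⟩) b •
        (X ⟨0, by omega⟩ - C Complex.I * X ⟨1, by omega⟩ : MvPolynomial (Fin n) ℂ) ^ k := by
  have hp : partner (⟨0, by omega⟩ : Fin n) = ⟨1, by omega⟩ := by
    ext
    rw [partner_val]
    simp
    omega
  have h1 : (X ⟨0, by omega⟩ - C Complex.I * X ⟨1, by omega⟩ : MvPolynomial (Fin n) ℂ) ^ k =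
      toWeightVars n (X ⟨0, by omega⟩ ^ k) := by
    rw [map_pow, toWeightVars, aeval_X, hp]
  rw [h1, linDer_toWeightVars, ← map_smul]
  congr 1
  rw [Finset.sum_eq_single ⟨0, by omega⟩]
  · rw [basicWeight_zero hn, pderiv_pow, pderiv_X_self, smul_eq_C_mul]
    rcases k with _ | k
    · simp
    · simp
      ring
  · intro j _ hj
    rw [pderiv_pow, pderiv_X_of_ne (Ne.symm hj)]
    simp
  · simp

lemma highest_mem_harmonic (hn : 2 ≤ n) (k : ℕ) :
    (X ⟨0, by omega⟩ - C Complex.I * X ⟨1, by omega⟩ : MvPolynomial (Fin n) ℂ) ^ k ∈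
      harmonic n k := by
  have h01 : (⟨0, by omega⟩ : Fin n) ≠ ⟨1, by omega⟩ := by simp
  have hsum : ∀ {M : Type} [AddCommMonoid M] (f : Fin n → M),
      (∀ i, i ≠ ⟨0, by omega⟩ → i ≠ ⟨1, by omega⟩ → f i = 0) →
      ∑ i, f i = f ⟨0, by omega⟩ + f ⟨1, by omega⟩ := by
    intro M _ f hf
    rw [← Finset.sum_pair h01]
    refine (Finset.sum_subset (Finset.subset_univ _) fun i _ hi => ?_).symm
    simp only [Finset.mem_insert, Finset.mem_singleton, not_or] at hi
    exact hf i hi.1 hi.2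
  have := pow_linear_mem_harmonic (n := n)
    (fun i => if i = ⟨0, by omega⟩ then 1 else if i = ⟨1, by omega⟩ then -Complex.I else 0) ?_ k
  · rw [hsum _ fun i h0 h1 => by simp [h0, h1]] at this
    simpa [h01.symm, sub_eq_add_neg] using this
  · rw [hsum _ fun i h0 h1 => by simp [h0, h1]]
    simp

lemma highest_ne_zero (hn : 2 ≤ n) (k : ℕ) :
    (X ⟨0, by omega⟩ - C Complex.I * X ⟨1, by omega⟩ : MvPolynomial (Fin n) ℂ) ^ k ≠ 0 := by
  refine pow_ne_zero _ fun h => ?_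
  have := congrArg (eval (Pi.single (⟨0, by omega⟩ : Fin n) (1 : ℂ))) h
  simp at this

lemma quad_ne_zero (hn : 1 ≤ n) : quad n ≠ 0 := by
  intro h
  have := congrArg (eval (Pi.single (⟨0, by omega⟩ : Fin n) (1 : ℂ))) h
  simp [quad, Pi.single_apply] at this

end Weights

-- Completeness of the Bergman space and density of polynomials

section Completeness

open Set Metric Filter Topology

variable {n : ℕ} {lam : ℝ}

/-- Δ^(λ-n) is continuous and positive on the domain, so it has a positive minimum on a compact
subset. This allows volume integrals to be estimated by the norm. -/
lemma exists_volume_restrict_le (hn : 2 ≤ n) (hlam : (n : ℝ) - 1 < lam) {K : Set (Fin n → ℂ)}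
    (hK : IsCompact K) (hKD : K ⊆ cartanIV n) :
    ∃ C : ENNReal, C ≠ ⊤ ∧ volume.restrict K ≤ C • bergmanMeasure n lam := by
  obtain ⟨ε, hε, hεK⟩ : ∃ ε : ℝ, 0 < ε ∧ ∀ z ∈ K, ε ≤ Delta z ^ (lam - n) := by
    rcases K.eq_empty_or_nonempty with rfl | hne
    · exact ⟨1, one_pos, by simp⟩
    have hpos : ∀ z ∈ K, 0 < Delta z := fun z hz => (mem_cartanIV_iff.1 (hKD hz)).2
    obtain ⟨z, hz, hmin⟩ := hK.exists_isMinOn hne (f := fun z => Delta z ^ (lam - n))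
      ((continuous_Delta n).continuousOn.rpow_const fun z hz => Or.inl (hpos z hz).ne')
    exact ⟨_, Real.rpow_pos_of_pos (hpos z hz) _, fun w hw => hmin hw⟩
  have h1 : ENNReal.ofReal ε • volume.restrict K ≤ weightedMeasure n lam := by
    refine Measure.le_iff.2 fun s hs => ?_
    rw [weightedMeasure, withDensity_apply _ hs, Measure.restrict_restrict hs, Measure.smul_apply,
      Measure.restrict_apply hs, smul_eq_mul, ← setLIntegral_const]
    refine (setLIntegral_mono' (hs.inter hK.measurableSet) fun z hz =>
      ENNReal.ofReal_le_ofReal (hεK z hz.2)).trans ?_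
    exact lintegral_mono_set (inter_subset_inter_right s hKD)
  set M := weightedMeasure n lam univ with hM
  have hM0 : M ≠ 0 := weightedMeasure_univ_ne_zero n lam
  have hMt : M ≠ ⊤ := (weightedMeasure_univ_lt_top hn hlam).ne
  have hε0 : ENNReal.ofReal ε ≠ 0 := by simpa using hε
  refine ⟨(ENNReal.ofReal ε)⁻¹ * M,
    ENNReal.mul_ne_top (ENNReal.inv_ne_top.2 hε0) hMt, ?_⟩
  rw [bergmanMeasure, smul_smul, mul_assoc, ENNReal.mul_inv_cancel hM0 hMt, mul_one]
  refine Measure.le_iff.2 fun s hs => ?_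
  have h2 := Measure.le_iff.1 h1 s hs
  rw [Measure.smul_apply, smul_eq_mul] at *
  calc volume.restrict K s = (ENNReal.ofReal ε)⁻¹ * (ENNReal.ofReal ε * volume.restrict K s) := by
        rw [← mul_assoc, ENNReal.inv_mul_cancel hε0 ENNReal.ofReal_ne_top, one_mul]
    _ ≤ _ := by gcongr

lemma act_one_left (t : Circle) (z : Fin n → ℂ) : act ((1, t) : SOxSO2 n) z = (t : ℂ) • z := by
  simp [act, actMatrix, complexMatrix_one, Matrix.smul_mulVec]

lemma measurable_indicator_of_continuousOn {s : Set (Fin n → ℂ)} (hs : MeasurableSet s)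
    {F : (Fin n → ℂ) → ℂ} (hF : ContinuousOn F s) : Measurable (s.indicator F) := by
  classical
  rw [← piecewise_eq_indicator]
  exact hF.measurable_piecewise continuousOn_const hs

/-- Sub-mean value inequality over a polydisc. -/
lemma enorm_mul_volume_ball_le {F : (Fin n → ℂ) → ℂ} {w : Fin n → ℂ} {r : ℝ}
    (hF : DifferentiableOn ℂ F (ball w r)) :
    ‖F w‖ₑ * volume (ball (0 : Fin n → ℂ) r) ≤ ∫⁻ z in ball w r, ‖F z‖ₑ := by
  set G : (Fin n → ℂ) → ENNReal := (ball w r).indicator fun z => ‖F z‖ₑ with hG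
  have hGm : Measurable G := by
    have h1 : Measurable ((ball w r).indicator F) :=
      measurable_indicator_of_continuousOn isOpen_ball.measurableSet hF.continuousOn
    have : G = fun z => ‖(ball w r).indicator F z‖ₑ := by
      ext z
      by_cases hz : z ∈ ball w r <;> simp [hG, hz]
    rw [this]
    exact h1.enorm
  -- The one-variable mean value property on the disc t ↦ w + t v; integration over v in the ball, a
  -- polydisc for the sup norm, and exchange of integrals give the claim.
  have hpt : ∀ v ∈ ball (0 : Fin n → ℂ) r,
      ENNReal.ofReal (2 * Real.pi) * ‖F w‖ₑ ≤
        ∫⁻ θ in Ioc 0 (2 * Real.pi), G (w + (Circle.exp θ : ℂ) • v) := by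
    intro v hv
    rw [mem_ball_zero_iff] at hv
    set g : ℂ → ℂ := fun t => F (w + t • v) with hg
    have hcont : Continuous fun t : ℂ => w + t • v := by fun_prop
    have hmem : ∀ t ∈ closedBall (0 : ℂ) 1, w + t • v ∈ ball w r := by
      intro t ht
      rw [mem_closedBall_zero_iff] at ht
      rw [mem_ball, dist_eq_norm, add_sub_cancel_left, norm_smul]
      nlinarith [norm_nonneg v, norm_nonneg t]
    have hgd : DifferentiableOn ℂ g ((fun t : ℂ => w + t • v) ⁻¹' ball w r) :=
      hF.comp ((differentiable_id.smul_const v).const_add w).differentiableOn fun _ h => h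
    have hg1 : DiffContOnCl ℂ g (ball 0 |(1 : ℝ)|) := by
      rw [abs_one]
      exact hgd.diffContOnCl_ball hmem
    have havg := hg1.circleAverage
    have hg0 : g 0 = F w := by simp [hg]
    rw [hg0, Real.circleAverage] at havg
    have hle : ‖∫ θ in (0)..2 * Real.pi, g (circleMap 0 1 θ)‖ₑ ≤
        ∫⁻ θ in Ioc 0 (2 * Real.pi), ‖g (circleMap 0 1 θ)‖ₑ := by
      rw [intervalIntegral.integral_of_le Real.two_pi_pos.le]
      exact enorm_integral_le_lintegral_enorm _
    rw [← havg, enorm_smul, ← mul_assoc]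
    have hc : ENNReal.ofReal (2 * Real.pi) * ‖(2 * Real.pi)⁻¹‖ₑ = 1 := by
      rw [Real.enorm_eq_ofReal (by positivity), ← ENNReal.ofReal_mul (by positivity),
        mul_inv_cancel₀ (by positivity), ENNReal.ofReal_one]
    rw [hc, one_mul]
    refine hle.trans (le_of_eq (setLIntegral_congr_fun measurableSet_Ioc fun θ _ => ?_))
    have hcm : circleMap 0 1 θ = (Circle.exp θ : ℂ) := by simp [circleMap]
    have : w + (Circle.exp θ : ℂ) • v ∈ ball w r := hmem _ (by simp)
    simp only [hcm, hG, indicator_of_mem this, hg]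
  -- Multiplication by a unimodular scalar preserves both volume and the polydisc, so the inner
  -- integral is independent of θ.
  have hrot : ∀ θ : ℝ, ∫⁻ v in ball (0 : Fin n → ℂ) r, G (w + (Circle.exp θ : ℂ) • v) =
      ∫⁻ z in ball w r, ‖F z‖ₑ := by
    intro θ
    have h1 := measurePreserving_act_volume (n := n) (1, Circle.exp θ)
    have h2 : ∫⁻ v, G (w + (Circle.exp θ : ℂ) • v) = ∫⁻ v, G (w + v) := by
      rw [← h1.lintegral_comp (f := fun v => G (w + v)) (hGm.comp (by fun_prop))]
      simp only [act_one_left]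
    have h3 : ∫⁻ v in ball (0 : Fin n → ℂ) r, G (w + (Circle.exp θ : ℂ) • v) =
        ∫⁻ v, G (w + (Circle.exp θ : ℂ) • v) := by
      refine setLIntegral_eq_of_support_subset fun v hv => ?_
      have h4 : w + (Circle.exp θ : ℂ) • v ∈ ball w r := by
        by_contra h
        exact hv (indicator_of_notMem h _)
      rw [mem_ball, dist_eq_norm, add_sub_cancel_left, norm_smul, Circle.norm_coe, one_mul] at h4
      rwa [mem_ball_zero_iff]
    rw [h3, h2, lintegral_add_left_eq_self G w, hG, lintegral_indicator measurableSet_ball]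
  have h2pi : ENNReal.ofReal (2 * Real.pi) ≠ 0 := by simp [Real.pi_pos]
  refine (ENNReal.mul_le_mul_iff_right h2pi ENNReal.ofReal_ne_top).1 ?_
  calc ENNReal.ofReal (2 * Real.pi) * (‖F w‖ₑ * volume (ball (0 : Fin n → ℂ) r))
      = ∫⁻ _v in ball (0 : Fin n → ℂ) r, ENNReal.ofReal (2 * Real.pi) * ‖F w‖ₑ := by
        rw [setLIntegral_const]; ring
    _ ≤ ∫⁻ v in ball (0 : Fin n → ℂ) r, ∫⁻ θ in Ioc 0 (2 * Real.pi),
          G (w + (Circle.exp θ : ℂ) • v) := setLIntegral_mono' measurableSet_ball hpt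
    _ = ∫⁻ θ in Ioc 0 (2 * Real.pi), ∫⁻ v in ball (0 : Fin n → ℂ) r,
          G (w + (Circle.exp θ : ℂ) • v) := by
        refine lintegral_lintegral_swap (hGm.comp ?_).aemeasurable
        fun_prop
    _ = _ := by
        simp only [hrot]
        rw [setLIntegral_const, Real.volume_Ioc, sub_zero, mul_comm]

/-- Point evaluations are locally uniformly bounded on the Bergman space. -/
lemma exists_norm_le_of_mem_cartanIV (hn : 2 ≤ n) (hlam : (n : ℝ) - 1 < lam) {z₀ : Fin n → ℂ}
    (hz₀ : z₀ ∈ cartanIV n) :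
    ∃ r > 0, ball z₀ r ⊆ cartanIV n ∧ ∃ C : ℝ, ∀ (f : Lp ℂ 2 (bergmanMeasure n lam))
      (F : (Fin n → ℂ) → ℂ), DifferentiableOn ℂ F (cartanIV n) → f =ᵐ[bergmanMeasure n lam] F →
      ∀ w ∈ ball z₀ r, ‖F w‖ ≤ C * ‖f‖ := by
  have := isProbabilityMeasure_bergmanMeasure hn hlam
  obtain ⟨R, hR, hRD⟩ := nhds_basis_closedBall.mem_iff.1 ((isOpen_cartanIV n).mem_nhds hz₀)
  obtain ⟨C, hC, hle⟩ := exists_volume_restrict_le hn hlam (isCompact_closedBall z₀ R) hRD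
  have hR2 : 0 < R / 2 := by positivity
  set V := volume (ball (0 : Fin n → ℂ) (R / 2)) with hV
  have hV0 : V ≠ 0 := (measure_ball_pos volume 0 hR2).ne'
  have hVt : V ≠ ⊤ := measure_ball_lt_top.ne
  refine ⟨R / 2, hR2, (ball_subset_closedBall.trans (closedBall_subset_closedBall
    (by linarith))).trans hRD, (C / V).toReal, fun f F hF hfF w hw => ?_⟩
  have hsub : ball w (R / 2) ⊆ closedBall z₀ R := by
    intro x hx
    rw [mem_ball] at *
    rw [mem_closedBall]
    linarith [dist_triangle x w z₀]
  have h1 := enorm_mul_volume_ball_le (hF.mono (hsub.trans hRD))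
  have h2 : ∫⁻ z in ball w (R / 2), ‖F z‖ₑ ≤ C * ‖f‖ₑ := by
    calc ∫⁻ z in ball w (R / 2), ‖F z‖ₑ ≤ ∫⁻ z in closedBall z₀ R, ‖F z‖ₑ := lintegral_mono_set hsub
      _ ≤ ∫⁻ z, ‖F z‖ₑ ∂(C • bergmanMeasure n lam) := lintegral_mono' hle le_rfl
      _ = C * ∫⁻ z, ‖f z‖ₑ ∂bergmanMeasure n lam := by
        rw [lintegral_smul_measure, smul_eq_mul]
        congr 1
        refine lintegral_congr_ae ?_
        filter_upwards [hfF] with z hz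
        rw [hz]
      _ ≤ C * ‖f‖ₑ := by
        gcongr
        rw [← eLpNorm_one_eq_lintegral_enorm, Lp.enorm_def]
        exact eLpNorm_le_eLpNorm_of_exponent_le one_le_two (Lp.aestronglyMeasurable f)
  have h3 : ‖F w‖ₑ ≤ C / V * ‖f‖ₑ := by
    have := h1.trans h2
    rw [← ENNReal.le_div_iff_mul_le (Or.inl hV0) (Or.inl hVt)] at this
    refine this.trans (le_of_eq ?_)
    rw [ENNReal.div_eq_inv_mul, ENNReal.div_eq_inv_mul, mul_assoc]
  have h4 := ENNReal.toReal_mono (ENNReal.mul_ne_top (ENNReal.div_ne_top hC hV0) enorm_ne_top) h3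
  rwa [ENNReal.toReal_mul, toReal_enorm, toReal_enorm] at h4

lemma eqOn_zero_of_ae_eq_zero (hn : 2 ≤ n) (hlam : (n : ℝ) - 1 < lam) {F : (Fin n → ℂ) → ℂ}
    (hF : DifferentiableOn ℂ F (cartanIV n)) (h0 : F =ᵐ[bergmanMeasure n lam] 0) :
    ∀ z ∈ cartanIV n, F z = 0 := by
  intro z hz
  obtain ⟨r, hr, -, C, hC⟩ := exists_norm_le_of_mem_cartanIV hn hlam hz
  have := hC 0 F hF ((Lp.coeFn_zero ℂ 2 _).trans h0.symm) z (mem_ball_self hr)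
  simpa using this

/-- Bounded point evaluations turn L² convergence into locally uniform convergence, so the pointwise
limit is holomorphic; an almost everywhere convergent subsequence identifies it with the L² limit.
-/
lemma isClosed_bergman (hn : 2 ≤ n) (hlam : (n : ℝ) - 1 < lam) :
    IsClosed (bergman n lam : Set (Lp ℂ 2 (bergmanMeasure n lam))) := by
  refine IsSeqClosed.isClosed fun u f hu huf => ?_
  choose F hF huF using hu
  have hcauchy : ∀ z ∈ cartanIV n, ∃ r > 0, ball z r ⊆ cartanIV n ∧
      UniformCauchySeqOn F atTop (ball z r) := by
    intro z hz
    obtain ⟨r, hr, hrD, C, hC⟩ := exists_norm_le_of_mem_cartanIV hn hlam hz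
    refine ⟨r, hr, hrD, Metric.uniformCauchySeqOn_iff.2 fun ε hε => ?_⟩
    have hC' : 0 < |C| + 1 := by positivity
    obtain ⟨N, hN⟩ := Metric.cauchySeq_iff.1 huf.cauchySeq (ε / (|C| + 1)) (by positivity)
    refine ⟨N, fun k hk l hl w hw => ?_⟩
    have h1 := hC (u k - u l) (F k - F l) ((hF k).sub (hF l))
      ((Lp.coeFn_sub _ _).trans ((huF k).sub (huF l))) w hw
    have h2 := hN k hk l hl
    rw [dist_eq_norm, lt_div_iff₀ hC'] at h2
    rw [dist_eq_norm]
    have h3 : C * ‖u k - u l‖ ≤ ‖u k - u l‖ * (|C| + 1) := by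
      nlinarith [norm_nonneg (u k - u l), le_abs_self C]
    exact (h1.trans h3).trans_lt h2
  have hlim : ∀ z, ∃ L, z ∈ cartanIV n → Tendsto (fun k => F k z) atTop (𝓝 L) := by
    intro z
    by_cases hz : z ∈ cartanIV n
    · obtain ⟨r, hr, -, hC⟩ := hcauchy z hz
      exact (cauchySeq_tendsto_of_complete (hC.cauchySeq (mem_ball_self hr))).imp fun _ h _ => h
    · exact ⟨0, fun h => absurd h hz⟩
  choose G hG using hlim
  refine ⟨G, fun z hz => ?_, ?_⟩
  · obtain ⟨r, hr, hrD, hC⟩ := hcauchy z hz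
    have hT := hC.tendstoUniformlyOn_of_tendsto fun w hw => hG w (hrD hw)
    exact (differentiableAt_of_tendstoUniformlyOn_ball hr (fun k => (hF k).mono hrD)
      hT).differentiableWithinAt
  · obtain ⟨ns, hns, hae⟩ := (tendstoInMeasure_of_tendsto_Lp huf).exists_seq_tendsto_ae
    filter_upwards [hae, ae_all_iff.2 huF, ae_mem_cartanIV n lam] with z hz hzF hzD
    refine tendsto_nhds_unique hz ?_
    simp only [hzF]
    exact (hG z hzD).comp hns.tendsto_atTop

lemma completeSpace_bergman (hn : 2 ≤ n) (hlam : (n : ℝ) - 1 < lam) :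
    CompleteSpace (bergman n lam) :=
  (isClosed_bergman hn hlam).completeSpace_coe

lemma polyToBergman_injective (hn : 2 ≤ n) (hlam : (n : ℝ) - 1 < lam) :
    Function.Injective (polyToBergman n lam) := by
  rw [injective_iff_map_eq_zero]
  intro p hp
  have h1 : (fun z => MvPolynomial.eval z p) =ᵐ[bergmanMeasure n lam] 0 := by
    have h2 := MemLp.coeFn_toLp (memLp_poly n lam p)
    have h3 : (memLp_poly n lam p).toLp _ = 0 := congrArg Subtype.val hp
    rw [h3] at h2
    exact h2.symm.trans (Lp.coeFn_zero ℂ 2 _)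
  have h2 := eqOn_zero_of_ae_eq_zero hn hlam (differentiable_poly n p).differentiableOn h1
  obtain ⟨r, hr, hrD⟩ := Metric.isOpen_iff.1 (isOpen_cartanIV n) 0 (zero_mem_cartanIV n)
  refine MvPolynomial.funext_set (fun _ => ball (0 : ℂ) r)
    (fun _ => infinite_of_mem_nhds 0 (ball_mem_nhds 0 hr)) fun z hz => ?_
  rw [h2 z (hrD ?_), map_zero]
  rw [ball_pi _ hr]
  simpa using hz

lemma eval_subst (B : Matrix (Fin n) (Fin n) ℂ) (p : MvPolynomial (Fin n) ℂ) (z : Fin n → ℂ) :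
    MvPolynomial.eval z (subst B p) = MvPolynomial.eval (B.mulVec z) p := by
  induction p using MvPolynomial.induction_on with
  | C a => simp [subst]
  | add p q hp hq => simp only [map_add, hp, hq]
  | mul_X p i hp =>
    rw [map_mul, map_mul, map_mul, hp, MvPolynomial.eval_X]
    congr 1
    simp [subst, Matrix.mulVec, dotProduct]

lemma rep_inv_apply {G E : Type*} [Group G] [NormedAddCommGroup E] [InnerProductSpace ℂ E]
    (π : G →* (E ≃ₗᵢ[ℂ] E)) (g : G) (v : E) : π g⁻¹ (π g v) = v := by
  have := DFunLike.congr_fun (map_mul π g⁻¹ g) v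
  rw [inv_mul_cancel, map_one] at this
  exact this.symm

lemma bergmanRep_polyToBergman (g : SOxSO2 n) (p : MvPolynomial (Fin n) ℂ) :
    bergmanRep n lam g (polyToBergman n lam p) =
      polyToBergman n lam (subst (actMatrix g⁻¹) p) := by
  apply Subtype.ext
  apply Lp.ext
  refine (Lp.coeFn_compMeasurePreserving _ (measurePreserving_act lam g⁻¹)).trans ?_
  refine .trans ?_ (MemLp.coeFn_toLp (memLp_poly n lam (subst (actMatrix g⁻¹) p))).symm
  refine ((measurePreserving_act lam g⁻¹).quasiMeasurePreserving.ae_eq_comp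
    (MemLp.coeFn_toLp (memLp_poly n lam p))).trans (ae_of_all _ fun z => ?_)
  simp only [Function.comp_apply, act, eval_subst]

lemma smul_mem_cartanIV {z : Fin n → ℂ} (hz : z ∈ cartanIV n) {t : ℂ} (ht : ‖t‖ ≤ 1) :
    t • z ∈ cartanIV n := by
  obtain ⟨h1, h2⟩ := mem_cartanIV_iff.1 hz
  have h0 := normSq_nonneg z
  set u := ‖t‖ ^ 2 with hu
  have hu0 : 0 ≤ u := by positivity
  have hu1 : u ≤ 1 := pow_le_one₀ (norm_nonneg t) ht
  rw [mem_cartanIV_iff, Delta, normSq_smul, bil_smul, norm_mul, norm_pow, ← hu]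
  rw [Delta] at h2
  refine ⟨by nlinarith, ?_⟩
  rcases hu0.eq_or_lt with h | h
  · rw [← h]; norm_num
  -- With N = |z|² and B = |zᵀz|² this is 1 - 2uN + u²B = u² Δ(z) + (1 - u)(1 + u - 2uN).
  · nlinarith [mul_pos (mul_pos h h) h2, mul_nonneg (sub_nonneg.2 hu1)
      (by nlinarith : 0 ≤ 1 + u - 2 * u * normSq z)]

lemma subst_smul_one {p : MvPolynomial (Fin n) ℂ} {m : ℕ} (hp : p.IsHomogeneous m)
    (c : ℂ) : subst (c • (1 : Matrix (Fin n) (Fin n) ℂ)) p = c ^ m • p := by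
  refine MvPolynomial.funext fun z => ?_
  rw [eval_subst, Matrix.smul_mulVec, Matrix.one_mulVec, MvPolynomial.smul_eval,
    MvPolynomial.eval_eq', MvPolynomial.eval_eq', Finset.mul_sum]
  refine Finset.sum_congr rfl fun d hd => ?_
  have hdeg := hp (MvPolynomial.mem_support_iff.1 hd)
  rw [Finsupp.weight_apply, Finsupp.sum_fintype _ _ (by simp)] at hdeg
  simp only [Pi.smul_apply, smul_eq_mul, mul_pow, Finset.prod_mul_distrib, Finset.prod_pow_eq_pow_sum]
  have : ∑ i, d i = m := by simpa using hdeg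
  rw [this]
  ring

/-- The radius exceeds 1, which permits Cauchy's formula on the unit circle and evaluation of the
Taylor series in t at t = 1. -/
lemma exists_ball_smul_mem {z : Fin n → ℂ} (hz : z ∈ cartanIV n) :
    ∃ r : ℝ, 1 < r ∧ ∀ t ∈ ball (0 : ℂ) r, t • z ∈ cartanIV n := by
  have hcont : Continuous fun s : ℝ => (s : ℂ) • z := by fun_prop
  have h1 : ∀ᶠ s : ℝ in 𝓝 1, (s : ℂ) • z ∈ cartanIV n :=
    hcont.continuousAt.eventually_mem ((isOpen_cartanIV n).mem_nhds (by simpa using hz))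
  obtain ⟨r, hr, hr1⟩ := ((h1.filter_mono nhdsWithin_le_nhds).and
    (self_mem_nhdsWithin : Ioi (1 : ℝ) ∈ 𝓝[>] 1)).exists
  have hr0 : (0 : ℝ) < r := lt_trans one_pos hr1
  refine ⟨r, hr1, fun t ht => ?_⟩
  have hne : (r : ℂ) ≠ 0 := Complex.ofReal_ne_zero.2 hr0.ne'
  have : t • z = (t / r) • ((r : ℂ) • z) := by rw [smul_smul, div_mul_cancel₀ _ hne]
  rw [this]
  refine smul_mem_cartanIV hr ?_
  rw [norm_div, Complex.norm_real, Real.norm_of_nonneg hr0.le, div_le_one hr0]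
  exact (mem_ball_zero_iff.1 ht).le

/-- A holomorphic function on the domain is orthogonal to all polynomials only if it is zero. -/
lemma eq_zero_of_inner_poly_eq_zero (hn : 2 ≤ n) (hlam : (n : ℝ) - 1 < lam) {f : bergman n lam}
    (hf : ∀ p, inner ℂ (polyToBergman n lam p) f = 0) : f = 0 := by
  have := isProbabilityMeasure_bergmanMeasure hn hlam
  set μ := bergmanMeasure n lam
  obtain ⟨F, hF, hfF⟩ := f.2
  choose P hPe using fun m =>
    exists_poly_iteratedDeriv (isOpen_cartanIV n) (zero_mem_cartanIV n) m F hF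
  have hgd : ∀ z ∈ cartanIV n, ∃ r : ℝ, 1 < r ∧
      DifferentiableOn ℂ (fun t : ℂ => F (t • z)) (ball 0 r) := by
    intro z hz
    obtain ⟨r, hr, hrD⟩ := exists_ball_smul_mem hz
    exact ⟨r, hr, hF.comp (differentiable_id.smul_const z).differentiableOn hrD⟩
  -- `F` is arbitrary outside the domain; cutting it off makes it measurable, as Fubini requires.
  set F₀ : (Fin n → ℂ) → ℂ := (cartanIV n).indicator F with hF₀
  have hF₀m : Measurable F₀ :=
    measurable_indicator_of_continuousOn (measurableSet_cartanIV n) hF.continuousOn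
  have hFF₀ : F =ᵐ[μ] F₀ := by
    filter_upwards [ae_mem_cartanIV n lam] with z hz
    rw [hF₀, indicator_of_mem hz]
  have hF₀i : Integrable F₀ μ := by
    have h1 : MemLp F₀ 2 μ := (Lp.memLp f.1).ae_eq (hfF.trans hFF₀)
    exact h1.integrable one_le_two
  have hexp : ∀ θ : ℝ, ((Circle.exp (-θ))⁻¹ : Circle) = Circle.exp θ := by
    intro θ; rw [← Circle.exp_neg, neg_neg]
  -- Rotations preserve orthogonality to polynomials, since the inverse rotation maps polynomials to
  -- polynomials.
  have horth : ∀ m (θ : ℝ), ∫ z, F₀ ((Circle.exp θ : ℂ) • z) *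
      star (MvPolynomial.eval z (P m)) ∂μ = 0 := by
    intro m θ
    set g : SOxSO2 n := (1, Circle.exp (-θ)) with hg
    have h1 : inner ℂ (polyToBergman n lam (P m)) (bergmanRep n lam g f) = (0 : ℂ) := by
      have h2 := (bergmanRep n lam g⁻¹).inner_map_map (polyToBergman n lam (P m))
        (bergmanRep n lam g f)
      rw [rep_inv_apply, bergmanRep_polyToBergman, hf] at h2
      exact h2.symm
    rw [Submodule.coe_inner, L2.inner_def] at h1
    rw [← h1]
    refine integral_congr_ae ?_
    have h3 := MemLp.coeFn_toLp (memLp_poly n lam (P m))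
    have h4 := Lp.coeFn_compMeasurePreserving f.1 (measurePreserving_act lam g⁻¹)
    have h5 := (measurePreserving_act lam g⁻¹).quasiMeasurePreserving.ae_eq_comp (hfF.trans hFF₀)
    filter_upwards [h3, h4, h5] with z hz3 hz4 hz5
    have e3 : ((polyToBergman n lam (P m) : bergman n lam) : Lp ℂ 2 μ) z =
      MvPolynomial.eval z (P m) := hz3
    have e4 : ((bergmanRep n lam g f : bergman n lam) : Lp ℂ 2 μ) z =
        F₀ ((Circle.exp θ : ℂ) • z) := by
      refine (hz4.trans hz5).trans ?_
      rw [Function.comp_apply, hg, Prod.inv_mk, inv_one, hexp, act_one_left]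
    rw [e3, e4]
    simp
  -- Cauchy's formula for the m-th derivative; `P m` is the derivative itself, hence the factorial.
  have hcoef : ∀ m : ℕ, ∀ z ∈ cartanIV n,
      ∫ θ in Ioc 0 (2 * Real.pi), (Circle.exp θ : ℂ) ^ (-(m : ℤ)) * F₀ ((Circle.exp θ : ℂ) • z) =
        (2 * Real.pi / m.factorial) * MvPolynomial.eval z (P m) := by
    intro m z hz
    obtain ⟨r, hr, hd⟩ := hgd z hz
    have hdc : DiffContOnCl ℂ (fun t : ℂ => F (t • z)) (ball 0 1) :=
      hd.diffContOnCl_ball (closedBall_subset_ball hr)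
    have h1 := hdc.circleIntegral_one_div_sub_center_pow_smul one_pos m
    rw [hPe, circleIntegral, intervalIntegral.integral_of_le Real.two_pi_pos.le] at h1
    have h2 : ∀ θ : ℝ, deriv (circleMap 0 1) θ • (1 / (circleMap 0 1 θ - 0) ^ (m + 1)) •
        F (circleMap 0 1 θ • z) = Complex.I * ((Circle.exp θ : ℂ) ^ (-(m : ℤ)) *
          F₀ ((Circle.exp θ : ℂ) • z)) := by
      intro θ
      have hcm : circleMap 0 1 θ = (Circle.exp θ : ℂ) := by simp [circleMap]
      have hmem : (Circle.exp θ : ℂ) • z ∈ cartanIV n := smul_mem_cartanIV hz (by simp)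
      rw [deriv_circleMap, hcm, hF₀, indicator_of_mem hmem]
      have hne : (Circle.exp θ : ℂ) ≠ 0 := Circle.coe_ne_zero _
      simp only [smul_eq_mul, sub_zero, zpow_neg, zpow_natCast]
      field_simp
      ring
    simp only [h2] at h1
    rw [integral_const_mul] at h1
    have h3 := mul_left_cancel₀ Complex.I_ne_zero (h1.trans (by
      rw [smul_eq_mul]; ring :
      _ = Complex.I * ((2 * Real.pi / m.factorial) * MvPolynomial.eval z (P m))))
    exact h3
  -- The double integral of e^(-imθ) F(e^(iθ)z) times the conjugate of P_m(z) is 0 when z is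
  -- integrated first (`horth`), and 2π/m! times ‖P_m‖² when θ is (`hcoef`).
  have hPzero : ∀ m, P m = 0 := by
    intro m
    apply polyToBergman_injective hn hlam
    rw [map_zero, ← inner_self_eq_zero (𝕜 := ℂ)]
    set ν := (volume : Measure ℝ).restrict (Ioc 0 (2 * Real.pi))
    have hcexp : Continuous fun θ : ℝ => (Circle.exp θ : ℂ) :=
      continuous_subtype_val.comp Circle.exp.continuous
    have hint : Integrable (fun x : ℝ × (Fin n → ℂ) => ((Circle.exp x.1 : ℂ) ^ (-(m : ℤ)) *
        star (MvPolynomial.eval x.2 (P m))) * F₀ ((Circle.exp x.1 : ℂ) • x.2)) (ν.prod μ) := by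
      have hskew : MeasurePreserving
          (fun x : ℝ × (Fin n → ℂ) => (x.1, (Circle.exp x.1 : ℂ) • x.2)) (ν.prod μ) (ν.prod μ) := by
        refine (MeasurePreserving.id ν).skew_product
          (g := fun θ z => (Circle.exp θ : ℂ) • z) ?_ (ae_of_all _ fun θ => ?_)
        · exact ((hcexp.comp continuous_fst).smul continuous_snd).measurable
        · have h1 := (measurePreserving_act lam ((1, Circle.exp θ) : SOxSO2 n)).map_eq
          have h2 : act ((1, Circle.exp θ) : SOxSO2 n) = fun z => (Circle.exp θ : ℂ) • z :=
            funext (act_one_left _)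
          rwa [h2] at h1
      obtain ⟨C, hC⟩ := (isCompact_closedBall (0 : Fin n → ℂ) 1).exists_bound_of_continuousOn
        (MvPolynomial.continuous_eval (P m)).continuousOn
      refine Integrable.bdd_mul (c := C)
        (hskew.integrable_comp_of_integrable (hF₀i.comp_snd ν)) ?_ ?_
      · refine Continuous.aestronglyMeasurable ?_
        refine ((hcexp.comp continuous_fst).zpow₀ _ fun x => Or.inl (Circle.coe_ne_zero _)).mul ?_
        exact continuous_star.comp ((MvPolynomial.continuous_eval (P m)).comp continuous_snd)
      · filter_upwards [Measure.quasiMeasurePreserving_snd.ae (ae_mem_cartanIV n lam)] with x hx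
        rw [norm_mul, norm_zpow, Circle.norm_coe, one_zpow, one_mul, norm_star]
        refine hC _ ?_
        rw [mem_closedBall_zero_iff, pi_norm_le_iff_of_nonneg zero_le_one]
        exact fun i => (norm_lt_one_of_mem hx i).le
    have hswap := integral_integral_swap (f := fun (θ : ℝ) (z : Fin n → ℂ) =>
      ((Circle.exp θ : ℂ) ^ (-(m : ℤ)) * star (MvPolynomial.eval z (P m))) *
        F₀ ((Circle.exp θ : ℂ) • z)) hint
    have hleft : ∀ θ : ℝ, ∫ z, ((Circle.exp θ : ℂ) ^ (-(m : ℤ)) *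
        star (MvPolynomial.eval z (P m))) * F₀ ((Circle.exp θ : ℂ) • z) ∂μ = 0 := by
      intro θ
      have h1 : ∀ z, ((Circle.exp θ : ℂ) ^ (-(m : ℤ)) * star (MvPolynomial.eval z (P m))) *
          F₀ ((Circle.exp θ : ℂ) • z) = (Circle.exp θ : ℂ) ^ (-(m : ℤ)) *
          (F₀ ((Circle.exp θ : ℂ) • z) * star (MvPolynomial.eval z (P m))) := fun z => by ring
      simp only [h1]
      rw [integral_const_mul, horth, mul_zero]
    simp only [hleft, integral_zero] at hswap
    have hright : ∀ᵐ z ∂μ, ∫ θ, ((Circle.exp θ : ℂ) ^ (-(m : ℤ)) *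
        star (MvPolynomial.eval z (P m))) * F₀ ((Circle.exp θ : ℂ) • z) ∂ν =
        (2 * Real.pi / m.factorial) *
          (MvPolynomial.eval z (P m) * star (MvPolynomial.eval z (P m))) := by
      filter_upwards [ae_mem_cartanIV n lam] with z hz
      have h1 : ∀ θ : ℝ, ((Circle.exp θ : ℂ) ^ (-(m : ℤ)) * star (MvPolynomial.eval z (P m))) *
          F₀ ((Circle.exp θ : ℂ) • z) = star (MvPolynomial.eval z (P m)) *
          ((Circle.exp θ : ℂ) ^ (-(m : ℤ)) * F₀ ((Circle.exp θ : ℂ) • z)) := fun z => by ring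
      simp only [h1]
      rw [integral_const_mul, hcoef m z hz]
      ring
    rw [integral_congr_ae hright, integral_const_mul] at hswap
    have hpi : (2 * Real.pi / m.factorial : ℂ) ≠ 0 := by
      simp [Real.pi_ne_zero, Nat.factorial_ne_zero]
    have hzero := (mul_eq_zero.1 hswap.symm).resolve_left hpi
    rw [Submodule.coe_inner, L2.inner_def, ← hzero]
    refine integral_congr_ae ?_
    filter_upwards [MemLp.coeFn_toLp (memLp_poly n lam (P m))] with z hz
    have e : ((polyToBergman n lam (P m) : bergman n lam) : Lp ℂ 2 μ) z =
      MvPolynomial.eval z (P m) := hz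
    rw [e]
    exact (RCLike.inner_apply _ _).trans rfl
  have hFzero : ∀ z ∈ cartanIV n, F z = 0 := by
    intro z hz
    obtain ⟨r, hr, hd⟩ := hgd z hz
    have h1 := Complex.hasSum_taylorSeries_on_ball hd (z := 1) (by simpa using hr)
    simp only [hPe, hPzero, map_zero, smul_zero, one_smul] at h1
    exact h1.unique hasSum_zero
  apply Subtype.ext
  apply Lp.ext
  refine hfF.trans (.trans ?_ (Lp.coeFn_zero _ _ _).symm)
  filter_upwards [ae_mem_cartanIV n lam] with z hz
  exact hFzero z hz

end Completeness

-- The differentiated action of so(n)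

section Differential

open Set Metric Filter Topology

variable {n : ℕ} {lam : ℝ}

/-- Restriction of polynomials to the closed unit polydisc. -/
def restrictPoly (n : ℕ) : MvPolynomial (Fin n) ℂ →ₐ[ℂ] C(closedBall (0 : Fin n → ℂ) 1, ℂ) :=
  MvPolynomial.aeval fun i => ⟨fun z => z.1 i, (continuous_apply i).comp continuous_subtype_val⟩

lemma restrictPoly_apply (p : MvPolynomial (Fin n) ℂ) (z : closedBall (0 : Fin n → ℂ) 1) :
    restrictPoly n p z = MvPolynomial.eval z.1 p := by
  induction p using MvPolynomial.induction_on with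
  | C a => simp [restrictPoly]
  | add p q hp hq => simp only [map_add, ContinuousMap.add_apply, hp, hq]
  | mul_X p i hp =>
    rw [map_mul, map_mul, ContinuousMap.mul_apply, hp, MvPolynomial.eval_X]
    simp [restrictPoly]

/-- The measure is finite and carried by the unit polydisc, so the sup norm dominates. Derivatives
can thus be computed in the Banach algebra of continuous functions, where a product rule is
available. -/
lemma exists_norm_polyToBergman_le (n : ℕ) (lam : ℝ) :
    ∃ C : ℝ, ∀ p, ‖polyToBergman n lam p‖ ≤ C * ‖restrictPoly n p‖ := by
  refine ⟨((measureUnivNNReal (bergmanMeasure n lam) : ℝ) ^ (2 : ENNReal).toReal⁻¹), fun p => ?_⟩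
  rw [Submodule.coe_norm]
  refine Lp.norm_le_of_ae_bound (norm_nonneg (restrictPoly n p)) ?_
  filter_upwards [ae_mem_cartanIV n lam, MemLp.coeFn_toLp (memLp_poly n lam p)] with z hz hz'
  have e : ((polyToBergman n lam p : bergman n lam) : Lp ℂ 2 (bergmanMeasure n lam)) z =
    MvPolynomial.eval z p := hz'
  have hmem : z ∈ closedBall (0 : Fin n → ℂ) 1 := by
    rw [mem_closedBall_zero_iff, pi_norm_le_iff_of_nonneg zero_le_one]
    exact fun i => (norm_lt_one_of_mem hz i).le
  rw [e, ← restrictPoly_apply p ⟨z, hmem⟩]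
  exact ContinuousMap.norm_coe_le_norm _ _

lemma hasDerivAt_restrictPoly_subst {B : ℝ → Matrix (Fin n) (Fin n) ℂ}
    {B' : Matrix (Fin n) (Fin n) ℂ} (hB : ∀ i j, HasDerivAt (fun s => B s i j) (B' i j) 0)
    (hB0 : B 0 = 1) (p : MvPolynomial (Fin n) ℂ) :
    HasDerivAt (fun s => restrictPoly n (subst (B s) p)) (restrictPoly n (linDer B' p)) 0 := by
  have hid : ∀ q, subst (B 0) q = q := fun q => by
    refine MvPolynomial.funext fun z => ?_
    rw [eval_subst, hB0, Matrix.one_mulVec]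
  induction p using MvPolynomial.induction_on with
  | C a => simpa [subst] using hasDerivAt_const (0 : ℝ) (restrictPoly n (MvPolynomial.C a))
  | add p q hp hq =>
    simp only [map_add]
    exact hp.fun_add hq
  | mul_X p i hp =>
    have hX : HasDerivAt (fun s => restrictPoly n (subst (B s) (MvPolynomial.X i)))
        (restrictPoly n (linDer B' (MvPolynomial.X i))) 0 := by
      have h1 : ∀ M : Matrix (Fin n) (Fin n) ℂ,
          restrictPoly n (∑ j, MvPolynomial.C (M i j) * MvPolynomial.X j) =
          ∑ j, M i j • restrictPoly n (MvPolynomial.X j) := by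
        intro M
        simp only [map_sum, ← map_smul, MvPolynomial.smul_eq_C_mul]
      have h2 : ∀ s, subst (B s) (MvPolynomial.X i) =
          ∑ j, MvPolynomial.C (B s i j) * MvPolynomial.X j := fun s => by simp [subst]
      simp only [h2, linDer_X, h1]
      exact HasDerivAt.fun_sum fun j _ => (hB i j).smul_const _
    have := hp.fun_mul hX
    simp only [map_mul, Derivation.leibniz, smul_eq_mul, map_add]
    refine this.congr_deriv ?_
    rw [hid, hid]
    ring

lemma hasDerivAt_polyToBergman_subst {B : ℝ → Matrix (Fin n) (Fin n) ℂ}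
    {B' : Matrix (Fin n) (Fin n) ℂ} (hB : ∀ i j, HasDerivAt (fun s => B s i j) (B' i j) 0)
    (hB0 : B 0 = 1) (p : MvPolynomial (Fin n) ℂ) :
    HasDerivAt (fun s => polyToBergman n lam (subst (B s) p))
      (polyToBergman n lam (linDer B' p)) 0 := by
  have h := hasDerivAt_restrictPoly_subst hB hB0 p
  rw [hasDerivAt_iff_isLittleO] at h ⊢
  obtain ⟨C, hC⟩ := exists_norm_polyToBergman_le n lam
  refine Asymptotics.IsBigO.trans_isLittleO (Asymptotics.IsBigO.of_bound C
    (Eventually.of_forall fun s => ?_)) h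
  have e1 : polyToBergman n lam (subst (B s) p) - polyToBergman n lam (subst (B 0) p) -
      (s - 0) • polyToBergman n lam (linDer B' p) =
      polyToBergman n lam (subst (B s) p - subst (B 0) p - ((s - 0 : ℝ) : ℂ) • linDer B' p) := by
    rw [map_sub, map_sub, map_smul]
    rfl
  have e2 : restrictPoly n (subst (B s) p) - restrictPoly n (subst (B 0) p) -
      (s - 0) • restrictPoly n (linDer B' p) =
      restrictPoly n (subst (B s) p - subst (B 0) p - ((s - 0 : ℝ) : ℂ) • linDer B' p) := by
    rw [map_sub, map_sub, map_smul, Complex.coe_smul]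
  rw [e1, e2]
  exact hC _

lemma hasDerivAt_exp_smul_entry (X : Matrix (Fin n) (Fin n) ℝ) (i j : Fin n) :
    HasDerivAt (fun s : ℝ => NormedSpace.exp (s • X) i j) (X i j) 0 := by
  let _ : NormedRing (Matrix (Fin n) (Fin n) ℝ) := Matrix.linftyOpNormedRing
  let _ : NormedAlgebra ℝ (Matrix (Fin n) (Fin n) ℝ) := Matrix.linftyOpNormedAlgebra
  have h := hasDerivAt_exp_smul_const (𝕂 := ℝ) X (0 : ℝ)
  rw [zero_smul, NormedSpace.exp_zero, one_mul] at h
  exact ((Matrix.entryLinearMap ℝ ℝ i j).toContinuousLinearMap.hasFDerivAt.comp_hasDerivAt 0 h)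

lemma complexMatrix_inv (A : SO n) : complexMatrix A⁻¹ = (complexMatrix A).transpose := by
  have h1 : complexMatrix A⁻¹ * complexMatrix A = 1 := by
    rw [← complexMatrix_mul, inv_mul_cancel, complexMatrix_one]
  calc complexMatrix A⁻¹ = complexMatrix A⁻¹ * (complexMatrix A * (complexMatrix A).transpose) := by
        rw [complexMatrix_mul_transpose, mul_one]
    _ = _ := by rw [← mul_assoc, h1, one_mul]

lemma bergmanRepSO_polyToBergman (A : SO n) (p : MvPolynomial (Fin n) ℂ) :
    bergmanRepSO n lam A (polyToBergman n lam p) =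
      polyToBergman n lam (subst (complexMatrix A⁻¹) p) := by
  have : bergmanRepSO n lam A (polyToBergman n lam p) =
    bergmanRep n lam (A, 1) (polyToBergman n lam p) := rfl
  rw [this, bergmanRep_polyToBergman]
  simp [actMatrix]

/-- A real skew-symmetric matrix viewed as a complex matrix. -/
def complexify (X : LieAlgebra.Orthogonal.so (Fin n) ℝ) : Matrix (Fin n) (Fin n) ℂ :=
  (X : Matrix (Fin n) (Fin n) ℝ).map Complex.ofRealHom

/-- `so(n)` acts on polynomials by derivations. -/
lemma isDifferential_polyToBergman (X : LieAlgebra.Orthogonal.so (Fin n) ℝ)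
    (p : MvPolynomial (Fin n) ℂ) :
    IsDifferential (bergmanRepSO n lam) X (polyToBergman n lam p)
      (polyToBergman n lam (linDer (-complexify X) p)) := by
  unfold IsDifferential
  simp only [bergmanRepSO_polyToBergman]
  refine hasDerivAt_polyToBergman_subst (fun i j => ?_) ?_ p
  · have h1 := (hasDerivAt_exp_smul_entry (X : Matrix (Fin n) (Fin n) ℝ) j i).ofReal_comp
    have h2 : ((-complexify X) i j) = (((X : Matrix (Fin n) (Fin n) ℝ) j i : ℝ) : ℂ) := by
      have := congrFun (congrFun (so_transpose X) i) j
      rw [Matrix.transpose_apply] at this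
      simp [complexify, this]
    rw [h2]
    refine h1.congr_of_eventuallyEq (Eventually.of_forall fun s => ?_)
    change complexMatrix (expSO (s • X))⁻¹ i j = _
    rw [complexMatrix_inv]
    rfl
  · have : expSO ((0 : ℝ) • X) = 1 := by
      apply Subtype.ext
      simp [expSO]
    rw [this, inv_one, complexMatrix_one]

lemma linDer_neg_complexify (X Y : LieAlgebra.Orthogonal.so (Fin n) ℝ)
    (p : MvPolynomial (Fin n) ℂ) :
    linDer (-(complexify X + Complex.I • complexify Y)) p =
      linDer (-complexify X) p + Complex.I • linDer (-complexify Y) p := by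
  rw [neg_add, ← smul_neg, linDer_add, linDer_smul, Derivation.add_apply, Derivation.smul_apply]

/-- Uniqueness of derivatives makes the complexified action single-valued, whichever decomposition Z
= X + iY is used; entrywise real and imaginary parts provide one. -/
lemma isComplexDifferential_polyToBergman_iff {Z : Matrix (Fin n) (Fin n) ℂ}
    (hZ : Z.transpose = -Z) (p : MvPolynomial (Fin n) ℂ) (w : bergman n lam) :
    IsComplexDifferential (bergmanRepSO n lam) Z (polyToBergman n lam p) w ↔
      w = polyToBergman n lam (linDer (-Z) p) := by
  constructor
  · rintro ⟨X, Y, hXY, w₁, w₂, h₁, h₂, rfl⟩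
    have e₁ := HasDerivAt.unique h₁ (isDifferential_polyToBergman X p)
    have e₂ := HasDerivAt.unique h₂ (isDifferential_polyToBergman Y p)
    have hXY' : Z = complexify X + Complex.I • complexify Y := hXY
    rw [e₁, e₂, hXY', linDer_neg_complexify, map_add, map_smul]
  · rintro rfl
    have hent : ∀ i j, Z j i = -Z i j := fun i j => by simpa using congrFun (congrFun hZ i) j
    have hre : Z.map Complex.re ∈ LieAlgebra.Orthogonal.so (Fin n) ℝ := by
      rw [LieAlgebra.Orthogonal.mem_so]
      ext i j
      simp [hent i j]
    have him : Z.map Complex.im ∈ LieAlgebra.Orthogonal.so (Fin n) ℝ := by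
      rw [LieAlgebra.Orthogonal.mem_so]
      ext i j
      simp [hent i j]
    have hZ' : Z = complexify ⟨_, hre⟩ + Complex.I • complexify ⟨_, him⟩ := by
      ext i j
      simp only [complexify, Matrix.add_apply, Matrix.smul_apply, Matrix.map_apply, smul_eq_mul,
        Complex.ofRealHom_eq_coe]
      rw [mul_comm, Complex.re_add_im]
    refine ⟨⟨_, hre⟩, ⟨_, him⟩, hZ', _, _, isDifferential_polyToBergman _ p,
      isDifferential_polyToBergman _ p, ?_⟩
    rw [← map_smul, ← map_add, ← linDer_neg_complexify, ← hZ']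

/-- The element of `so(n)` that acts on polynomials through `rotMatrix i j`. -/
def rotSO (i j : Fin n) : LieAlgebra.Orthogonal.so (Fin n) ℝ :=
  ⟨Matrix.single i j 1 - Matrix.single j i 1, by
    rw [LieAlgebra.Orthogonal.mem_so]
    simp⟩

lemma neg_complexify_rotSO (i j : Fin n) : -complexify (rotSO i j) = rotMatrix i j := by
  ext a b
  simp [complexify, rotSO, rotMatrix, Matrix.single_apply]
  split_ifs <;> simp

lemma isDifferential_rotSO (i j : Fin n) (p : MvPolynomial (Fin n) ℂ) :
    IsDifferential (bergmanRepSO n lam) (rotSO i j) (polyToBergman n lam p)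
      (polyToBergman n lam (linDer (rotMatrix i j) p)) := by
  rw [← neg_complexify_rotSO]
  exact isDifferential_polyToBergman _ p

variable {E : Type*} [NormedAddCommGroup E] [InnerProductSpace ℂ E] {π : SO n →* (E ≃ₗᵢ[ℂ] E)}
  {X : LieAlgebra.Orthogonal.so (Fin n) ℝ}

/-- Unitarity makes the inner product of the two moving vectors constant; its derivative shows that
dπ(X) is skew-Hermitian. -/
lemma IsDifferential.inner_add_inner {u v u' v' : E} (hu : IsDifferential π X u u')
    (hv : IsDifferential π X v v') : inner ℂ u v' + inner ℂ u' v = 0 := by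
  have h := HasDerivAt.inner ℂ hu hv
  have h0 : π (expSO ((0 : ℝ) • X)) = 1 := by
    have : expSO ((0 : ℝ) • X) = 1 := by
      apply Subtype.ext
      simp [expSO]
    rw [this, map_one]
  simp only [LinearIsometryEquiv.inner_map_map, h0] at h
  exact h.unique (hasDerivAt_const _ _)

/-- Pairing the curve with a vector of Wᗮ gives the constant 0, so the derivative lies in Wᗮᗮ, which
is W by completeness. -/
lemma IsDifferential.mem {W : Submodule ℂ E} (hW : ∀ g, ∀ w ∈ W, π g w ∈ W) [CompleteSpace W]
    {v v' : E} (hv : IsDifferential π X v v') (hvW : v ∈ W) : v' ∈ W := by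
  rw [← Submodule.orthogonal_orthogonal W, Submodule.mem_orthogonal]
  intro u hu
  have h := HasDerivAt.inner ℂ (hasDerivAt_const (0 : ℝ) u) hv
  have h0 : ∀ s : ℝ, inner ℂ u (π (expSO (s • X)) v) = (0 : ℂ) := fun s =>
    Submodule.inner_left_of_mem_orthogonal (hW _ v hvW) hu
  simp only [h0, inner_zero_left, add_zero] at h
  exact h.unique (hasDerivAt_const _ _)

lemma IsDifferential.map {V : Submodule ℂ E} (S : E →L[ℂ] E)
    (hS : ∀ g, ∀ v ∈ V, S (π g v) = π g (S v)) {v v' : E} (hv : IsDifferential π X v v')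
    (hvV : v ∈ V) : IsDifferential π X (S v) (S v') := by
  unfold IsDifferential at *
  have h := (S.restrictScalars ℝ).hasFDerivAt.comp_hasDerivAt (0 : ℝ) hv
  refine h.congr_of_eventuallyEq (Eventually.of_forall fun s => ?_)
  exact (hS _ v hvV).symm

end Differential

-- Schur's lemma and the criterion for isotypic decompositions

section AbstractReps

variable {G E : Type*} [Group G] [NormedAddCommGroup E] [InnerProductSpace ℂ E]
  {π : G →* (E ≃ₗᵢ[ℂ] E)}

lemma rep_apply_inv (π : G →* (E ≃ₗᵢ[ℂ] E)) (g : G) (v : E) : π g (π g⁻¹ v) = v := by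
  have := rep_inv_apply π g⁻¹ v
  rwa [inv_inv] at this

lemma inner_rep_left (π : G →* (E ≃ₗᵢ[ℂ] E)) (g : G) (v w : E) :
    inner ℂ (π g v) w = inner ℂ v (π g⁻¹ w) := by
  rw [← (π g).inner_map_map v, rep_apply_inv]

/-- Schur's lemma: an intertwining linear isomorphism from a finite-dimensional irreducible
subspace can be rescaled to a unitary map. -/
lemma unitarilyEquivalent_of_linearEquiv {V W : Submodule ℂ E} [FiniteDimensional ℂ V]
    (hV : IsIrreducibleSubspace π V) (e : V ≃ₗ[ℂ] W)
    (he : ∀ (g : G) (v v' : V), (v' : E) = π g v → (e v' : E) = π g (e v)) :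
    UnitarilyEquivalent π V W := by
  have : FiniteDimensional ℂ W := e.finiteDimensional
  have : Nontrivial V := (Submodule.nontrivial_iff_ne_bot).2 hV.ne_bot
  -- An eigenspace of e*e is invariant, hence all of `V`; so `e` scales all norms by one factor.
  set A : V →ₗ[ℂ] V := LinearMap.adjoint e.toLinearMap ∘ₗ e.toLinearMap with hA
  have hAi : ∀ v v' : V, inner ℂ v (A v') = (inner ℂ (e v) (e v') : ℂ) := fun v v' => by
    rw [hA, LinearMap.comp_apply, LinearMap.adjoint_inner_right]
    rfl
  obtain ⟨d, hd⟩ := Module.End.exists_eigenvalue A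
  set U : Submodule ℂ V := Module.End.eigenspace A d with hU
  have hmem : ∀ v : V, v ∈ U ↔ ∀ v', (inner ℂ (e v') (e v) : ℂ) = d * inner ℂ v' v := by
    intro v
    rw [hU, Module.End.mem_eigenspace_iff]
    constructor
    · intro h v'
      rw [← hAi, h, inner_smul_right]
    · intro h
      refine ext_inner_left ℂ fun v' => ?_
      rw [hAi, h, inner_smul_right]
  have hUV : U.map V.subtype = V := by
    refine (hV.minimal _ (Submodule.map_subtype_le V U)
      (Submodule.closed_of_finiteDimensional _) ?_).resolve_left ?_
    · rintro g _ ⟨v, hv, rfl⟩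
      refine ⟨⟨π g v, hV.invariant g v v.2⟩, ?_, rfl⟩
      rw [SetLike.mem_coe, hmem] at *
      intro v'
      have h1 := hv ⟨π g⁻¹ v', hV.invariant _ _ v'.2⟩
      rw [Submodule.coe_inner, he g⁻¹ v' _ rfl, Submodule.coe_inner] at h1
      rw [Submodule.coe_inner, he g v ⟨π g v, hV.invariant g v v.2⟩ rfl, Submodule.coe_inner]
      have h2 := inner_rep_left π g⁻¹ (e v' : E) (e v)
      have h3 := inner_rep_left π g⁻¹ (v' : E) v
      rw [inv_inv] at h2 h3
      rw [← h2, h1, h3]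
    · intro h
      exact hd (Submodule.map_injective_of_injective V.subtype_injective
        (h.trans (Submodule.map_bot _).symm))
  have hUtop : ∀ v : V, v ∈ U := by
    intro v
    have : (v : E) ∈ U.map V.subtype := hUV.symm ▸ v.2
    obtain ⟨u, hu, huv⟩ := this
    rwa [← Subtype.ext huv]
  have hnorm : ∀ v : V, ((‖e v‖ ^ 2 : ℝ) : ℂ) = d * ((‖v‖ ^ 2 : ℝ) : ℂ) := by
    intro v
    have := (hmem v).1 (hUtop v) v
    rw [inner_self_eq_norm_sq_to_K, inner_self_eq_norm_sq_to_K] at this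
    exact_mod_cast this
  obtain ⟨v₀, hv₀⟩ := exists_ne (0 : V)
  have hv₀' : 0 < ‖v₀‖ ^ 2 := by positivity
  set r : ℝ := ‖e v₀‖ ^ 2 / ‖v₀‖ ^ 2 with hr
  have hdr : d = (r : ℂ) := by
    rw [hr, Complex.ofReal_div, hnorm, mul_div_cancel_right₀]
    exact_mod_cast hv₀'.ne'
  have hr0 : 0 < r := by
    have : e v₀ ≠ 0 := by simpa using hv₀
    positivity
  have hnorm' : ∀ v : V, ‖e v‖ ^ 2 = r * ‖v‖ ^ 2 := by
    intro v
    have := hnorm v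
    rw [hdr] at this
    exact_mod_cast this
  have hs : (0 : ℝ) < (√r)⁻¹ := by positivity
  have hs' : (((√r)⁻¹ : ℝ) : ℂ) ≠ 0 := by exact_mod_cast hs.ne'
  refine ⟨⟨e.trans (LinearEquiv.smulOfNeZero ℂ W _ hs'), fun v => ?_⟩, fun g v v' hvv' => ?_⟩
  · have h1 : (e.trans (LinearEquiv.smulOfNeZero ℂ W _ hs')) v = (((√r)⁻¹ : ℝ) : ℂ) • e v := rfl
    rw [h1, norm_smul, Complex.norm_real, Real.norm_of_nonneg hs.le]
    refine (sq_eq_sq₀ (by positivity) (norm_nonneg _)).1 ?_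
    rw [mul_pow, hnorm', inv_pow, Real.sq_sqrt hr0.le]
    field_simp
  · change (((√r)⁻¹ : ℝ) : ℂ) • (e v' : E) = π g ((((√r)⁻¹ : ℝ) : ℂ) • (e v : E))
    rw [he g v v' hvv', map_smul]

lemma IsIrreducibleSubspace.of_comp {G' : Type*} [Group G'] {f : G' →* G} {V : Submodule ℂ E}
    (h : IsIrreducibleSubspace (π.comp f) V) (hV : ∀ g, ∀ v ∈ V, π g v ∈ V) :
    IsIrreducibleSubspace π V :=
  ⟨h.isClosed, hV, h.ne_bot, fun W hW hc hinv => h.minimal W hW hc fun g => hinv (f g)⟩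

lemma starProjection_rep {V : Submodule ℂ E} [V.HasOrthogonalProjection]
    (hV : ∀ g, ∀ v ∈ V, π g v ∈ V) (g : G) (v : E) :
    V.starProjection (π g v) = π g (V.starProjection v) := by
  refine Submodule.eq_starProjection_of_mem_of_inner_eq_zero
    (hV g _ (V.starProjection_apply_mem v)) fun w hw => ?_
  rw [← map_sub, inner_rep_left]
  exact V.starProjection_inner_eq_zero _ _ (hV _ _ hw)

/-- A dense sum of finite-dimensional irreducible subspaces without non-zero intertwining
operators between them is the isotypic decomposition. -/
lemma isIsotypicDecomposition_of_irreducible {ι : Type*} [CompleteSpace E] {H : ι → Submodule ℂ E}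
    [∀ i, FiniteDimensional ℂ (H i)] (hirr : ∀ i, IsIrreducibleSubspace π (H i))
    (hS : ∀ (S : E →L[ℂ] E) (i j : ι), i ≠ j → (∀ g, ∀ v ∈ H i, S (π g v) = π g (S v)) →
      (∀ v ∈ H i, S v ∈ H j) → ∀ v ∈ H i, S v = 0)
    (htot : (⨆ i, H i)ᗮ = ⊥) : IsIsotypicDecomposition π H := by
  -- The orthogonal projection onto an invariant subspace intertwines, so the hypothesis forces
  -- distinct summands to be orthogonal.
  have hproj : ∀ i j, i ≠ j → ∀ v ∈ H i, (H j).starProjection v = 0 := fun i j hij =>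
    hS _ i j hij (fun g v _ => starProjection_rep (hirr j).invariant g v)
      fun v _ => (H j).starProjection_apply_mem v
  have horth : ∀ i j, i ≠ j → ∀ v ∈ H i, ∀ w ∈ H j, (inner ℂ v w : ℂ) = 0 := by
    intro i j hij v hv w hw
    have := (H j).starProjection_inner_eq_zero v w hw
    rwa [hproj i j hij v hv, sub_zero] at this
  refine ⟨⟨H, hirr, ?_, ?_⟩, fun j => (hirr j).isClosed, fun j => (hirr j).invariant,
    inferInstance, ?_⟩
  · rintro i j hij ⟨e, he⟩
    -- An equivalence of summands, extended to the whole space through the orthogonal projection,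
    -- would be a forbidden intertwiner.
    set S : E →L[ℂ] E := (H j).subtypeL ∘L e.toContinuousLinearEquiv.toContinuousLinearMap ∘L
      (H i).orthogonalProjectionOnto with hSdef
    have hSv : ∀ v (hv : v ∈ H i), S v = e ⟨v, hv⟩ := by
      intro v hv
      have := (H i).orthogonalProjectionOnto_mem_subspace_eq_self ⟨v, hv⟩
      rw [hSdef, ContinuousLinearMap.comp_apply, ContinuousLinearMap.comp_apply, this]
      rfl
    have h0 := hS S i j hij (fun g v hv => by
        rw [hSv v hv, hSv _ ((hirr i).invariant g v hv)]
        exact he g ⟨v, hv⟩ _ rfl)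
      (fun v hv => by rw [hSv v hv]; exact (e ⟨v, hv⟩).2)
    refine (hirr i).ne_bot ((Submodule.eq_bot_iff _).2 fun v hv => ?_)
    have h1 := h0 v hv
    rw [hSv v hv, Submodule.coe_eq_zero, map_eq_zero_iff _ e.injective] at h1
    exact congrArg Subtype.val h1
  · intro j
    refine le_antisymm (le_sSup ⟨hirr j, LinearIsometryEquiv.refl ℂ _, fun g v v' h => h⟩) ?_
    refine sSup_le ?_
    rintro W ⟨hW, e, he⟩ w hw
    -- The copy `W` of `H j` projects to 0 in every other summand, as projection after `e` is again
    -- an intertwiner; by totality `W` lies in `H j`.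
    have hP : ∀ i, i ≠ j → (H i).starProjection w = 0 := by
      intro i hij
      set S : E →L[ℂ] E := (H i).starProjection ∘L W.subtypeL ∘L
        e.toContinuousLinearEquiv.toContinuousLinearMap ∘L (H j).orthogonalProjectionOnto with hSdef
      have hSv : ∀ v (hv : v ∈ H j), S v = (H i).starProjection (e ⟨v, hv⟩) := by
        intro v hv
        have := (H j).orthogonalProjectionOnto_mem_subspace_eq_self ⟨v, hv⟩
        rw [hSdef, ContinuousLinearMap.comp_apply, ContinuousLinearMap.comp_apply,
          ContinuousLinearMap.comp_apply, this]
        rfl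
      have h0 := hS S j i hij.symm (fun g v hv => by
          rw [hSv v hv, hSv _ ((hirr j).invariant g v hv), ← starProjection_rep (hirr i).invariant]
          congr 1
          exact he g ⟨v, hv⟩ _ rfl)
        (fun v hv => by rw [hSv v hv]; exact (H i).starProjection_apply_mem _)
        (e.symm ⟨w, hw⟩) (e.symm ⟨w, hw⟩).2
      rwa [hSv _ (e.symm ⟨w, hw⟩).2, Subtype.coe_eta, e.apply_symm_apply] at h0
    have hz : w - (H j).starProjection w ∈ (⨆ i, H i)ᗮ := by
      rw [Submodule.mem_orthogonal']
      intro u hu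
      induction hu using Submodule.iSup_induction' with
      | mem i u hu =>
        by_cases hij : i = j
        · subst hij
          exact (H i).starProjection_inner_eq_zero _ _ hu
        · rw [inner_sub_left, horth j i (Ne.symm hij) _ ((H j).starProjection_apply_mem _) u hu,
            sub_zero]
          have := (H i).starProjection_inner_eq_zero w u hu
          rwa [hP i hij, sub_zero] at this
      | zero => exact inner_zero_right _
      | add u v _ _ hu hv => rw [inner_add_right, hu, hv, add_zero]
    rw [htot, Submodule.mem_bot, sub_eq_zero] at hz
    rw [hz]
    exact (H j).starProjection_apply_mem w
  · refine IsHilbertSum.mkInternal H (fun i j hij v w => horth i j hij _ v.2 _ w.2) ?_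
    rw [Submodule.topologicalClosure_eq_top_iff.2 htot]

end AbstractReps

-- Transitivity of SO(n) on the real unit sphere

section Transitivity

open MvPolynomial

variable {n : ℕ}

/-- The reflection matrix `1 - 2 v vᵀ / (vᵀ v)`. -/
def reflectionMatrix (v : Fin n → ℝ) : Matrix (Fin n) (Fin n) ℝ :=
  1 - (2 / (v ⬝ᵥ v)) • Matrix.vecMulVec v v

lemma reflectionMatrix_mem {v : Fin n → ℝ} (hv : v ⬝ᵥ v ≠ 0) :
    reflectionMatrix v ∈ Matrix.orthogonalGroup (Fin n) ℝ := by
  rw [Matrix.mem_orthogonalGroup_iff]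
  have hs : (reflectionMatrix v).transpose = reflectionMatrix v := by
    ext i j
    simp [reflectionMatrix, Matrix.vecMulVec_apply, Matrix.one_apply, eq_comm,
      mul_comm]
  rw [hs, reflectionMatrix, sub_mul, one_mul, mul_sub, mul_one, Matrix.smul_mul, Matrix.mul_smul,
    Matrix.vecMulVec_mul_vecMulVec, Matrix.vecMulVec_smul, smul_smul, smul_smul]
  have : 2 / (v ⬝ᵥ v) * (2 / (v ⬝ᵥ v)) * (v ⬝ᵥ v) = 2 / (v ⬝ᵥ v) + 2 / (v ⬝ᵥ v) := by
    field_simp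
    norm_num
  rw [this, add_smul]
  abel

lemma reflectionMatrix_mulVec (v w : Fin n → ℝ) :
    (reflectionMatrix v).mulVec w = w - (2 / (v ⬝ᵥ v) * (v ⬝ᵥ w)) • v := by
  rw [reflectionMatrix, Matrix.sub_mulVec, Matrix.one_mulVec, Matrix.smul_mulVec,
    Matrix.vecMulVec_mulVec, op_smul_eq_smul, smul_smul]

/-- `SO(n)` acts transitively on the unit sphere. -/
lemma exists_SO_mulVec_single (hn : 2 ≤ n) (o : Fin n) {u : Fin n → ℝ} (hu : u ⬝ᵥ u = 1) :
    ∃ A : SO n, (A : Matrix (Fin n) (Fin n) ℝ).mulVec (Pi.single o 1) = u := by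
  classical
  obtain ⟨M, hM, hMu⟩ : ∃ M ∈ Matrix.orthogonalGroup (Fin n) ℝ, M.mulVec (Pi.single o 1) = u := by
    by_cases huo : u = Pi.single o 1
    · exact ⟨1, one_mem _, by rw [Matrix.one_mulVec, huo]⟩
    -- For unit vectors the reflection along their difference exchanges them.
    · have hv : (u - Pi.single o 1) ⬝ᵥ (u - Pi.single o 1) ≠ 0 := by
        rwa [Ne, dotProduct_self_eq_zero, sub_eq_zero]
      refine ⟨_, reflectionMatrix_mem hv, ?_⟩
      rw [reflectionMatrix_mulVec]
      have h1 : (u - Pi.single o 1) ⬝ᵥ (u - Pi.single o 1) = 2 - 2 * u o := by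
        simp [dotProduct_sub, hu]
        ring
      have h2 : (u - Pi.single o 1) ⬝ᵥ Pi.single o 1 = u o - 1 := by
        simp
      rw [h1] at hv
      have h3 : 2 / (2 - 2 * u o) * (u o - 1) = -1 := by
        rw [div_mul_eq_mul_div, div_eq_iff hv]
        ring
      rw [h1, h2, h3]
      simp
  have hdet : M.det = 1 ∨ M.det = -1 := by
    have h := congrArg Matrix.det ((Matrix.mem_orthogonalGroup_iff _ _).1 hM)
    rw [Matrix.det_mul, Matrix.det_transpose, Matrix.det_one] at h
    exact mul_self_eq_one_iff.1 h
  rcases hdet with hdet | hdet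
  · exact ⟨⟨M, Matrix.mem_specialOrthogonalGroup_iff.2 ⟨hM, hdet⟩⟩, hMu⟩
  -- A sign change of another coordinate corrects the determinant and fixes the coordinate vector
  -- `o`.
  · have : Nontrivial (Fin n) := Fin.nontrivial_iff_two_le.2 hn
    obtain ⟨a, ha⟩ := exists_ne o
    set D : Matrix (Fin n) (Fin n) ℝ := Matrix.diagonal (Function.update 1 a (-1)) with hD
    have hDm : D ∈ Matrix.orthogonalGroup (Fin n) ℝ := by
      rw [Matrix.mem_orthogonalGroup_iff, hD, Matrix.diagonal_transpose,
        Matrix.diagonal_mul_diagonal, Matrix.diagonal_eq_one]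
      ext i
      by_cases hi : i = a <;> simp [hi]
    have hDdet : D.det = -1 := by
      rw [hD, Matrix.det_diagonal, Finset.prod_update_of_mem (Finset.mem_univ a)]
      simp
    refine ⟨⟨M * D, Matrix.mem_specialOrthogonalGroup_iff.2 ⟨mul_mem hM hDm, ?_⟩⟩, ?_⟩
    · rw [Matrix.det_mul, hdet, hDdet]
      norm_num
    · change (M * D).mulVec _ = _
      rw [← Matrix.mulVec_mulVec, hD, Matrix.diagonal_mulVec_single]
      simpa [Function.update_apply, ha.symm] using hMu

lemma subst_smul {p : MvPolynomial (Fin n) ℂ} {m : ℕ} (hp : p.IsHomogeneous m) (c : ℂ)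
    (B : Matrix (Fin n) (Fin n) ℂ) : subst (c • B) p = c ^ m • subst B p := by
  refine MvPolynomial.funext fun z => ?_
  have := congrArg (eval (B.mulVec z)) (subst_smul_one hp c)
  rw [eval_subst, Matrix.smul_mulVec, Matrix.one_mulVec] at this
  rw [eval_subst, Matrix.smul_mulVec, this, smul_eval, smul_eval, eval_subst]

/-- A non-zero polynomial does not vanish on all real points; homogeneity moves a non-zero value to
the unit sphere, and transitivity to the orbit of a coordinate vector. -/
lemma exists_SO_eval_ne_zero (hn : 2 ≤ n) (o : Fin n) {p : MvPolynomial (Fin n) ℂ} {k : ℕ}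
    (hp : p.IsHomogeneous k) (hp0 : p ≠ 0) :
    ∃ A : SO n, eval ((complexMatrix A).mulVec (Pi.single o 1)) p ≠ 0 := by
  have hinf : (Set.range Complex.ofReal).Infinite := Set.infinite_range_of_injective Complex.ofReal_injective
  obtain ⟨x, hx, hxo⟩ : ∃ x : Fin n → ℝ, eval (fun i => (x i : ℂ)) p ≠ 0 ∧ x o ≠ 0 := by
    by_contra! h
    -- The extra factor X_o guarantees a non-zero point, also when `p` is constant.
    refine mul_ne_zero hp0 (X_ne_zero o) (MvPolynomial.funext_set (fun _ => Set.range Complex.ofReal)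
      (fun _ => hinf) fun z hz => ?_)
    choose x hx using fun i => hz i (Set.mem_univ i)
    obtain rfl : (fun i => (x i : ℂ)) = z := funext hx
    rw [map_mul, eval_X, map_zero]
    by_cases hx0 : eval (fun i => (x i : ℂ)) p = 0
    · rw [hx0, zero_mul]
    · rw [h x hx0, Complex.ofReal_zero, mul_zero]
  have hpos : 0 < x ⬝ᵥ x := by
    refine lt_of_le_of_ne (by simpa using dotProduct_star_self_nonneg x) (Ne.symm ?_)
    rw [Ne, dotProduct_self_eq_zero]
    rintro rfl
    exact hxo rfl
  obtain ⟨A, hA⟩ := exists_SO_mulVec_single hn o (u := (√(x ⬝ᵥ x))⁻¹ • x) (by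
    rw [smul_dotProduct, dotProduct_smul, smul_smul, smul_eq_mul, ← mul_inv,
      Real.mul_self_sqrt hpos.le, inv_mul_cancel₀ hpos.ne'])
  refine ⟨A, ?_⟩
  have hs : (complexMatrix A).mulVec (Pi.single o 1) =
      (((√(x ⬝ᵥ x))⁻¹ : ℝ) : ℂ) • fun i => (x i : ℂ) := by
    ext i
    have h1 := congrFun hA i
    rw [Matrix.mulVec_single_one] at h1 ⊢
    change ((A : Matrix (Fin n) (Fin n) ℝ) i o : ℂ) = _
    change (A : Matrix (Fin n) (Fin n) ℝ) i o = _ at h1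
    rw [h1]
    simp
  have h2 := congrArg (eval fun i => (x i : ℂ)) (subst_smul_one hp (((√(x ⬝ᵥ x))⁻¹ : ℝ) : ℂ))
  rw [eval_subst, Matrix.smul_mulVec, Matrix.one_mulVec, smul_eval] at h2
  rw [hs, h2]
  refine mul_ne_zero (pow_ne_zero _ ?_) hx
  exact_mod_cast (inv_pos.2 (Real.sqrt_pos.2 hpos)).ne'

end Transitivity

-- The summands as modules over SO(n) and SO(n) × SO(2)

section Summands

variable {n : ℕ} {lam : ℝ}

lemma subst_quad (A : SO n) : subst (complexMatrix A) (quad n) = quad n := by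
  have h : ∀ z : Fin n → ℂ, MvPolynomial.eval z (quad n) = bil z := fun z => by simp [quad, bil]
  refine MvPolynomial.funext fun z => ?_
  rw [eval_subst, h, h]
  simpa [act, actMatrix] using bil_act ((A, 1) : SOxSO2 n) z

lemma subst_mem_harmonic (A : SO n) {k : ℕ} {p : MvPolynomial (Fin n) ℂ} (hp : p ∈ harmonic n k) :
    subst (complexMatrix A) p ∈ harmonic n k := by
  have := (harmonicRep n k A⁻¹ ⟨p, hp⟩).2
  have h : ((harmonicRep n k A⁻¹ ⟨p, hp⟩ : harmonic n k) : MvPolynomial (Fin n) ℂ) =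
    subst (complexMatrix A⁻¹⁻¹) p := rfl
  rwa [h, inv_inv] at this

lemma mem_summand_iff {k a : ℕ} {v : bergman n lam} :
    v ∈ summand n lam k a ↔ ∃ p ∈ harmonic n k, polyToBergman n lam (p * quad n ^ a) = v :=
  Iff.rfl

lemma bergmanRepSO_harmonic_mul (A : SO n) (p : MvPolynomial (Fin n) ℂ) (a : ℕ) :
    bergmanRepSO n lam A (polyToBergman n lam (p * quad n ^ a)) =
      polyToBergman n lam (subst (complexMatrix A⁻¹) p * quad n ^ a) := by
  rw [bergmanRepSO_polyToBergman, map_mul, map_pow, subst_quad]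

lemma bergmanRep_eq (g : SOxSO2 n) {k a : ℕ} {p : MvPolynomial (Fin n) ℂ}
    (hp : p ∈ harmonic n k) :
    bergmanRep n lam g (polyToBergman n lam (p * quad n ^ a)) =
      ((g.2 : ℂ) ^ (-((k + 2 * a : ℕ) : ℤ))) •
        polyToBergman n lam (subst (complexMatrix g.1⁻¹) p * quad n ^ a) := by
  have h1 : actMatrix g⁻¹ = ((g.2 : ℂ)⁻¹) • complexMatrix g.1⁻¹ := by
    rw [actMatrix, Prod.snd_inv, Prod.fst_inv, Circle.coe_inv]
  rw [bergmanRep_polyToBergman, h1, subst_smul (isHomogeneous_mul_quad_pow hp.2 a), map_mul,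
    map_pow, subst_quad, map_smul, zpow_neg, zpow_natCast, inv_pow]

lemma summand_invariant (k a : ℕ) (g : SOxSO2 n) (v : bergman n lam)
    (hv : v ∈ summand n lam k a) : bergmanRep n lam g v ∈ summand n lam k a := by
  obtain ⟨p, hp, rfl⟩ := mem_summand_iff.1 hv
  rw [bergmanRep_eq g hp]
  exact Submodule.smul_mem _ _ (mem_summand_iff.2 ⟨_, subst_mem_harmonic _ hp, rfl⟩)

instance finiteDimensional_harmonic (k : ℕ) : FiniteDimensional ℂ (harmonic n k) := by
  have : FiniteDimensional ℂ (MvPolynomial.homogeneousSubmodule (Fin n) ℂ k) :=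
    Module.Finite.iff_fg.2 (MvPolynomial.homogeneousSubmodule_fg _ _ k)
  exact Submodule.finiteDimensional_of_le inf_le_right

instance finiteDimensional_summand (k a : ℕ) : FiniteDimensional ℂ (summand n lam k a) := by
  unfold summand
  infer_instance

lemma mul_quad_pow_injective (hn : 1 ≤ n) (a : ℕ) :
    Function.Injective fun p : MvPolynomial (Fin n) ℂ => p * quad n ^ a :=
  mul_left_injective₀ (pow_ne_zero a (quad_ne_zero hn))

lemma polyToBergman_mul_injective (hn : 2 ≤ n) (hlam : (n : ℝ) - 1 < lam) (a : ℕ) :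
    Function.Injective (polyToBergman n lam ∘ₗ LinearMap.mulRight ℂ (quad n ^ a)) :=
  (polyToBergman_injective hn hlam).comp (mul_quad_pow_injective (by omega) a)

/-- Multiplication by `(zᵀz)ᵃ` as an isomorphism onto a summand. -/
def summandEquiv (hn : 2 ≤ n) (hlam : (n : ℝ) - 1 < lam) (k a : ℕ) :
    harmonic n k ≃ₗ[ℂ] summand n lam k a :=
  Submodule.equivMapOfInjective _ (polyToBergman_mul_injective hn hlam a) (harmonic n k)

lemma coe_summandEquiv (hn : 2 ≤ n) (hlam : (n : ℝ) - 1 < lam) (k a : ℕ) (p : harmonic n k) :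
    (summandEquiv hn hlam k a p : bergman n lam) = polyToBergman n lam (p.1 * quad n ^ a) := rfl

lemma summandEquiv_rep (hn : 2 ≤ n) (hlam : (n : ℝ) - 1 < lam) (k a : ℕ) (A : SO n)
    (p : harmonic n k) : (summandEquiv hn hlam k a (harmonicRep n k A p) : bergman n lam) =
      bergmanRepSO n lam A (summandEquiv hn hlam k a p) := by
  rw [coe_summandEquiv, coe_summandEquiv, bergmanRepSO_harmonic_mul]
  rfl

lemma isModuleIso_harmonicRep (hn : 2 ≤ n) (hlam : (n : ℝ) - 1 < lam) (k a : ℕ) :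
    IsModuleIso (harmonicRep n k) (bergmanRepSO n lam) (summand n lam k a) :=
  ⟨summandEquiv hn hlam k a, summandEquiv_rep hn hlam k a⟩

lemma isModuleIso_outerTensor (hn : 2 ≤ n) (hlam : (n : ℝ) - 1 < lam) (k a : ℕ) :
    IsModuleIso (M := harmonic n k ⊗[ℂ] ℂ) (outerTensor (harmonicRep n k) (charRep (k + 2 * a))) (bergmanRep n lam)
      (summand n lam k a) := by
  refine ⟨(TensorProduct.rid ℂ (harmonic n k)).trans (summandEquiv hn hlam k a), fun g x => ?_⟩
  induction x using TensorProduct.induction_on with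
  | zero => simp
  | add x y hx hy => simp only [map_add, Submodule.coe_add, hx, hy]
  | tmul p c =>
    have h1 : outerTensor (harmonicRep n k) (charRep (k + 2 * a)) g (p ⊗ₜ[ℂ] c) =
      (harmonicRep n k g.1 p) ⊗ₜ[ℂ] (((g.2 : ℂ) ^ (-((k + 2 * a : ℕ) : ℤ))) • c) := rfl
    rw [h1, LinearEquiv.trans_apply, LinearEquiv.trans_apply, TensorProduct.rid_tmul,
      TensorProduct.rid_tmul, map_smul, map_smul, Submodule.coe_smul, Submodule.coe_smul,
      map_smul, coe_summandEquiv, coe_summandEquiv, bergmanRep_eq g p.2, smul_eq_mul, mul_comm,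
      mul_smul]
    rfl

end Summands

-- Irreducibility under SO(n)

section Irreducibility

open MvPolynomial

variable {n : ℕ} {lam : ℝ}

lemma eval_single_linDer_rotMatrix {o i j : Fin n} (hi : i ≠ o) (hj : j ≠ o)
    (p : MvPolynomial (Fin n) ℂ) :
    eval (Pi.single o 1) (linDer (rotMatrix i j) p) = 0 := by
  rw [linDer_rotMatrix, map_sub, map_mul, map_mul, eval_X, eval_X, Pi.single_eq_of_ne hi,
    Pi.single_eq_of_ne hj]
  ring

/-- SO(n) preserves harmonic polynomials, hence so does its derivative. The argument runs in the
auxiliary Bergman space with λ = n, where `IsDifferential.mem` applies. -/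
lemma linDer_rotMatrix_mem_harmonic (i j : Fin n) {k : ℕ} {p : MvPolynomial (Fin n) ℂ}
    (hn : 2 ≤ n) (hp : p ∈ harmonic n k) : linDer (rotMatrix i j) p ∈ harmonic n k := by
  have hlam : (n : ℝ) - 1 < n := by linarith
  have h1 := isDifferential_rotSO (lam := n) i j (p * quad n ^ 0)
  have h2 := h1.mem (W := summand n n k 0)
    (fun A v hv => summand_invariant k 0 (A, 1) v hv) (mem_summand_iff.2 ⟨p, hp, rfl⟩)
  obtain ⟨q, hq, hqe⟩ := mem_summand_iff.1 h2
  rw [linDer_mul_quad_pow (rotMatrix_transpose i j)] at hqe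
  rwa [← polyToBergman_mul_injective hn hlam 0 hqe]

/-- A non-zero `SO(n)`-invariant subspace of a summand contains a vector that is fixed by the
stabilizer of a coordinate vector and does not vanish at that vector. -/
lemma exists_zonal_mem (hn : 3 ≤ n) (hlam : (n : ℝ) - 1 < lam) (o : Fin n) {k a : ℕ}
    {W : Submodule ℂ (bergman n lam)} (hW : W ≤ summand n lam k a) (hW0 : W ≠ ⊥)
    (hinv : ∀ A, ∀ w ∈ W, bergmanRepSO n lam A w ∈ W) :
    ∃ h ∈ harmonic n k, polyToBergman n lam (h * quad n ^ a) ∈ W ∧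
      (∀ i j, i ≠ o → j ≠ o → linDer (rotMatrix i j) h = 0) ∧ eval (Pi.single o 1) h ≠ 0 := by
  have hn2 : 2 ≤ n := by omega
  have : FiniteDimensional ℂ W := Submodule.finiteDimensional_of_le hW
  set ev : MvPolynomial (Fin n) ℂ →ₗ[ℂ] ℂ := (MvPolynomial.aeval (Pi.single o (1 : ℂ))).toLinearMap
    with hev
  have hev' : ∀ p, ev p = eval (Pi.single o 1) p := fun p => by
    rw [hev, AlgHom.toLinearMap_apply, MvPolynomial.aeval_eq_eval]
  set l : W →ₗ[ℂ] ℂ := ev ∘ₗ (harmonic n k).subtype ∘ₗ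
    (summandEquiv hn2 hlam k a).symm.toLinearMap ∘ₗ Submodule.inclusion hW with hl
  have hlT : ∀ p ∈ harmonic n k, ∀ hp : polyToBergman n lam (p * quad n ^ a) ∈ W,
      l ⟨_, hp⟩ = eval (Pi.single o 1) p := by
    intro p hp hpW
    have h1 : Submodule.inclusion hW ⟨_, hpW⟩ = summandEquiv hn2 hlam k a ⟨p, hp⟩ := rfl
    rw [hl, LinearMap.comp_apply, LinearMap.comp_apply, LinearMap.comp_apply, h1,
      LinearEquiv.coe_coe, LinearEquiv.symm_apply_apply, Submodule.subtype_apply, hev']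
  -- The Riesz representative in `W` of evaluation at the coordinate vector.
  set Z : W := (InnerProductSpace.toDual ℂ W).symm (LinearMap.toContinuousLinearMap l) with hZ
  have hZi : ∀ w : W, inner ℂ Z w = l w := fun w => InnerProductSpace.toDual_symm_apply
  obtain ⟨h, hh, hhZ⟩ := mem_summand_iff.1 (hW Z.2)
  have hhW : polyToBergman n lam (h * quad n ^ a) ∈ W := hhZ ▸ Z.2
  -- For D a rotation fixing the point, skewness gives ‖Dh‖² = -⟨h, D²h⟩, which is minus the value
  -- of D²h there, namely 0.
  have hrot : ∀ i j, i ≠ o → j ≠ o → linDer (rotMatrix i j) h = 0 := by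
    intro i j hi hj
    have hd : ∀ p, IsDifferential (bergmanRepSO n lam) (rotSO i j)
        (polyToBergman n lam (p * quad n ^ a))
        (polyToBergman n lam (linDer (rotMatrix i j) p * quad n ^ a)) := fun p => by
      rw [← linDer_mul_quad_pow (rotMatrix_transpose i j)]
      exact isDifferential_rotSO i j _
    have h1 := (hd h).mem hinv hhW
    have h2 := linDer_rotMatrix_mem_harmonic i j hn2 hh
    have h3 := linDer_rotMatrix_mem_harmonic i j hn2 h2
    have h4 := (hd (linDer (rotMatrix i j) h)).mem hinv h1
    have h5 := (hd h).inner_add_inner (hd (linDer (rotMatrix i j) h))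
    have h6 := hZi ⟨_, h4⟩
    rw [hlT _ h3, eval_single_linDer_rotMatrix hi hj, Submodule.coe_inner, ← hhZ] at h6
    rw [h6, zero_add] at h5
    exact polyToBergman_mul_injective hn2 hlam a
      (((inner_self_eq_zero (𝕜 := ℂ)).1 h5).trans (map_zero _).symm)
  refine ⟨h, hh, hhW, hrot, fun heval => ?_⟩
  -- Were `h` zero, evaluation would vanish on all of `W`, contrary to the transitivity of SO(n).
  have hh0 : h = 0 := eq_zero_of_zonal hn o hh hrot heval
  obtain ⟨w, hw, hw0⟩ := Submodule.exists_mem_ne_zero_of_ne_bot hW0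
  obtain ⟨p, hp, rfl⟩ := mem_summand_iff.1 (hW hw)
  have hp0 : p ≠ 0 := by
    rintro rfl
    exact hw0 (by rw [zero_mul, map_zero])
  obtain ⟨A, hA⟩ := exists_SO_eval_ne_zero hn2 o hp.2 hp0
  have h1 := hinv A⁻¹ _ hw
  rw [bergmanRepSO_harmonic_mul, inv_inv] at h1
  have h2 := hZi ⟨_, h1⟩
  rw [hlT _ (subst_mem_harmonic A hp), eval_subst, Submodule.coe_inner, ← hhZ, hh0, zero_mul,
    map_zero, inner_zero_left] at h2
  exact hA h2.symm

/-- A proper non-zero invariant `W` and its complement would each contain a zonal polynomial with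
non-zero value at the coordinate vector. These are proportional by `eq_zero_of_zonal`, yet
orthogonal. -/
lemma isIrreducibleSubspace_summand_SO (hn : 3 ≤ n) (hlam : (n : ℝ) - 1 < lam) (k a : ℕ) :
    IsIrreducibleSubspace (bergmanRepSO n lam) (summand n lam k a) := by
  have hn2 : 2 ≤ n := by omega
  have hinvH : ∀ A, ∀ v ∈ summand n lam k a, bergmanRepSO n lam A v ∈ summand n lam k a :=
    fun A v hv => summand_invariant k a (A, 1) v hv
  refine ⟨Submodule.closed_of_finiteDimensional _, hinvH, ?_, ?_⟩
  · intro hbot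
    have h1 : polyToBergman n lam (_ * quad n ^ a) ∈ summand n lam k a :=
      mem_summand_iff.2 ⟨_, highest_mem_harmonic hn2 k, rfl⟩
    rw [hbot, Submodule.mem_bot] at h1
    exact highest_ne_zero hn2 k (polyToBergman_mul_injective hn2 hlam a (h1.trans (map_zero _).symm))
  · intro W hW _ hinv
    by_contra! hne
    have : FiniteDimensional ℂ W := Submodule.finiteDimensional_of_le hW
    have hW' : Wᗮ ⊓ summand n lam k a ≠ ⊥ := by
      intro hbot
      have := Submodule.sup_orthogonal_inf_of_hasOrthogonalProjection hW
      rw [hbot, sup_bot_eq] at this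
      exact hne.2 this
    have hinv' : ∀ A, ∀ w ∈ Wᗮ ⊓ summand n lam k a,
        bergmanRepSO n lam A w ∈ Wᗮ ⊓ summand n lam k a := by
      rintro A w ⟨hw, hwH⟩
      refine ⟨(Submodule.mem_orthogonal' _ _).2 fun u hu => ?_, hinvH A w hwH⟩
      rw [inner_rep_left]
      exact Submodule.inner_left_of_mem_orthogonal (hinv _ u hu) hw
    set o : Fin n := ⟨0, by omega⟩
    obtain ⟨h, hh, hhW, hrot, hev⟩ := exists_zonal_mem hn hlam o hW hne.1 hinv
    obtain ⟨h', hh', hhW', hrot', hev'⟩ := exists_zonal_mem hn hlam o inf_le_right hW' hinv'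
    set c := eval (Pi.single o 1) h with hc
    set c' := eval (Pi.single o 1) h' with hc'
    have h0 : c' • h - c • h' = 0 := by
      refine eq_zero_of_zonal hn o (sub_mem (Submodule.smul_mem _ _ hh) (Submodule.smul_mem _ _ hh'))
        (fun i j hi hj => ?_) ?_
      · rw [map_sub, Derivation.map_smul, Derivation.map_smul, hrot i j hi hj, hrot' i j hi hj,
          smul_zero, smul_zero, sub_zero]
      · rw [map_sub, smul_eval, smul_eval, ← hc, ← hc']
        ring
    have h1 : c' • polyToBergman n lam (h * quad n ^ a) =
        c • polyToBergman n lam (h' * quad n ^ a) := by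
      rw [← map_smul, ← map_smul, ← smul_mul_assoc, ← smul_mul_assoc, sub_eq_zero.1 h0]
    have h2 : c' • polyToBergman n lam (h * quad n ^ a) ∈ W := W.smul_mem _ hhW
    have h3 : c' • polyToBergman n lam (h * quad n ^ a) ∈ Wᗮ := h1 ▸ Wᗮ.smul_mem _ hhW'.1
    have h4 : c' • polyToBergman n lam (h * quad n ^ a) = 0 :=
      (Submodule.eq_bot_iff _).1 W.inf_orthogonal_eq_bot _ ⟨h2, h3⟩
    have h5 := (smul_eq_zero.1 h4).resolve_left hev'
    have h6 : h = 0 := polyToBergman_mul_injective hn2 hlam a (h5.trans (map_zero _).symm)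
    rw [hc, h6, map_zero] at hev
    exact hev rfl

lemma isIrreducibleSubspace_summand (hn : 3 ≤ n) (hlam : (n : ℝ) - 1 < lam) (k a : ℕ) :
    IsIrreducibleSubspace (bergmanRep n lam) (summand n lam k a) :=
  (isIrreducibleSubspace_summand_SO hn hlam k a).of_comp (summand_invariant k a)

lemma unitarilyEquivalent_summand (hn : 3 ≤ n) (hlam : (n : ℝ) - 1 < lam) (k a b : ℕ) :
    UnitarilyEquivalent (bergmanRepSO n lam) (summand n lam k a) (summand n lam k b) := by
  have hn2 : 2 ≤ n := by omega
  refine unitarilyEquivalent_of_linearEquiv (isIrreducibleSubspace_summand_SO hn hlam k a)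
    ((summandEquiv hn2 hlam k a).symm.trans (summandEquiv hn2 hlam k b)) fun A v v' hvv' => ?_
  obtain ⟨p, rfl⟩ := (summandEquiv hn2 hlam k a).surjective v
  obtain rfl : v' = summandEquiv hn2 hlam k a (harmonicRep n k A p) :=
    Subtype.ext (hvv'.trans (summandEquiv_rep hn2 hlam k a A p).symm)
  rw [LinearEquiv.trans_apply, LinearEquiv.trans_apply, LinearEquiv.symm_apply_apply,
    LinearEquiv.symm_apply_apply, summandEquiv_rep]

end Irreducibility

-- Absence of intertwiners, totality and the isotypic decomposition

section Decomposition

open MvPolynomial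

variable {n : ℕ} {lam : ℝ}

lemma sum_rot_rot_mul_quad_pow {k : ℕ} {p : MvPolynomial (Fin n) ℂ} (hp : p ∈ harmonic n k)
    (a : ℕ) : ∑ i, ∑ j, linDer (rotMatrix i j) (linDer (rotMatrix i j) (p * quad n ^ a)) =
      (-(2 * k * (k + n - 2)) : ℂ) • (p * quad n ^ a) := by
  simp only [linDer_mul_quad_pow (rotMatrix_transpose _ _), ← Finset.sum_mul]
  rw [sum_rot_rot_harmonic hp, smul_mul_assoc]

/-- Operators that intertwine the actions of `SO(n)` preserve the degree of the harmonic factor. -/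
lemma intertwiner_eq_zero_of_ne (hn : 3 ≤ n) {k a k' a' : ℕ} (hk : k ≠ k')
    {S : bergman n lam →L[ℂ] bergman n lam}
    (hS : ∀ A, ∀ v ∈ summand n lam k a, S (bergmanRepSO n lam A v) = bergmanRepSO n lam A (S v))
    (hSm : ∀ v ∈ summand n lam k a, S v ∈ summand n lam k' a') {v : bergman n lam}
    (hv : v ∈ summand n lam k a) : S v = 0 := by
  have hinv : ∀ A, ∀ v ∈ summand n lam k a, bergmanRepSO n lam A v ∈ summand n lam k a :=
    fun A v hv => summand_invariant k a (A, 1) v hv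
  have hmem : ∀ i j p, polyToBergman n lam p ∈ summand n lam k a →
      polyToBergman n lam (linDer (rotMatrix i j) p) ∈ summand n lam k a := fun i j p hp =>
    (isDifferential_rotSO i j p).mem hinv hp
  have hstep : ∀ i j p p', polyToBergman n lam p ∈ summand n lam k a →
      S (polyToBergman n lam p) = polyToBergman n lam p' →
      S (polyToBergman n lam (linDer (rotMatrix i j) p)) =
        polyToBergman n lam (linDer (rotMatrix i j) p') := by
    intro i j p p' hp hpp'
    have h1 := (isDifferential_rotSO i j p).map S hS hp
    rw [hpp'] at h1
    exact HasDerivAt.unique h1 (isDifferential_rotSO i j p')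
  obtain ⟨p, hp, rfl⟩ := mem_summand_iff.1 hv
  obtain ⟨p', hp', hpp'⟩ := mem_summand_iff.1 (hSm _ hv)
  have h1 : S (polyToBergman n lam (∑ i, ∑ j, linDer (rotMatrix i j)
      (linDer (rotMatrix i j) (p * quad n ^ a)))) =
      polyToBergman n lam (∑ i, ∑ j, linDer (rotMatrix i j)
        (linDer (rotMatrix i j) (p' * quad n ^ a'))) := by
    simp only [map_sum]
    exact Finset.sum_congr rfl fun i _ => Finset.sum_congr rfl fun j _ =>
      hstep i j _ _ (hmem i j _ hv) (hstep i j _ _ hv hpp'.symm)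
  rw [sum_rot_rot_mul_quad_pow hp, sum_rot_rot_mul_quad_pow hp', map_smul, map_smul, map_smul,
    hpp', ← sub_eq_zero, ← sub_smul] at h1
  refine (smul_eq_zero.1 h1).resolve_left fun hc => ?_
  -- The difference of the Casimir eigenvalues is -2(k - k')(k + k' + n - 2); the last factor is
  -- positive since n ≥ 3.
  have h2 : ((k : ℂ) - k') * ((k + k' + n : ℕ) - (2 : ℕ) : ℂ) = 0 := by
    push_cast
    linear_combination (-1 / 2) * hc
  rcases mul_eq_zero.1 h2 with h3 | h3
  · exact hk (by exact_mod_cast sub_eq_zero.1 h3)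
  · have h4 : k + k' + n = 2 := by exact_mod_cast sub_eq_zero.1 h3
    omega

lemma exists_circle_zpow_eq (m : ℤ) (hm : m ≠ 0) : ∃ t : Circle, (t : ℂ) ^ m = -1 := by
  refine ⟨Circle.exp (Real.pi / m), ?_⟩
  have hm' : (m : ℂ) ≠ 0 := by exact_mod_cast hm
  rw [Circle.coe_exp, ← Complex.exp_int_mul, ← Complex.exp_pi_mul_I]
  congr 1
  push_cast
  field_simp

/-- Operators that intertwine the actions of `SO(2)` preserve the degree. -/
lemma intertwiner_eq_zero_of_degree_ne {k a k' a' : ℕ} (hd : k + 2 * a ≠ k' + 2 * a')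
    {S : bergman n lam →L[ℂ] bergman n lam}
    (hS : ∀ g, ∀ v ∈ summand n lam k a, S (bergmanRep n lam g v) = bergmanRep n lam g (S v))
    (hSm : ∀ v ∈ summand n lam k a, S v ∈ summand n lam k' a') {v : bergman n lam}
    (hv : v ∈ summand n lam k a) : S v = 0 := by
  have hcirc : ∀ {k a : ℕ} (t : Circle) {v : bergman n lam}, v ∈ summand n lam k a →
      bergmanRep n lam (1, t) v = (t : ℂ) ^ (-((k + 2 * a : ℕ) : ℤ)) • v := by
    intro k a t v hv
    obtain ⟨p, hp, rfl⟩ := mem_summand_iff.1 hv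
    have h1 : subst (complexMatrix (1 : SO n)⁻¹) p = p := MvPolynomial.funext fun z => by
      rw [eval_subst, inv_one, complexMatrix_one, Matrix.one_mulVec]
    rw [bergmanRep_eq _ hp]
    simp only [h1]
  -- A circle element at which the two characters differ by the factor -1.
  obtain ⟨t, ht⟩ := exists_circle_zpow_eq
    (((k' + 2 * a' : ℕ) : ℤ) - ((k + 2 * a : ℕ) : ℤ)) (by omega)
  have h1 := hS (1, t) v hv
  rw [hcirc t hv, hcirc t (hSm v hv), map_smul] at h1
  have hne : (t : ℂ) ≠ 0 := Circle.coe_ne_zero t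
  have h2 : (t : ℂ) ^ (-((k + 2 * a : ℕ) : ℤ)) = -(t : ℂ) ^ (-((k' + 2 * a' : ℕ) : ℤ)) := by
    rw [← neg_one_mul ((t : ℂ) ^ _), ← ht, ← zpow_add₀ hne]
    congr 1
    ring
  have h3 : (2 * (t : ℂ) ^ (-((k' + 2 * a' : ℕ) : ℤ))) • S v = 0 := by
    rw [two_mul, add_smul]
    nth_rw 1 [← h1]
    rw [h2, neg_smul, neg_add_cancel]
  exact (smul_eq_zero.1 h3).resolve_left (mul_ne_zero two_ne_zero (zpow_ne_zero _ hne))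

lemma iSup_summand_orthogonal (hn : 2 ≤ n) (hlam : (n : ℝ) - 1 < lam) :
    (⨆ k : ℕ × ℕ, summand n lam k.1 k.2)ᗮ = ⊥ := by
  refine (Submodule.eq_bot_iff _).2 fun f hf => eq_zero_of_inner_poly_eq_zero hn hlam fun p => ?_
  refine Submodule.inner_right_of_mem_orthogonal ?_ hf
  set V := ⨆ k : ℕ × ℕ, summand n lam k.1 k.2 with hV
  have hle : ∀ m, harmonicProducts n m ≤ V.comap (polyToBergman n lam) := by
    intro m
    refine Submodule.span_le.2 ?_
    rintro _ ⟨k, j, -, h, hh, rfl⟩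
    exact Submodule.mem_iSup_of_mem (p := fun k : ℕ × ℕ => summand n lam k.1 k.2) (k, j)
      (mem_summand_iff.2 ⟨h, hh, rfl⟩)
  rw [← sum_homogeneousComponent p, map_sum]
  exact Submodule.sum_mem _ fun m _ =>
    hle m (mem_harmonicProducts (by omega) m (homogeneousComponent_isHomogeneous m p))

/-- Different harmonic degrees are separated by the Casimir operator. For equal k the summands are
equivalent under SO(n), and only the circle, through the degree k + 2a, separates them. -/
lemma isIsotypicDecomposition_summand (hn : 3 ≤ n) (hlam : (n : ℝ) - 1 < lam) :
    IsIsotypicDecomposition (bergmanRep n lam) (fun k : ℕ × ℕ => summand n lam k.1 k.2) := by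
  have := completeSpace_bergman (n := n) (lam := lam) (by omega) hlam
  refine isIsotypicDecomposition_of_irreducible
    (fun k => isIrreducibleSubspace_summand hn hlam k.1 k.2) ?_
    (iSup_summand_orthogonal (by omega) hlam)
  rintro S ⟨k, a⟩ ⟨k', a'⟩ hne hS hSm v hv
  by_cases hk : k = k'
  · refine intertwiner_eq_zero_of_degree_ne (fun hd => hne ?_) hS hSm hv
    rw [hk, show a = a' by omega]
  · exact intertwiner_eq_zero_of_ne hn hk (fun A => hS (A, 1)) hSm hv

end Decomposition

-- Highest weights of the summands

section HighestWeights

open MvPolynomial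

variable {n : ℕ} {lam : ℝ}

lemma inWeightSpace_iff (hn : 2 ≤ n) (hlam : (n : ℝ) - 1 < lam) {k a : ℕ} (μ : CartanDual n)
    {p : MvPolynomial (Fin n) ℂ} (hp : p ∈ harmonic n k) :
    InWeightSpace (bergmanRepSO n lam) (summand n lam k a) μ
      (polyToBergman n lam (p * quad n ^ a)) ↔
      ∀ b, linDer (-cartanElement n b) p = μ b • p := by
  have hskew : ∀ b, (-cartanElement n b).transpose = -(-cartanElement n b) := fun b => by
    rw [Matrix.transpose_neg, cartanElement_transpose]
  refine (and_iff_right (mem_summand_iff.2 ⟨p, hp, rfl⟩)).trans (forall_congr' fun b => ?_)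
  rw [isComplexDifferential_polyToBergman_iff (cartanElement_transpose b),
    linDer_mul_quad_pow (hskew b), ← map_smul, ← smul_mul_assoc]
  exact ⟨fun h => (polyToBergman_mul_injective hn hlam a h).symm, fun h => by rw [h]⟩

lemma inWeightSpace_highest (hn : 2 ≤ n) (hlam : (n : ℝ) - 1 < lam) (k a : ℕ) :
    InWeightSpace (bergmanRepSO n lam) (summand n lam k a)
      ((k : ℂ) • coordFunctional n ⟨0, by omega⟩)
      (polyToBergman n lam ((X ⟨0, by omega⟩ - C Complex.I * X ⟨1, by omega⟩) ^ k *
        quad n ^ a)) :=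
  (inWeightSpace_iff hn hlam _ (highest_mem_harmonic hn k)).2
    (linDer_cartanElement_highest hn k)

lemma highest_vector_ne_zero (hn : 2 ≤ n) (hlam : (n : ℝ) - 1 < lam) (k a : ℕ) :
    polyToBergman n lam ((X ⟨0, by omega⟩ - C Complex.I * X ⟨1, by omega⟩) ^ k *
        quad n ^ a) ≠ 0 := fun h =>
  highest_ne_zero hn k (polyToBergman_mul_injective hn hlam a (h.trans (map_zero _).symm))

lemma isHighestWeight_summand (hn : 3 ≤ n) (hl : 0 < n / 2) (hlam : (n : ℝ) - 1 < lam) (k a : ℕ) :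
    IsHighestWeight (bergmanRepSO n lam) (summand n lam k a)
      ((k : ℂ) • coordFunctional n ⟨0, hl⟩) := by
  have hn2 : 2 ≤ n := by omega
  refine ⟨⟨_, highest_vector_ne_zero hn2 hlam k a, inWeightSpace_highest hn2 hlam k a⟩, ?_⟩
  rintro ν ⟨v, hv0, hv⟩
  obtain ⟨p, hp, rfl⟩ := mem_summand_iff.1 hv.1
  have hp0 : p ≠ 0 := by
    rintro rfl
    exact hv0 (by rw [zero_mul, map_zero])
  obtain ⟨m, hm, rfl⟩ := exists_weight_eq_sum hp.2 hp0 ((inWeightSpace_iff hn2 hlam ν hp).1 hv)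
  rw [← hm]
  exact weightLE_sum hn hl m

end HighestWeights

end BergmanIV

end

open BergmanIV

theorem proposition3p4 (n : ℕ) (hn : 3 ≤ n) (lam : ℝ) (hlam : (n : ℝ) - 1 < lam) :
    -- the isotypic decomposition under `SO(n) × SO(2)`
    IsIsotypicDecomposition (bergmanRep n lam) (fun k : ℕ × ℕ => summand n lam k.1 k.2) ∧
    -- the summands as modules over `SO(n)`
    (∀ k₁ k₂ : ℕ,
      IsIrreducibleSubspace (bergmanRepSO n lam) (summand n lam k₁ k₂) ∧
      IsModuleIso (harmonicRep n k₁) (bergmanRepSO n lam) (summand n lam k₁ k₂) ∧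
      UnitarilyEquivalent (bergmanRepSO n lam) (summand n lam k₁ 0) (summand n lam k₁ k₂) ∧
      IsHighestWeight (bergmanRepSO n lam) (summand n lam k₁ k₂)
        ((k₁ : ℂ) • coordFunctional n ⟨0, by omega⟩) ∧
      IsHighestWeightVector (bergmanRepSO n lam) (summand n lam k₁ k₂)
        (polyToBergman n lam
          ((MvPolynomial.X ⟨0, by omega⟩ -
            MvPolynomial.C Complex.I * MvPolynomial.X ⟨1, by omega⟩) ^ k₁ * quad n ^ k₂))) ∧
    -- the summands as modules over `SO(n) × SO(2)`
    (∀ k₁ k₂ : ℕ,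
      IsIrreducibleSubspace (bergmanRep n lam) (summand n lam k₁ k₂) ∧
      IsModuleIso (outerTensor (harmonicRep n k₁) (charRep (k₁ + 2 * k₂)))
        (bergmanRep n lam) (summand n lam k₁ k₂)) ∧
    -- the decomposition is multiplicity-free
    IsMultiplicityFree (bergmanRep n lam) (fun k : ℕ × ℕ => summand n lam k.1 k.2) := by
  have hn2 : 2 ≤ n := by omega
  have hdec := isIsotypicDecomposition_summand hn hlam
  exact ⟨hdec, fun k a => ⟨isIrreducibleSubspace_summand_SO hn hlam k a,
    isModuleIso_harmonicRep hn2 hlam k a, unitarilyEquivalent_summand hn hlam k 0 a,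
    isHighestWeight_summand hn (by omega) hlam k a, highest_vector_ne_zero hn2 hlam k a, _,
    isHighestWeight_summand hn (by omega) hlam k a, inWeightSpace_highest hn2 hlam k a⟩,
    fun k a => ⟨isIrreducibleSubspace_summand hn hlam k a,
      isModuleIso_outerTensor hn2 hlam k a⟩,
    hdec, fun k => isIrreducibleSubspace_summand hn hlam k.1 k.2⟩
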